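/- Let $B>0$, $\mu_0<0<\mu_1$, $\Lambda_0,\Lambda_1>0$. Consider the telegraph process $(A(t),s(t))_{t\ge 0}$ on $[0,B]$: the initial pair $(A(0),s(0))\in[0,B]\times\{0,1\}$ has an arbitrary law; the regime $s(t)$ switches from $0$ to $1$ at rate $\Lambda_0$ and from $1$ to $0$ at rate $\Lambda_1$ (independent exponential holding times, independent of the initial pair); in regime $s$ the point moves with velocity $\mu_s$, except that after reaching $B$ it stays at $B$ until the next switch to regime $0$; the process stops when $A$ becomes negative for the first time. For $s\in\{0,1\}$ put $$F_s(t,A)=P(\text{not stopped by time } t,\ A(t)\ge A,\ s(t)=s),\qquad L_s(t,\xi)=\int_0^B e^{-\xi A}F_s(t,A)\,dA ,$$ $\phi(t)=F_0(t,0)$, $\psi(t)=F_1(t,0)$, $\omega(t)=F_1(t,B)$. Notation. For $\xi\in\mathbb R$ let $q(\xi)=(\xi(\mu_0-\mu_1)+\Lambda_0-\Lambda_1)^2+4\Lambda_0\Lambda_1$ and $$n(\xi),\,m(\xi)=\tfrac12\bigl(-\mu_0\xi-\mu_1\xi-\Lambda_0-\Lambda_1\mp\sqrt{q(\xi)}\bigr).$$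 For a number $m>0$ (the Laplace variable) let $b=m\mu_0+m\mu_1+\Lambda_0\mu_1+\Lambda_1\mu_0$, $r=b^2-4\mu_0\mu_1m(m+\Lambda_0+\Lambda_1)$, $s=\sqrt r$, $U=b-s$, $W=b+s$, $$c_V=Vm+V\Lambda_1-2m^2\mu_0-4m\Lambda_1\mu_0-2\Lambda_0\Lambda_1\mu_1-2\Lambda_1^2\mu_0\quad(V\in\{U,W\}),\qquad S_1=c_W,\quad S_2=-c_U,$$ $e_V(x)=e^{Vx/(2\mu_0\mu_1)}$ and $D=e_W(B)S_2+e_U(B)S_1$. For given functions $l_0,l_1$ of $\xi$ and $c\in\mathbb R$ let $\mathrm{Sys}_m(l_0,l_1,c)$ be the linear system for two unknowns $\hat\psi,\hat\omega$ consisting of the equations, for $V=U$ and $V=W$, $$l_1\Bigl(-\tfrac{V}{2\mu_0\mu_1}\Bigr)=-\frac{(V-2m\mu_0-2\Lambda_1\mu_0)\,c}{2\Lambda_0\Lambda_1}+\mu_1e_V(B)\,\hat\omega+\frac{V-2m\mu_0-2\Lambda_1\mu_0}{2\Lambda_1\mu_0}\,l_0\Bigl(-\tfrac{V}{2\mu_0\mu_1}\Bigr)+\frac{c_V}{2\Lambda_0\Lambda_1}\,\hat\psi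 .$$ Then the following holds. 1. $q(\xi)>0$ for all $\xi\in\mathbb R$, and $r>0$, $S_2\ne0$, $D\ne0$ for all $m>0$. 2. For every $m>0$, $A\in[0,B]$ and $c\in\mathbb R$ each of the following systems has exactly one solution: (0) $\mathrm{Sys}_m(e^{-\xi A},0,0)$ (that is, $F_0(0,\cdot)=\delta_A$, $F_1(0,\cdot)=0$, $\psi(0)=0$): $$\hat\omega^0_A=\frac{\Lambda_0\,(U e_U(A)-W e_W(A))}{\mu_0D},\qquad \hat\psi^0_A=\frac{2\Lambda_0\Lambda_1\mu_1\hat\omega^0_A}{S_2}e_U(B)-\frac{\Lambda_0(m\mu_0-m\mu_1-\Lambda_0\mu_1+\Lambda_1\mu_0+s)}{S_2\mu_0}e_U(A);$$ (1) $\mathrm{Sys}_m(0,e^{-\xi A},0)$ (that is, $F_0(0,\cdot)=0$, $F_1(0,\cdot)=\delta_A$, $\psi(0)=0$): $$\hat\omega^1_A=\frac{e_W(A)S_2+e_U(A)S_1}{\mu_1D},\qquad \hat\psi^1_A=\frac{2\Lambda_0\Lambda_1\mu_1\hat\omega^1_A}{S_2}e_U(B)-\frac{2\Lambda_0\Lambda_1}{S_2}e_U(A);$$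 (2) $\mathrm{Sys}_m(0,0,c)$ (that is, $F_0(0,\cdot)=F_1(0,\cdot)=0$, $\psi(0)=c$): $$\hat\omega^2=\frac{2sc}{D},\qquad \hat\psi^2=\frac{-c(U-2m\mu_0-2\Lambda_1\mu_0)e_W(B)+c(W-2m\mu_0-2\Lambda_1\mu_0)e_U(B)}{D}.$$ 3. There are fundamental solutions in the time domain, depending only on $\mu_0,\mu_1,\Lambda_0,\Lambda_1,B$ (and, in case (2), on $c$), whose Laplace transforms in $t$ converge absolutely at every $m>0$ and have the values of part 2: functions $\psi^0_A,\omega^0_A,\psi^1_A,\psi^2_c,\omega^2_c$ on $[0,\infty)$ and measures $\omega^1_A(d\tau)$ on $[0,\infty)$ depending measurably on $A$. They are such that for every initial law, with $c=\psi(0)$, the following holds. (a) $\phi,\psi,\omega$ are locally integrable on $[0,\infty)$, and for every $m>0$ the transforms $\int_0^\infty e^{-m\tau}\psi(\tau)\,d\tau$ and $\int_0^\infty e^{-m\tau}\omega(\tau)\,d\tau$ converge absolutely and solve $\mathrm{Sys}_m(L_0(0,\cdot),L_1(0,\cdot),\psi(0))$. (b) For every $t\ge0$ (all integrands being integrable)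 $$\psi(t)=\int_0^B\psi^0_A(t)F_0(0,A)\,dA+\int_0^B\psi^1_A(t)F_1(0,A)\,dA+\psi^2_c(t),$$ and the corresponding superposition holds for $\omega$, as an identity of measures in time, that is, for every $t\ge0$ $$\int_0^t\omega(\tau)\,d\tau=\int_0^B\Bigl(\int_0^t\omega^0_A(\tau)\,d\tau\Bigr)F_0(0,A)\,dA+\int_0^B\omega^1_A([0,t])\,F_1(0,A)\,dA+\int_0^t\omega^2_c(\tau)\,d\tau .$$ (c) $\psi'+\Lambda_1\psi-\Lambda_0\phi=0$ holds in integrated form, $\psi(t)-\psi(0)+\int_0^t(\Lambda_1\psi-\Lambda_0\phi)\,d\tau=0$ for all $t\ge0$, and hence pointwise for almost every $t>0$ and at every $t>0$ at which $\phi$ is continuous. (d) For all $t\ge0$ and $\xi\in\mathbb R$, with $m=m(\xi)$, $n=n(\xi)$ and $\Pi_k(t)=\int_0^t\pi(\tau)e^{-k\tau}\,d\tau$ for $(\Pi,\pi)\in\{(\Phi,\phi),(\Psi,\psi),(\Omega,\omega)\}$, $$L_0(t,\xi)=\frac{G_m-G_n}{m-n},\qquad L_1(t,\xi)=\frac{H_m-H_n}{m-n},$$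 where for $k\in\{m,n\}$ $$G_k=e^{kt}\Bigl(\Lambda_1\bigl[L_1(0,\xi)+\mu_1\Psi_k(t)-\mu_1e^{-\xi B}\Omega_k(t)\bigr]+(\mu_1\xi+k+\Lambda_1)\bigl[L_0(0,\xi)+\mu_0\Phi_k(t)\bigr]\Bigr),$$ $$H_k=e^{kt}\Bigl(\Lambda_0\bigl[L_0(0,\xi)+\mu_0\Phi_k(t)\bigr]+(\mu_0\xi+k+\Lambda_0)\bigl[L_1(0,\xi)+\mu_1\Psi_k(t)-\mu_1e^{-\xi B}\Omega_k(t)\bigr]\Bigr).$$ -/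

import Mathlib

open Set MeasureTheory ProbabilityTheory

noncomputable section

namespace Telegraph

/-- The parameters of the process: velocities `μ 0 < 0 < μ 1` of the two regimes, the switching
rates `Λ 0` (from regime 0 to 1) and `Λ 1` (from regime 1 to 0), the length `B` of the domain. -/
structure Params where
  μ : Fin 2 → ℝ
  Λ : Fin 2 → ℝ
  B : ℝ
  μ_zero_neg : μ 0 < 0
  μ_one_pos : 0 < μ 1
  Λ_pos : ∀ i, 0 < Λ i
  B_pos : 0 < B

/-! ### The process -/

/-- The random input of a telegraph process on a probability space: an initial position in
`[0, B]`, an initial regime (with an arbitrary joint law), and, independent of them, independent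
standard exponential clocks. -/
structure Driver (p : Params) {Ω : Type*} [MeasurableSpace Ω] (P : Measure Ω) where
  x₀ : Ω → ℝ
  s₀ : Ω → Fin 2
  clock : ℕ → Ω → ℝ
  measurable_x₀ : Measurable x₀
  measurable_s₀ : Measurable s₀
  measurable_clock : ∀ k, Measurable (clock k)
  x₀_mem : ∀ ω, x₀ ω ∈ Icc 0 p.B
  law_clock : ∀ k, P.map (clock k) = expMeasure 1
  indep_clock : iIndepFun clock P
  indep_init : IndepFun (fun ω => (x₀ ω, s₀ ω)) (fun ω k => clock k ω) P

namespace Driver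

variable {p : Params} {Ω : Type*} [MeasurableSpace Ω] {P : Measure Ω} (X : Driver p P)

/-- The regime after the `k`-th switch. -/
def regimeSeq (ω : Ω) : ℕ → Fin 2
  | 0 => X.s₀ ω
  | k + 1 => 1 - regimeSeq ω k

/-- The time between the `k`-th and the `(k+1)`-st switch: exponential with rate `Λ i`, where `i`
is the current regime. -/
def holding (ω : Ω) (k : ℕ) : ℝ := X.clock k ω / p.Λ (X.regimeSeq ω k)

/-- The time of the `k`-th switch (`switchTime ω 0 = 0` is the start). -/
def switchTime (ω : Ω) (k : ℕ) : ℝ := ∑ j ∈ Finset.range k, X.holding ω j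

/-- The position at the `k`-th switch. Between switches the point moves with the velocity of the
regime; if it reaches `B` (only possible in regime 1), it stays there until the next switch. -/
def posSeq (ω : Ω) : ℕ → ℝ
  | 0 => X.x₀ ω
  | k + 1 => min p.B (posSeq ω k + p.μ (X.regimeSeq ω k) * X.holding ω k)

/-- The number of switches up to time `t`. -/
def switchCount (t : ℝ) (ω : Ω) : ℕ := sSup {k : ℕ | X.switchTime ω k ≤ t}

/-- The regime `s(t)`. -/
def regime (t : ℝ) (ω : Ω) : Fin 2 := X.regimeSeq ω (X.switchCount t ω)

/-- The position `A(t)` (meaningful as long as the process has not stopped). -/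
def pos (t : ℝ) (ω : Ω) : ℝ :=
  min p.B (X.posSeq ω (X.switchCount t ω) +
    p.μ (X.regime t ω) * (t - X.switchTime ω (X.switchCount t ω)))

/-- The process has not stopped by time `t`: the position has not become negative. -/
def Alive (t : ℝ) (ω : Ω) : Prop := ∀ u ∈ Icc 0 t, 0 ≤ X.pos u ω

/-- `F_s(t, a) = P(A(t) ≥ a, s(t) = s)`, the process not having stopped by time `t`. -/
def F (s : Fin 2) (t a : ℝ) : ℝ := P.real {ω | X.Alive t ω ∧ a ≤ X.pos t ω ∧ X.regime t ω = s}

/-- `L_s(t, ξ)`, the Laplace transform of `F_s(t, ·)` on `[0, B]`. -/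
def L (s : Fin 2) (t ξ : ℝ) : ℝ := ∫ a in (0 : ℝ)..p.B, Real.exp (-(ξ * a)) * X.F s t a

/-- The boundary function `φ(t) = F_0(t, 0)`. -/
def φ (t : ℝ) : ℝ := X.F 0 t 0

/-- The boundary function `ψ(t) = F_1(t, 0)`. -/
def ψ (t : ℝ) : ℝ := X.F 1 t 0

/-- The boundary function `ω(t) = F_1(t, B)`. -/
def ω (t : ℝ) : ℝ := X.F 1 t p.B

end Driver

/-! ### Laplace transforms in time -/

/-- The Laplace transform of the function `f` on `[0, ∞)` at `m`. -/
def laplace (f : ℝ → ℝ) (m : ℝ) : ℝ := ∫ t in Ioi (0 : ℝ), Real.exp (-(m * t)) * f t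

/-- `f` has, at `m`, an absolutely convergent Laplace transform with value `v`. -/
def HasLaplace (f : ℝ → ℝ) (m v : ℝ) : Prop :=
  IntegrableOn (fun t => Real.exp (-(m * t)) * f t) (Ioi 0) ∧ laplace f m = v

/-- The measure `ν` lives on `[0, ∞)` and has, at `m`, a convergent Laplace transform with
value `v`. -/
def HasLaplaceMeasure (ν : Measure ℝ) (m v : ℝ) : Prop :=
  ν (Iio 0) = 0 ∧ Integrable (fun t => Real.exp (-(m * t))) ν ∧
    ∫ t, Real.exp (-(m * t)) ∂ν = v

namespace Params

variable (p : Params)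

/-! ### The representation of `L_0`, `L_1` through the boundary functions -/

/-- The discriminant `q` as a function of `ξ`. -/
def q (ξ : ℝ) : ℝ :=
  ξ ^ 2 * p.μ 0 ^ 2 - 2 * ξ ^ 2 * p.μ 0 * p.μ 1 + ξ ^ 2 * p.μ 1 ^ 2
    + 2 * ξ * p.Λ 0 * p.μ 0 - 2 * ξ * p.Λ 0 * p.μ 1
    - 2 * ξ * p.Λ 1 * p.μ 0 + 2 * ξ * p.Λ 1 * p.μ 1
    + p.Λ 0 ^ 2 + 2 * p.Λ 0 * p.Λ 1 + p.Λ 1 ^ 2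

def n (ξ : ℝ) : ℝ := (-(p.μ 0 * ξ) - p.μ 1 * ξ - √(p.q ξ) - p.Λ 0 - p.Λ 1) / 2

def m (ξ : ℝ) : ℝ := (-(p.μ 0 * ξ) - p.μ 1 * ξ + √(p.q ξ) - p.Λ 0 - p.Λ 1) / 2

/-- `Π_k(t) = ∫_0^t π(τ) e^{-kτ} dτ`. -/
def partialLaplace (π : ℝ → ℝ) (k t : ℝ) : ℝ := ∫ τ in (0 : ℝ)..t, π τ * Real.exp (-(k * τ))

/-- The right-hand side of the formula for `L_0(t, ξ)`, in terms of the boundary functions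
`φ, ψ, ω` and of the initial values `l₀ = L_0(0, ξ)`, `l₁ = L_1(0, ξ)`. -/
def solL₀ (φ ψ ω : ℝ → ℝ) (l₀ l₁ t ξ : ℝ) : ℝ :=
  let m := p.m ξ
  let n := p.n ξ
  let em := Real.exp (m * t)
  let en := Real.exp (n * t);
  p.Λ 1 * p.μ 1 * Real.exp (-(ξ * p.B)) * en * partialLaplace ω n t / (-n + m)
  - p.Λ 1 * p.μ 1 * Real.exp (-(ξ * p.B)) * em * partialLaplace ω m t / (-n + m)
  + (-(p.μ 1 * partialLaplace ψ n t * p.Λ 1 / (-n + m))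
      - p.μ 0 * (ξ * p.μ 1 + n + p.Λ 1) * partialLaplace φ n t / (-n + m)) * en
  + (p.μ 1 * partialLaplace ψ m t * p.Λ 1 / (-n + m)
      + p.μ 0 * (ξ * p.μ 1 + m + p.Λ 1) * partialLaplace φ m t / (-n + m)) * em
  + (-(p.Λ 1 * en / (-n + m)) + p.Λ 1 * em / (-n + m)) * l₁
  + (-((ξ * p.μ 1 + n + p.Λ 1) * en / (-n + m))
      + (ξ * p.μ 1 + m + p.Λ 1) * em / (-n + m)) * l₀

/-- The right-hand side of the formula for `L_1(t, ξ)`. -/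
def solL₁ (φ ψ ω : ℝ → ℝ) (l₀ l₁ t ξ : ℝ) : ℝ :=
  let m := p.m ξ
  let n := p.n ξ
  let em := Real.exp (m * t)
  let en := Real.exp (n * t);
  -(partialLaplace ω m t * p.μ 1 * (p.μ 0 * ξ + m + p.Λ 0)
      * Real.exp (-(ξ * p.B) + m * t) / (-n + m))
  + p.μ 1 * (p.μ 0 * ξ + n + p.Λ 0) * Real.exp (-(ξ * p.B) + n * t)
      * partialLaplace ω n t / (-n + m)
  + (-(p.Λ 0 * p.μ 0 * partialLaplace φ n t / (-n + m))
      - p.μ 1 * (p.μ 0 * ξ + n + p.Λ 0) * partialLaplace ψ n t / (-n + m)) * en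
  + (p.Λ 0 * p.μ 0 * partialLaplace φ m t / (-n + m)
      + p.μ 1 * (p.μ 0 * ξ + m + p.Λ 0) * partialLaplace ψ m t / (-n + m)) * em
  + (em * p.Λ 0 / (-n + m) - en * p.Λ 0 / (-n + m)) * l₀
  + (-((p.μ 0 * ξ + n + p.Λ 0) * en / (-n + m))
      + (p.μ 0 * ξ + m + p.Λ 0) * em / (-n + m)) * l₁

/-- The discriminant `r`. From here on the argument `m > 0` is the Laplace variable. -/
def r (m : ℝ) : ℝ :=
  m ^ 2 * p.μ 0 ^ 2 - 2 * m ^ 2 * p.μ 0 * p.μ 1 + m ^ 2 * p.μ 1 ^ 2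
    - 2 * m * p.Λ 0 * p.μ 0 * p.μ 1 + 2 * m * p.Λ 0 * p.μ 1 ^ 2
    + 2 * m * p.Λ 1 * p.μ 0 ^ 2 - 2 * m * p.Λ 1 * p.μ 0 * p.μ 1
    + p.Λ 0 ^ 2 * p.μ 1 ^ 2 + 2 * p.Λ 0 * p.Λ 1 * p.μ 0 * p.μ 1 + p.Λ 1 ^ 2 * p.μ 0 ^ 2

def s (m : ℝ) : ℝ := √(p.r m)

def U (m : ℝ) : ℝ := m * p.μ 0 + m * p.μ 1 + p.Λ 0 * p.μ 1 + p.Λ 1 * p.μ 0 - p.s m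

def W (m : ℝ) : ℝ := m * p.μ 0 + m * p.μ 1 + p.Λ 0 * p.μ 1 + p.Λ 1 * p.μ 0 + p.s m

/-- One equation of the system, for `V = U` or `V = W`. Here `l₀ ξ = L_0(0, ξ)`,
`l₁ ξ = L_1(0, ξ)`, `c = ψ(0)`, and `Ψ`, `Θ` are the Laplace transforms of `ψ`, `ω` at `m`. -/
def SysEq (V m : ℝ) (l₀ l₁ : ℝ → ℝ) (c Ψ Θ : ℝ) : Prop :=
  l₁ (-(V / (2 * p.μ 0 * p.μ 1))) =
    -((-2 * m * p.μ 0 * c - 2 * p.μ 0 * c * p.Λ 1 + V * c) / (2 * p.Λ 0 * p.Λ 1))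
    + p.μ 1 * Real.exp (V * p.B / (2 * p.μ 0 * p.μ 1)) * Θ
    + (-2 * m * p.μ 0 - 2 * p.Λ 1 * p.μ 0 + V) / (2 * p.Λ 1 * p.μ 0)
        * l₀ (-(V / (2 * p.μ 0 * p.μ 1)))
    + (-2 * m ^ 2 * p.μ 0 - 4 * m * p.Λ 1 * p.μ 0 - 2 * p.Λ 0 * p.Λ 1 * p.μ 1
        - 2 * p.Λ 1 ^ 2 * p.μ 0 + V * m + V * p.Λ 1) * Ψ / (2 * p.Λ 0 * p.Λ 1)

/-- The linear system of two equations for the unknowns `Ψ`, `Θ`. -/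
def Sys (m : ℝ) (l₀ l₁ : ℝ → ℝ) (c Ψ Θ : ℝ) : Prop :=
  p.SysEq (p.U m) m l₀ l₁ c Ψ Θ ∧ p.SysEq (p.W m) m l₀ l₁ c Ψ Θ

/-- The Laplace transform `ξ ↦ e^{-ξa}` of the delta function at `a`. -/
def deltaHat (a ξ : ℝ) : ℝ := Real.exp (-(ξ * a))

/-! ### The explicit solutions -/

def S₁ (m : ℝ) : ℝ :=
  -2 * m ^ 2 * p.μ 0 - 4 * m * p.Λ 1 * p.μ 0 - 2 * p.Λ 0 * p.Λ 1 * p.μ 1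
    - 2 * p.Λ 1 ^ 2 * p.μ 0 + p.W m * m + p.W m * p.Λ 1

def S₂ (m : ℝ) : ℝ :=
  -(-2 * m ^ 2 * p.μ 0 - 4 * m * p.Λ 1 * p.μ 0 - 2 * p.Λ 0 * p.Λ 1 * p.μ 1
    - 2 * p.Λ 1 ^ 2 * p.μ 0 + p.U m * m + p.U m * p.Λ 1)

/-- `e^{U x / (2 μ₀ μ₁)}` -/
def eU (m x : ℝ) : ℝ := Real.exp (p.U m * x / (2 * p.μ 0 * p.μ 1))

/-- `e^{W x / (2 μ₀ μ₁)}` -/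
def eW (m x : ℝ) : ℝ := Real.exp (p.W m * x / (2 * p.μ 0 * p.μ 1))

/-- The common denominator. -/
def den (m : ℝ) : ℝ := p.eW m p.B * p.S₂ m + p.S₁ m * p.eU m p.B

/-- Laplace transform of `ω_A^0` at `m`, where `A = a`. -/
def ω₀Hat (m a : ℝ) : ℝ :=
  (p.eU m a * p.U m * p.Λ 0 - p.eW m a * p.W m * p.Λ 0) / (p.μ 0 * p.den m)

/-- Laplace transform of `ψ_A^0` at `m`, where `A = a`. -/
def ψ₀Hat (m a : ℝ) : ℝ :=
  2 * p.Λ 1 * p.Λ 0 * p.μ 1 * p.ω₀Hat m a / p.S₂ m * p.eU m p.B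
  - p.Λ 0 * (m * p.μ 0 - m * p.μ 1 - p.Λ 0 * p.μ 1 + p.Λ 1 * p.μ 0 + p.s m)
      / (p.S₂ m * p.μ 0) * p.eU m a

/-- Laplace transform of `ω_A^1` at `m`, where `A = a`. -/
def ω₁Hat (m a : ℝ) : ℝ :=
  (p.eW m a * p.S₂ m + p.eU m a * p.S₁ m) / (p.μ 1 * p.den m)

/-- Laplace transform of `ψ_A^1` at `m`, where `A = a`. -/
def ψ₁Hat (m a : ℝ) : ℝ :=
  2 * p.Λ 1 * p.Λ 0 * p.μ 1 * p.ω₁Hat m a / p.S₂ m * p.eU m p.B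
  - 2 * p.Λ 1 * p.Λ 0 / p.S₂ m * p.eU m a

/-- Laplace transform of `ω^2` at `m`, where `c = ψ(0)`. -/
def ω₂Hat (c m : ℝ) : ℝ := 2 * p.s m * c / p.den m

/-- Laplace transform of `ψ^2` at `m`, where `c = ψ(0)`. -/
def ψ₂Hat (c m : ℝ) : ℝ :=
  (-(c * (-2 * m * p.μ 0 - 2 * p.Λ 1 * p.μ 0 + p.U m) * p.eW m p.B)
    + c * (-2 * m * p.μ 0 - 2 * p.Λ 1 * p.μ 0 + p.W m) * p.eU m p.B) / p.den m

end Params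

/-- A family of fundamental solutions in the time domain. The arguments of `ψ⁰, ω⁰, ψ¹` are the
location `a` of the delta function and the time `t`; those of `ψ², ω²` are `c = ψ(0)` and `t`.
The solution `ω_A^1` has an atom in time (the arrival at `B` of a point that does not switch), so
that it is a measure in `t`, depending measurably on `a`. -/
structure FundamentalSolutions (p : Params) where
  ψ₀ : ℝ → ℝ → ℝ
  ω₀ : ℝ → ℝ → ℝ
  ψ₁ : ℝ → ℝ → ℝ
  ω₁ : Kernel ℝ ℝ
  ψ₂ : ℝ → ℝ → ℝ
  ω₂ : ℝ → ℝ → ℝ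
  integrable_ψ₀ : ∀ t, 0 ≤ t → IntegrableOn (fun a => ψ₀ a t) (Icc 0 p.B)
  integrable_ψ₁ : ∀ t, 0 ≤ t → IntegrableOn (fun a => ψ₁ a t) (Icc 0 p.B)
  integrable_ω₀ : ∀ t, 0 ≤ t →
    IntegrableOn (fun z : ℝ × ℝ => ω₀ z.1 z.2) (Icc 0 p.B ×ˢ Icc 0 t)
  integrable_ω₁ : ∀ t, 0 ≤ t → IntegrableOn (fun a => (ω₁ a).real (Icc 0 t)) (Icc 0 p.B)

end Telegraph

end

noncomputable section

open scoped ENNReal Topology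

namespace Telegraph

namespace Params

variable (p : Params)

/-! ### Algebra of the characteristic roots -/

/-! Equations. The expectation of `E_ξ(x) = ∫_0^x e^{-ξa} da` over the law of the position in regime
`s` is `L_s(t, ξ)`, because `E_ξ` is a mixture of the indicators `a ≤ x`. The forward equations of
the process therefore read `L_0' = μ₀(φ - ξ L_0) - Λ₀ L_0 + Λ₁ L_1` and `L_1' = μ₁(ψ - ξ L_1 -
e^{-ξB} ω) + Λ₀ L_0 - Λ₁ L_1`, and the constant test function in regime 1 gives `ψ' = Λ₀ φ - Λ₁ ψ`.
All are proved in integrated form (`evol_forward`, `lapl_forward_zero`, `lapl_forward_one`,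
`dist_forward`). The process enters only through `F_eq_dist`, which identifies its distribution
functions with averages of transition functions `evol`, built by recursion on the first switch.

Formula for `L_s`. If `k` is an eigenvalue of the 2×2 system at `ξ` (`IsRoot`), a left eigenvector
reduces it to a scalar equation, solved by variation of constants (`eigen_combination`). The
eigenvalues at `ξ` are `m(ξ)` and `n(ξ)`; subtracting the two scalar solutions isolates `L_0` or
`L_1` (`lapl_eq_sol`).

The linear system. Read the characteristic equation the other way: for given `m > 0` it is satisfied
by `ξ = -U/(2μ₀μ₁)` and `ξ = -W/(2μ₀μ₁)`. Since `L_s(·, ξ)` is bounded, `e^{-mt}` times the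
eigencombination tends to zero, which leaves a linear relation between the transforms of `φ, ψ, ω`.
Eliminating `φ` by the equation for `ψ` gives `Sys` (`sys_dist`). It is uniquely solvable because
`c_U < 0 < c_W`, so that its determinant is a positive multiple of `D > 0`.

Fundamental solutions. Let `G_i(x, t)` be `ψ(t)`, or `∫_0^t ω`, for the start at `x` in regime `i`.
Then `G_i(x, t) = G_i(0, t) + ∫_0^x g_i(b, t) db` with nonnegative `g_i`, and `G_0(0, t) = 0`.
Averaging over the initial law turns the indicator of `b ≤ x` into `F_i(0, b)`, which is the
superposition formula: `g_0` and `g_1` are the responses to delta functions, and `G_1(0, t)` is the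
response to `ψ(0)`. The derivatives are built along the recursion on the first switch
(`IsPrim.jump`, `isPrim_diff`). For `ω` the start in regime 1 produces an atom in time, so `∫_0^t ω`
is differentiated first and the density is extracted afterwards (`cumOmegaDiff_eq_past`).

Their transforms. For a deterministic start the system has the data `E_ξ(a) = ∫_0^a e^{-ξb} db`, so
by linearity its solution is the primitive of the explicit formulas (`laplace_evol`).
Differentiation in `a` identifies the transforms of `g_i` for almost every `a`. The equation of the
first switch makes these transforms continuous in `a`, and the identity then holds for every `a` in
`[0, B]` (`IsPrim.lap_eq`). -/

theorem q_eq (ξ : ℝ) : p.q ξ =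
    (ξ * (p.μ 0 - p.μ 1) + p.Λ 0 - p.Λ 1) ^ 2 + 4 * p.Λ 0 * p.Λ 1 := by
  unfold q; ring

theorem q_pos (ξ : ℝ) : 0 < p.q ξ := by
  rw [q_eq]
  have := mul_pos (p.Λ_pos 0) (p.Λ_pos 1)
  nlinarith [sq_nonneg (ξ * (p.μ 0 - p.μ 1) + p.Λ 0 - p.Λ 1)]

theorem n_lt_m (ξ : ℝ) : p.n ξ < p.m ξ := by
  have := Real.sqrt_pos.2 (p.q_pos ξ)
  unfold n m; linarith

/-- The characteristic equation at `(ξ, k)`. -/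
def IsRoot (ξ k : ℝ) : Prop :=
  (p.μ 0 * ξ + k + p.Λ 0) * (p.μ 1 * ξ + k + p.Λ 1) = p.Λ 0 * p.Λ 1

/-- For fixed `ξ` the characteristic equation is quadratic in `k`, with discriminant `q`. -/
theorem isRoot_m (ξ : ℝ) : p.IsRoot ξ (p.m ξ) := by
  have h := Real.sq_sqrt (p.q_pos ξ).le
  unfold IsRoot m
  unfold q at h ⊢
  linear_combination h / 4

theorem isRoot_n (ξ : ℝ) : p.IsRoot ξ (p.n ξ) := by
  have h := Real.sq_sqrt (p.q_pos ξ).le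
  unfold IsRoot n
  unfold q at h ⊢
  linear_combination h / 4

theorem r_eq (m : ℝ) : p.r m =
    (m * p.μ 0 + m * p.μ 1 + p.Λ 0 * p.μ 1 + p.Λ 1 * p.μ 0) ^ 2
      + 4 * (-p.μ 0) * p.μ 1 * (m * (m + p.Λ 0 + p.Λ 1)) := by
  unfold r; ring

theorem r_pos {m : ℝ} (hm : 0 < m) : 0 < p.r m := by
  rw [r_eq]
  have h0 := neg_pos.2 p.μ_zero_neg
  have h1 := p.μ_one_pos
  have := p.Λ_pos 0
  have := p.Λ_pos 1
  positivity

theorem s_pos {m : ℝ} (hm : 0 < m) : 0 < p.s m := Real.sqrt_pos.2 (p.r_pos hm)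

theorem s_sq {m : ℝ} (hm : 0 < m) : p.s m ^ 2 = p.r m := Real.sq_sqrt (p.r_pos hm).le

/-- `V` is one of the numbers `U`, `W`. -/
def IsUW (m V : ℝ) : Prop :=
  (V - 2 * p.μ 0 * (m + p.Λ 1)) * (V - 2 * p.μ 1 * (m + p.Λ 0))
    = 4 * p.μ 0 * p.μ 1 * p.Λ 0 * p.Λ 1

theorem isUW_U {m : ℝ} (hm : 0 < m) : p.IsUW m (p.U m) := by
  have h := p.s_sq hm
  unfold IsUW U
  unfold r at h
  linear_combination h

theorem isUW_W {m : ℝ} (hm : 0 < m) : p.IsUW m (p.W m) := by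
  have h := p.s_sq hm
  unfold IsUW W
  unfold r at h
  linear_combination h

/-- `IsUW` is the characteristic equation with the denominators cleared after the substitution `ξ =
-V/(2μ₀μ₁)`. This is the source of the two abscissas at which the linear system is evaluated. -/
theorem IsUW.isRoot {p : Params} {m V : ℝ} (h : p.IsUW m V) :
    p.IsRoot (-(V / (2 * p.μ 0 * p.μ 1))) m := by
  have h0 := p.μ_zero_neg.ne
  have h1 := p.μ_one_pos.ne'
  unfold IsUW at h
  unfold IsRoot
  field_simp
  linear_combination h

/-- The coefficient `c_V` of the system. -/
def coef (m V : ℝ) : ℝ := -2 * m ^ 2 * p.μ 0 - 4 * m * p.Λ 1 * p.μ 0 - 2 * p.Λ 0 * p.Λ 1 * p.μ 1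
    - 2 * p.Λ 1 ^ 2 * p.μ 0 + V * m + V * p.Λ 1

/-- By `s² = r` the product collapses to `-4Λ₀Λ₁μ₁² m(m + Λ₀ + Λ₁)`. Opposite signs together with
`c_U < c_W` give `S₁, S₂ > 0`, and `den` is then a sum of positive terms. -/
theorem coef_U_mul_coef_W {m : ℝ} (hm : 0 < m) : p.coef m (p.U m) * p.coef m (p.W m) < 0 := by
  have hs := p.s_sq hm
  have h1 := p.μ_one_pos
  have hΛ₀ := p.Λ_pos 0
  have hΛ₁ := p.Λ_pos 1
  have : p.coef m (p.U m) * p.coef m (p.W m) =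
      -(4 * p.Λ 0 * p.Λ 1 * p.μ 1 ^ 2 * (m * (m + p.Λ 0 + p.Λ 1))) := by
    unfold coef U W
    unfold r at hs
    linear_combination (-(m + p.Λ 1) ^ 2) * hs
  rw [this]
  have : 0 < 4 * p.Λ 0 * p.Λ 1 * p.μ 1 ^ 2 * (m * (m + p.Λ 0 + p.Λ 1)) := by positivity
  linarith

theorem coef_U_lt_coef_W {m : ℝ} (hm : 0 < m) : p.coef m (p.U m) < p.coef m (p.W m) := by
  have hs := p.s_pos hm
  have := p.Λ_pos 1
  have : 0 < p.s m * (m + p.Λ 1) := by positivity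
  unfold coef U W
  linarith

theorem S₁_eq (m : ℝ) : p.S₁ m = p.coef m (p.W m) := rfl

theorem S₂_eq (m : ℝ) : p.S₂ m = -p.coef m (p.U m) := rfl

theorem S₁_pos {m : ℝ} (hm : 0 < m) : 0 < p.S₁ m := by
  rw [S₁_eq]
  have h1 := p.coef_U_mul_coef_W hm
  have h2 := p.coef_U_lt_coef_W hm
  by_contra h
  nlinarith

theorem S₂_pos {m : ℝ} (hm : 0 < m) : 0 < p.S₂ m := by
  rw [S₂_eq]
  have h1 := p.coef_U_mul_coef_W hm
  have h2 := p.coef_U_lt_coef_W hm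
  by_contra h
  nlinarith

theorem den_pos {m : ℝ} (hm : 0 < m) : 0 < p.den m := by
  have h1 := p.S₁_pos hm
  have h2 := p.S₂_pos hm
  unfold den eU eW
  positivity

/-! ### The linear system -/

/-- Multiplication by `2Λ₀Λ₁` separates the unknowns from the data; solving the system and
integrating it over the data both use this form. -/
theorem sysEq_iff (V m : ℝ) (l₀ l₁ : ℝ → ℝ) (c Ψ Θ : ℝ) : p.SysEq V m l₀ l₁ c Ψ Θ ↔
    2 * p.Λ 0 * p.Λ 1 * p.μ 1 * Real.exp (V * p.B / (2 * p.μ 0 * p.μ 1)) * Θ + p.coef m V * Ψ =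
      2 * p.Λ 0 * p.Λ 1 * l₁ (-(V / (2 * p.μ 0 * p.μ 1)))
        + (-2 * m * p.μ 0 - 2 * p.Λ 1 * p.μ 0 + V) * c
        - p.Λ 0 / p.μ 0 * (-2 * m * p.μ 0 - 2 * p.Λ 1 * p.μ 0 + V)
          * l₀ (-(V / (2 * p.μ 0 * p.μ 1))) := by
  have h0 := p.μ_zero_neg.ne
  have hΛ₀ := (p.Λ_pos 0).ne'
  have hΛ₁ := (p.Λ_pos 1).ne'
  unfold SysEq coef
  generalize l₁ (-(V / (2 * p.μ 0 * p.μ 1))) = x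
  generalize l₀ (-(V / (2 * p.μ 0 * p.μ 1))) = y
  generalize Real.exp (V * p.B / (2 * p.μ 0 * p.μ 1)) = z
  have hN : 2 * p.Λ 0 * p.Λ 1 ≠ 0 := by positivity
  rw [← mul_right_inj' hN, ← sub_eq_zero, ← sub_eq_zero (a := _ + _)]
  refine Eq.congr ?_ rfl |>.trans neg_eq_zero
  field_simp
  ring

/-- Cramer's rule for the system, the first equation being used for back substitution. -/
theorem sys_iff {m : ℝ} (hm : 0 < m) (l₀ l₁ : ℝ → ℝ) (c Ψ Θ : ℝ) {RU RW : ℝ}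
    (hU : 2 * p.Λ 0 * p.Λ 1 * l₁ (-(p.U m / (2 * p.μ 0 * p.μ 1)))
        + (-2 * m * p.μ 0 - 2 * p.Λ 1 * p.μ 0 + p.U m) * c
        - p.Λ 0 / p.μ 0 * (-2 * m * p.μ 0 - 2 * p.Λ 1 * p.μ 0 + p.U m)
          * l₀ (-(p.U m / (2 * p.μ 0 * p.μ 1))) = RU)
    (hW : 2 * p.Λ 0 * p.Λ 1 * l₁ (-(p.W m / (2 * p.μ 0 * p.μ 1)))
        + (-2 * m * p.μ 0 - 2 * p.Λ 1 * p.μ 0 + p.W m) * c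
        - p.Λ 0 / p.μ 0 * (-2 * m * p.μ 0 - 2 * p.Λ 1 * p.μ 0 + p.W m)
          * l₀ (-(p.W m / (2 * p.μ 0 * p.μ 1))) = RW) :
    p.Sys m l₀ l₁ c Ψ Θ ↔
      Ψ = (2 * p.Λ 0 * p.Λ 1 * p.μ 1 * Θ * p.eU m p.B - RU) / p.S₂ m ∧
      Θ = (p.S₂ m * RW + p.S₁ m * RU) / (2 * p.Λ 0 * p.Λ 1 * p.μ 1 * p.den m) := by
  have hS := (p.S₂_pos hm).ne'
  have hD := (p.den_pos hm).ne'
  have hΛ₀ := (p.Λ_pos 0).ne'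
  have hΛ₁ := (p.Λ_pos 1).ne'
  have h1 := p.μ_one_pos.ne'
  rw [Sys, sysEq_iff, sysEq_iff, hU, hW, ← S₁_eq, ← neg_neg (p.coef m (p.U m)), ← S₂_eq,
    eq_div_iff hS, eq_div_iff (by positivity)]
  change (2 * p.Λ 0 * p.Λ 1 * p.μ 1 * p.eU m p.B * Θ + -p.S₂ m * Ψ = RU ∧
    2 * p.Λ 0 * p.Λ 1 * p.μ 1 * p.eW m p.B * Θ + p.S₁ m * Ψ = RW) ↔ _
  constructor
  · rintro ⟨h, h'⟩
    refine ⟨by linear_combination -h, ?_⟩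
    rw [den]
    -- The weights `S₂` and `S₁` eliminate `Ψ`; what multiplies `Θ` is `2Λ₀Λ₁μ₁` times `den`.
    linear_combination p.S₂ m * h' + p.S₁ m * h
  · rintro ⟨h, h'⟩
    rw [den] at h'
    refine ⟨by linear_combination -h, ?_⟩
    apply mul_left_cancel₀ hS
    linear_combination h' + p.S₁ m * h

theorem deltaHat_apply (a V : ℝ) : deltaHat a (-(V / (2 * p.μ 0 * p.μ 1))) =
    Real.exp (V * a / (2 * p.μ 0 * p.μ 1)) := by
  unfold deltaHat; congr 1; ring

theorem sys_delta_zero_iff {m : ℝ} (hm : 0 < m) (a Ψ Θ : ℝ) :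
    p.Sys m (deltaHat a) 0 0 Ψ Θ ↔ Ψ = p.ψ₀Hat m a ∧ Θ = p.ω₀Hat m a := by
  have hS := (p.S₂_pos hm).ne'
  have hD := (p.den_pos hm).ne'
  have hΛ₀ := (p.Λ_pos 0).ne'
  have hΛ₁ := (p.Λ_pos 1).ne'
  have h0 := p.μ_zero_neg.ne
  have h1 := p.μ_one_pos.ne'
  have hs := p.s_sq hm
  rw [p.sys_iff hm (deltaHat a) 0 0 Ψ Θ rfl rfl, deltaHat_apply, deltaHat_apply]
  change (Ψ = (2 * p.Λ 0 * p.Λ 1 * p.μ 1 * Θ * p.eU m p.B -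
    (2 * p.Λ 0 * p.Λ 1 * 0 + (-2 * m * p.μ 0 - 2 * p.Λ 1 * p.μ 0 + p.U m) * 0 -
      p.Λ 0 / p.μ 0 * (-2 * m * p.μ 0 - 2 * p.Λ 1 * p.μ 0 + p.U m) * p.eU m a)) / p.S₂ m ∧
    Θ = (p.S₂ m * (2 * p.Λ 0 * p.Λ 1 * 0 + (-2 * m * p.μ 0 - 2 * p.Λ 1 * p.μ 0 + p.W m) * 0 -
      p.Λ 0 / p.μ 0 * (-2 * m * p.μ 0 - 2 * p.Λ 1 * p.μ 0 + p.W m) * p.eW m a) +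
      p.S₁ m * (2 * p.Λ 0 * p.Λ 1 * 0 + (-2 * m * p.μ 0 - 2 * p.Λ 1 * p.μ 0 + p.U m) * 0 -
      p.Λ 0 / p.μ 0 * (-2 * m * p.μ 0 - 2 * p.Λ 1 * p.μ 0 + p.U m) * p.eU m a))
        / (2 * p.Λ 0 * p.Λ 1 * p.μ 1 * p.den m)) ↔ _
  have hΘ : (p.S₂ m * (2 * p.Λ 0 * p.Λ 1 * 0 + (-2 * m * p.μ 0 - 2 * p.Λ 1 * p.μ 0 + p.W m) * 0 -
      p.Λ 0 / p.μ 0 * (-2 * m * p.μ 0 - 2 * p.Λ 1 * p.μ 0 + p.W m) * p.eW m a) +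
      p.S₁ m * (2 * p.Λ 0 * p.Λ 1 * 0 + (-2 * m * p.μ 0 - 2 * p.Λ 1 * p.μ 0 + p.U m) * 0 -
      p.Λ 0 / p.μ 0 * (-2 * m * p.μ 0 - 2 * p.Λ 1 * p.μ 0 + p.U m) * p.eU m a))
        / (2 * p.Λ 0 * p.Λ 1 * p.μ 1 * p.den m) = p.ω₀Hat m a := by
    -- By `s² = r`, the product of `U - 2μ₀(m + Λ₁)` and `W - 2μ₀(m + Λ₁)` is `-4μ₀μ₁Λ₀Λ₁`. Hence
    -- each of `S₂`, `S₁` times its conjugate factor is a multiple of `W` or `U` alone.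
    have e1 : p.S₂ m * (-2 * m * p.μ 0 - 2 * p.Λ 1 * p.μ 0 + p.W m) =
        2 * p.Λ 1 * p.μ 1 * p.Λ 0 * p.W m := by
      unfold S₂ U W; unfold r at hs
      linear_combination (m + p.Λ 1) * hs
    have e2 : p.S₁ m * (-2 * m * p.μ 0 - 2 * p.Λ 1 * p.μ 0 + p.U m) =
        -(2 * p.Λ 1 * p.μ 1 * p.Λ 0 * p.U m) := by
      unfold S₁ U W; unfold r at hs
      linear_combination (-(m + p.Λ 1)) * hs
    rw [ω₀Hat, div_eq_div_iff (by positivity) (by positivity)]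
    field_simp
    linear_combination (-p.eW m a * p.Λ 0) * e1 - p.eU m a * p.Λ 0* e2
  rw [hΘ]
  refine and_congr_left fun h => ?_
  rw [h]
  have : (2 * p.Λ 0 * p.Λ 1 * p.μ 1 * p.ω₀Hat m a * p.eU m p.B -
    (2 * p.Λ 0 * p.Λ 1 * 0 + (-2 * m * p.μ 0 - 2 * p.Λ 1 * p.μ 0 + p.U m) * 0 -
      p.Λ 0 / p.μ 0 * (-2 * m * p.μ 0 - 2 * p.Λ 1 * p.μ 0 + p.U m) * p.eU m a)) / p.S₂ m
      = p.ψ₀Hat m a := by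
    rw [ψ₀Hat]
    field_simp
    unfold U
    ring
  rw [this]

theorem sys_delta_one_iff {m : ℝ} (hm : 0 < m) (a Ψ Θ : ℝ) :
    p.Sys m 0 (deltaHat a) 0 Ψ Θ ↔ Ψ = p.ψ₁Hat m a ∧ Θ = p.ω₁Hat m a := by
  have hS := (p.S₂_pos hm).ne'
  have hD := (p.den_pos hm).ne'
  have hΛ₀ := (p.Λ_pos 0).ne'
  have hΛ₁ := (p.Λ_pos 1).ne'
  have h1 := p.μ_one_pos.ne'
  rw [p.sys_iff hm 0 (deltaHat a) 0 Ψ Θ (RU := 2 * p.Λ 0 * p.Λ 1 * p.eU m a)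
    (RW := 2 * p.Λ 0 * p.Λ 1 * p.eW m a)
    (by rw [deltaHat_apply]; simp [eU]) (by rw [deltaHat_apply]; simp [eW])]
  have hΘ : (p.S₂ m * (2 * p.Λ 0 * p.Λ 1 * p.eW m a) + p.S₁ m * (2 * p.Λ 0 * p.Λ 1 * p.eU m a))
      / (2 * p.Λ 0 * p.Λ 1 * p.μ 1 * p.den m) = p.ω₁Hat m a := by
    rw [ω₁Hat]; field_simp
  rw [hΘ]
  refine and_congr_left fun h => ?_
  rw [h, ψ₁Hat]
  have : (2 * p.Λ 0 * p.Λ 1 * p.μ 1 * p.ω₁Hat m a * p.eU m p.B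
      - 2 * p.Λ 0 * p.Λ 1 * p.eU m a) / p.S₂ m =
      2 * p.Λ 1 * p.Λ 0 * p.μ 1 * p.ω₁Hat m a / p.S₂ m * p.eU m p.B
        - 2 * p.Λ 1 * p.Λ 0 / p.S₂ m * p.eU m a := by
    field_simp
  rw [this]

theorem sys_const_iff {m : ℝ} (hm : 0 < m) (c Ψ Θ : ℝ) :
    p.Sys m 0 0 c Ψ Θ ↔ Ψ = p.ψ₂Hat c m ∧ Θ = p.ω₂Hat c m := by
  have hS := (p.S₂_pos hm).ne'
  have hD := (p.den_pos hm).ne'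
  have hΛ₀ := (p.Λ_pos 0).ne'
  have hΛ₁ := (p.Λ_pos 1).ne'
  have h1 := p.μ_one_pos.ne'
  have hs := p.s_sq hm
  rw [p.sys_iff hm 0 0 c Ψ Θ (RU := (-2 * m * p.μ 0 - 2 * p.Λ 1 * p.μ 0 + p.U m) * c)
    (RW := (-2 * m * p.μ 0 - 2 * p.Λ 1 * p.μ 0 + p.W m) * c)
    (by simp) (by simp)]
  -- Since `c_V = (m + Λ₁)(V - 2μ₀(m + Λ₁)) - 2Λ₀Λ₁μ₁`, the products of the two factors cancel and
  -- only `W - U = 2s` survives; no relation for `s²` enters.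
  have key : p.S₂ m * (-2 * m * p.μ 0 - 2 * p.Λ 1 * p.μ 0 + p.W m)
      + p.S₁ m * (-2 * m * p.μ 0 - 2 * p.Λ 1 * p.μ 0 + p.U m) =
        4 * p.Λ 0 * p.Λ 1 * p.μ 1 * p.s m := by
    unfold S₁ S₂ U W; ring
  have hΘ : (p.S₂ m * ((-2 * m * p.μ 0 - 2 * p.Λ 1 * p.μ 0 + p.W m) * c) +
      p.S₁ m * ((-2 * m * p.μ 0 - 2 * p.Λ 1 * p.μ 0 + p.U m) * c))
      / (2 * p.Λ 0 * p.Λ 1 * p.μ 1 * p.den m) = p.ω₂Hat c m := by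
    rw [ω₂Hat, div_eq_div_iff (by positivity) (by positivity)]
    linear_combination c * p.den m * key
  rw [hΘ]
  refine and_congr_left fun h => ?_
  rw [h, ψ₂Hat, ω₂Hat]
  have : (2 * p.Λ 0 * p.Λ 1 * p.μ 1 * (2 * p.s m * c / p.den m) * p.eU m p.B
      - (-2 * m * p.μ 0 - 2 * p.Λ 1 * p.μ 0 + p.U m) * c) / p.S₂ m =
      (-(c * (-2 * m * p.μ 0 - 2 * p.Λ 1 * p.μ 0 + p.U m) * p.eW m p.B)
        + c * (-2 * m * p.μ 0 - 2 * p.Λ 1 * p.μ 0 + p.W m) * p.eU m p.B) / p.den m := by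
    rw [div_eq_div_iff hS hD]
    field_simp
    rw [den]
    linear_combination (-c * p.eU m p.B) * key
  rw [this]

end Params

/-- The integral of `g` over the past of `t`. -/
def past (g : ℝ → ℝ≥0∞) (t : ℝ) : ℝ≥0∞ := ∫⁻ s in Iic t, g s

/-- The test function equal to `h` in regime `j` and to zero in the other regime. -/
def onRegime (j : Fin 2) (h : ℝ → ℝ≥0∞) (i : Fin 2) (x : ℝ) : ℝ≥0∞ := if i = j then h x else 0

namespace Params

variable (p : Params)

/-! ### The transition functions, by the number of switches -/

/-- The density of the holding time in regime `i`. -/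
def dens (i : Fin 2) (τ : ℝ) : ℝ≥0∞ := exponentialPDF (p.Λ i) τ

/-- The probability of no switch during the time `τ ≥ 0` in regime `i`. -/
def tail (i : Fin 2) (τ : ℝ) : ℝ≥0∞ :=
  if 0 ≤ τ then ENNReal.ofReal (Real.exp (-(p.Λ i * τ))) else 0

/-- The position after the time `τ` spent in regime `i`, starting at `x`. -/
def flow (i : Fin 2) (x τ : ℝ) : ℝ := min p.B (x + p.μ i * τ)

/-- The indicator of survival during the time `τ` spent in regime `i`, starting at `x`. -/
def gate (i : Fin 2) (x τ : ℝ) : ℝ≥0∞ := if 0 ≤ x + p.μ i * τ then 1 else 0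

/-- The expectation of `g` at the first switch. -/
def jump (g : Fin 2 → ℝ → ℝ → ℝ≥0∞) (i : Fin 2) (x t : ℝ) : ℝ≥0∞ :=
  ∫⁻ τ, p.dens i τ * (p.gate i x τ * g (1 - i) (p.flow i x τ) (t - τ))

/-- The expectation of `f` at time `t`, on survival without any switch. -/
def free (f : Fin 2 → ℝ → ℝ≥0∞) (i : Fin 2) (x t : ℝ) : ℝ≥0∞ :=
  p.tail i t * (p.gate i x t * f i (p.flow i x t))

/-- The expectation of `f` at time `t`, on survival with exactly `n` switches. -/
def evolN (f : Fin 2 → ℝ → ℝ≥0∞) : ℕ → Fin 2 → ℝ → ℝ → ℝ≥0∞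
  | 0 => p.free f
  | n + 1 => p.jump (evolN f n)

/-- The expectation of `f` at time `t`, on survival, for the start at `x` in regime `i`. -/
def evol (f : Fin 2 → ℝ → ℝ≥0∞) (i : Fin 2) (x t : ℝ) : ℝ≥0∞ := ∑' n, p.evolN f n i x t

variable {p}

theorem measurable_dens (i : Fin 2) : Measurable (p.dens i) :=
  (measurable_exponentialPDFReal _).ennreal_ofReal

theorem dens_of_neg {i : Fin 2} {τ : ℝ} (h : τ < 0) : p.dens i τ = 0 := exponentialPDF_of_neg h

theorem dens_of_nonneg {i : Fin 2} {τ : ℝ} (h : 0 ≤ τ) :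
    p.dens i τ = ENNReal.ofReal (p.Λ i * Real.exp (-(p.Λ i * τ))) := exponentialPDF_of_nonneg h

theorem dens_eq_mul_tail (i : Fin 2) (τ : ℝ) :
    p.dens i τ = ENNReal.ofReal (p.Λ i) * p.tail i τ := by
  unfold tail
  split_ifs with h
  · rw [dens_of_nonneg h, ENNReal.ofReal_mul (p.Λ_pos i).le]
  · rw [dens_of_neg (not_le.1 h), mul_zero]

theorem measurable_tail (i : Fin 2) : Measurable (p.tail i) := by
  unfold tail
  exact Measurable.ite measurableSet_Ici (by fun_prop) measurable_const

theorem tail_of_neg {i : Fin 2} {τ : ℝ} (h : τ < 0) : p.tail i τ = 0 := if_neg (not_le.2 h)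

theorem tail_of_nonneg {i : Fin 2} {τ : ℝ} (h : 0 ≤ τ) :
    p.tail i τ = ENNReal.ofReal (Real.exp (-(p.Λ i * τ))) := if_pos h

theorem measurable_flow (i : Fin 2) : Measurable fun z : ℝ × ℝ => p.flow i z.1 z.2 := by
  unfold flow; fun_prop

theorem measurable_gate (i : Fin 2) : Measurable fun z : ℝ × ℝ => p.gate i z.1 z.2 := by
  unfold gate
  refine Measurable.ite (measurableSet_le measurable_const (by fun_prop)) measurable_const
    measurable_const

theorem gate_le_one (i : Fin 2) (x τ : ℝ) : p.gate i x τ ≤ 1 := by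
  unfold gate; split_ifs <;> simp

theorem gate_one {x τ : ℝ} (hx : 0 ≤ x) (hτ : 0 ≤ τ) : p.gate 1 x τ = 1 :=
  if_pos (add_nonneg hx (mul_nonneg p.μ_one_pos.le hτ))

theorem flow_mem {i : Fin 2} {x τ : ℝ} (h : 0 ≤ x + p.μ i * τ) : p.flow i x τ ∈ Icc 0 p.B :=
  ⟨le_min p.B_pos.le h, min_le_left _ _⟩

theorem flow_zero {x τ : ℝ} (hx : x ≤ p.B) (hτ : 0 ≤ τ) : p.flow 0 x τ = x + p.μ 0 * τ :=
  min_eq_right (by nlinarith [p.μ_zero_neg])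

section Measurability

variable {α : Type*} [MeasurableSpace α]

theorem measurable_jump {g : α → Fin 2 → ℝ → ℝ → ℝ≥0∞}
    (hg : ∀ j, Measurable fun z : α × ℝ × ℝ => g z.1 j z.2.1 z.2.2) (i : Fin 2) :
    Measurable fun z : α × ℝ × ℝ => p.jump (g z.1) i z.2.1 z.2.2 := by
  unfold jump
  refine Measurable.lintegral_prod_right' (f := fun w : (α × ℝ × ℝ) × ℝ =>
    p.dens i w.2 * (p.gate i w.1.2.1 w.2 *
      g w.1.1 (1 - i) (p.flow i w.1.2.1 w.2) (w.1.2.2 - w.2))) ?_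
  refine ((measurable_dens i).comp measurable_snd).mul (.mul ?_ ?_)
  · exact (measurable_gate i).comp (f := fun w : (α × ℝ × ℝ) × ℝ => (w.1.2.1, w.2)) (by fun_prop)
  · refine (hg (1 - i)).comp (f := fun w : (α × ℝ × ℝ) × ℝ =>
      (w.1.1, p.flow i w.1.2.1 w.2, w.1.2.2 - w.2)) ?_
    refine .prodMk (by fun_prop) (.prodMk ?_ (by fun_prop))
    exact (measurable_flow i).comp (f := fun w : (α × ℝ × ℝ) × ℝ => (w.1.2.1, w.2)) (by fun_prop)

theorem measurable_free {f : α → Fin 2 → ℝ → ℝ≥0∞}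
    (hf : ∀ j, Measurable fun z : α × ℝ => f z.1 j z.2) (i : Fin 2) :
    Measurable fun z : α × ℝ × ℝ => p.free (f z.1) i z.2.1 z.2.2 := by
  unfold free
  refine ((measurable_tail i).comp measurable_snd.snd).mul (.mul ?_ ?_)
  · exact (measurable_gate i).comp (f := fun w : α × ℝ × ℝ => (w.2.1, w.2.2)) (by fun_prop)
  · refine (hf i).comp (f := fun w : α × ℝ × ℝ => (w.1, p.flow i w.2.1 w.2.2)) ?_
    exact .prodMk (by fun_prop)
      ((measurable_flow i).comp (f := fun w : α × ℝ × ℝ => (w.2.1, w.2.2)) (by fun_prop))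

theorem measurable_evolN_param {f : α → Fin 2 → ℝ → ℝ≥0∞}
    (hf : ∀ j, Measurable fun z : α × ℝ => f z.1 j z.2) (n : ℕ) (i : Fin 2) :
    Measurable fun z : α × ℝ × ℝ => p.evolN (f z.1) n i z.2.1 z.2.2 := by
  induction n generalizing i with
  | zero => exact measurable_free hf i
  | succ n ih => exact measurable_jump (g := fun a => p.evolN (f a) n) ih i

theorem measurable_evol_param {f : α → Fin 2 → ℝ → ℝ≥0∞}
    (hf : ∀ j, Measurable fun z : α × ℝ => f z.1 j z.2) (i : Fin 2) :
    Measurable fun z : α × ℝ × ℝ => p.evol (f z.1) i z.2.1 z.2.2 :=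
  Measurable.tsum fun n => measurable_evolN_param hf n i

end Measurability

theorem measurable_evolN {f : Fin 2 → ℝ → ℝ≥0∞} (hf : ∀ j, Measurable (f j)) (n : ℕ) (i : Fin 2) :
    Measurable fun z : ℝ × ℝ => p.evolN f n i z.1 z.2 :=
  (measurable_evolN_param (α := Unit) (f := fun _ => f)
    (fun j => (hf j).comp measurable_snd) n i).comp (measurable_prodMk_left (x := ()))

theorem measurable_evol {f : Fin 2 → ℝ → ℝ≥0∞} (hf : ∀ j, Measurable (f j)) (i : Fin 2) :
    Measurable fun z : ℝ × ℝ => p.evol f i z.1 z.2 :=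
  Measurable.tsum fun n => measurable_evolN hf n i

theorem measurable_jump_integrand {g : Fin 2 → ℝ → ℝ → ℝ≥0∞}
    (hg : ∀ j, Measurable fun z : ℝ × ℝ => g j z.1 z.2) (i : Fin 2) (x : ℝ) :
    Measurable fun z : ℝ × ℝ =>
      p.dens i z.1 * (p.gate i x z.1 * g (1 - i) (p.flow i x z.1) (z.2 - z.1)) := by
  refine ((measurable_dens i).comp measurable_fst).mul (.mul ?_ ?_)
  · exact (measurable_gate i).comp (f := fun w : ℝ × ℝ => (x, w.1)) (by fun_prop)
  · refine (hg (1 - i)).comp (f := fun w : ℝ × ℝ => (p.flow i x w.1, w.2 - w.1)) ?_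
    refine .prodMk ?_ (by fun_prop)
    exact (measurable_flow i).comp (f := fun w : ℝ × ℝ => (x, w.1)) (by fun_prop)

theorem measurable_jump_integrand' {g : Fin 2 → ℝ → ℝ → ℝ≥0∞}
    (hg : ∀ j, Measurable fun z : ℝ × ℝ => g j z.1 z.2) (i : Fin 2) (x t : ℝ) :
    Measurable fun τ => p.dens i τ * (p.gate i x τ * g (1 - i) (p.flow i x τ) (t - τ)) :=
  (measurable_jump_integrand hg i x).comp (measurable_prodMk_right (y := t))

/-! ### Linearity -/

/-- Behind an open gate the flow lands in `[0, B]`, so values of `g` elsewhere are never seen. -/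
theorem jump_congr {g g' : Fin 2 → ℝ → ℝ → ℝ≥0∞} (i : Fin 2) (x t : ℝ)
    (h : ∀ y ∈ Icc 0 p.B, ∀ s, g (1 - i) y s = g' (1 - i) y s) :
    p.jump g i x t = p.jump g' i x t := by
  unfold jump
  congr! 3 with τ
  unfold gate
  split_ifs with hx
  · rw [h _ (flow_mem hx)]
  · simp

theorem jump_add {g g' : Fin 2 → ℝ → ℝ → ℝ≥0∞}
    (hg : ∀ j, Measurable fun z : ℝ × ℝ => g j z.1 z.2) (i : Fin 2) (x t : ℝ) :
    p.jump (fun j y s => g j y s + g' j y s) i x t = p.jump g i x t + p.jump g' i x t := by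
  unfold jump
  rw [← lintegral_add_left (measurable_jump_integrand' hg i x t)]
  simp only [mul_add]

/-- A switch at `τ` only delays `g`, and a translation absorbs the delay. Integrating from `-∞`
rather than from `0` makes this hold for every `τ` without case distinctions. -/
theorem jump_past {g : Fin 2 → ℝ → ℝ → ℝ≥0∞}
    (hg : ∀ j, Measurable fun z : ℝ × ℝ => g j z.1 z.2) (i : Fin 2) (x t : ℝ) :
    p.jump (fun j y => past (g j y)) i x t = past (p.jump g i x) t := by
  unfold past jump
  rw [lintegral_lintegral_swap (μ := volume.restrict (Iic t)) (f := fun s τ =>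
    p.dens i τ * (p.gate i x τ * g (1 - i) (p.flow i x τ) (s - τ)))
    ((measurable_jump_integrand hg i x).comp measurable_swap).aemeasurable]
  refine lintegral_congr fun τ => ?_
  have hm : Measurable fun s => g (1 - i) (p.flow i x τ) s :=
    (hg (1 - i)).comp measurable_prodMk_left
  rw [lintegral_const_mul _ (by fun_prop), lintegral_const_mul _ (by fun_prop)]
  congr 2
  beta_reduce
  rw [← lintegral_indicator measurableSet_Iic, ← lintegral_indicator measurableSet_Iic,
    ← lintegral_sub_right_eq_self _ τ]
  refine lintegral_congr fun s => ?_
  simp [indicator]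

theorem evolN_congr {f f' : Fin 2 → ℝ → ℝ≥0∞} (h : ∀ j, ∀ y ∈ Icc 0 p.B, f j y = f' j y) (n : ℕ)
    (i : Fin 2) (x t : ℝ) : p.evolN f n i x t = p.evolN f' n i x t := by
  induction n generalizing i x t with
  | zero =>
    change p.free f i x t = p.free f' i x t
    unfold free gate
    split_ifs with hx
    · rw [h _ _ (flow_mem hx)]
    · simp
  | succ n ih => exact jump_congr i x t fun y _ s => ih (1 - i) y s

theorem evol_congr {f f' : Fin 2 → ℝ → ℝ≥0∞} (h : ∀ j, ∀ y ∈ Icc 0 p.B, f j y = f' j y)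
    (i : Fin 2) (x t : ℝ) : p.evol f i x t = p.evol f' i x t :=
  tsum_congr fun n => evolN_congr h n i x t

/-- Each step of the recursion integrates against a nonnegative kernel, so Tonelli carries any
mixture of test functions through it. Additivity and homogeneity of `evol` are then special cases:
the counting measure on `Bool` and a multiple of a Dirac measure on `Unit`. -/
theorem evolN_lintegral {α : Type*} [MeasurableSpace α] (ν : Measure α) [SFinite ν]
    {f : α → Fin 2 → ℝ → ℝ≥0∞} (hf : ∀ j, Measurable fun z : α × ℝ => f z.1 j z.2) (n : ℕ)
    (i : Fin 2) (x t : ℝ) :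
    p.evolN (fun j y => ∫⁻ a, f a j y ∂ν) n i x t = ∫⁻ a, p.evolN (f a) n i x t ∂ν := by
  induction n generalizing i x t with
  | zero =>
    change p.free _ i x t = ∫⁻ a, p.free (f a) i x t ∂ν
    unfold free
    have hm : Measurable fun a => f a i (p.flow i x t) := (hf i).comp measurable_prodMk_right
    rw [lintegral_const_mul _ (by fun_prop), lintegral_const_mul _ (by fun_prop)]
  | succ n ih =>
    change ∫⁻ τ, _ = ∫⁻ a, (∫⁻ τ, _) ∂ν
    rw [lintegral_lintegral_swap]
    · refine lintegral_congr fun τ => ?_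
      have hm : Measurable fun a => p.evolN (f a) n (1 - i) (p.flow i x τ) (t - τ) :=
        (measurable_evolN_param hf n (1 - i)).comp
          (measurable_prodMk_right (y := (p.flow i x τ, t - τ)))
      rw [lintegral_const_mul _ (by fun_prop), lintegral_const_mul _ (by fun_prop), ih]
    · refine Measurable.aemeasurable ?_
      refine ((measurable_dens i).comp measurable_snd).mul (.mul ?_ ?_)
      · exact (measurable_gate i).comp (f := fun w : α × ℝ => (x, w.2)) (by fun_prop)
      · refine (measurable_evolN_param hf n (1 - i)).comp (f := fun w : α × ℝ =>
          (w.1, p.flow i x w.2, t - w.2)) ?_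
        refine .prodMk (by fun_prop) (.prodMk ?_ (by fun_prop))
        exact (measurable_flow i).comp (f := fun w : α × ℝ => (x, w.2)) (by fun_prop)

theorem evol_lintegral {α : Type*} [MeasurableSpace α] (ν : Measure α) [SFinite ν]
    {f : α → Fin 2 → ℝ → ℝ≥0∞} (hf : ∀ j, Measurable fun z : α × ℝ => f z.1 j z.2)
    (i : Fin 2) (x t : ℝ) :
    p.evol (fun j y => ∫⁻ a, f a j y ∂ν) i x t = ∫⁻ a, p.evol (f a) i x t ∂ν := by
  unfold evol
  have hm : ∀ n, Measurable fun a => p.evolN (f a) n i x t := fun n =>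
    (measurable_evolN_param hf n i).comp (measurable_prodMk_right (y := (x, t)))
  rw [lintegral_tsum fun n => (hm n).aemeasurable]
  exact tsum_congr fun n => evolN_lintegral ν hf n i x t

theorem evol_add {f g : Fin 2 → ℝ → ℝ≥0∞} (hf : ∀ j, Measurable (f j)) (hg : ∀ j, Measurable (g j))
    (i : Fin 2) (x t : ℝ) :
    p.evol (fun j y => f j y + g j y) i x t = p.evol f i x t + p.evol g i x t := by
  have h := evol_lintegral (p := p) (Measure.count : Measure Bool)
    (f := fun b j y => if b then f j y else g j y) (fun j => ?_) i x t
  · simpa [lintegral_count, tsum_bool, add_comm] using h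
  · exact measurable_from_prod_countable_right fun b => by cases b <;> simp <;> [exact hg j; exact hf j]

theorem evol_const_mul (c : ℝ≥0∞) {f : Fin 2 → ℝ → ℝ≥0∞} (hf : ∀ j, Measurable (f j))
    (i : Fin 2) (x t : ℝ) : p.evol (fun j y => c * f j y) i x t = c * p.evol f i x t := by
  have h := evol_lintegral (p := p) (c • Measure.dirac () : Measure Unit)
    (f := fun _ => f) (fun j => (hf j).comp measurable_snd) i x t
  simpa [mul_comm] using h

/-! ### Values at negative times and at time zero, and bounds -/

theorem evolN_of_neg (f : Fin 2 → ℝ → ℝ≥0∞) (n : ℕ) (i : Fin 2) (x : ℝ) {t : ℝ} (ht : t < 0) :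
    p.evolN f n i x t = 0 := by
  induction n generalizing i x t with
  | zero => change p.tail i t * _ = 0; rw [tail_of_neg ht, zero_mul]
  | succ n ih =>
    change ∫⁻ τ, _ = 0
    rw [← lintegral_zero (μ := (volume : Measure ℝ))]
    refine lintegral_congr fun τ => ?_
    rcases lt_or_ge τ 0 with h | h
    · rw [dens_of_neg h, zero_mul]
    · rw [ih _ _ (by linarith), mul_zero, mul_zero]

theorem evol_of_neg (f : Fin 2 → ℝ → ℝ≥0∞) (i : Fin 2) (x : ℝ) {t : ℝ} (ht : t < 0) :
    p.evol f i x t = 0 := by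
  unfold evol
  simp [evolN_of_neg f _ i x ht]

/-- Only the term without switches survives: a switch at `τ < 0` has density zero, and one at `τ >
0` leaves a negative remaining time. -/
theorem evol_zero (f : Fin 2 → ℝ → ℝ≥0∞) (i : Fin 2) {x : ℝ} (hx : x ∈ Icc 0 p.B) :
    p.evol f i x 0 = f i x := by
  unfold evol
  rw [tsum_eq_single 0]
  · change p.free f i x 0 = f i x
    unfold free tail gate flow
    simp [hx.1, hx.2]
  · intro n hn
    obtain ⟨n, rfl⟩ := Nat.exists_eq_succ_of_ne_zero hn
    change ∫⁻ τ, _ = 0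
    rw [← lintegral_zero (μ := (volume : Measure ℝ))]
    refine lintegral_congr_ae ?_
    filter_upwards [Measure.ae_ne volume (0 : ℝ)] with τ hτ
    rcases lt_or_gt_of_ne hτ with h | h
    · rw [dens_of_neg h, zero_mul]
    · rw [evolN_of_neg _ _ _ _ (by linarith), mul_zero, mul_zero]

/-- The terms with at least one switch contribute at most the probability `1 - e^{-Λt}` of a first
switch before `t`, the term without a switch at most `e^{-Λt}`. The induction on the truncation
carries the bound `0` at negative times, which restricts the first switch to `τ ≤ t`. -/
theorem evol_le_one {f : Fin 2 → ℝ → ℝ≥0∞} (hf : ∀ j, Measurable (f j)) (h1 : ∀ j y, f j y ≤ 1)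
    (i : Fin 2) (x t : ℝ) : p.evol f i x t ≤ 1 := by
  have key : ∀ (n : ℕ) (i : Fin 2) (x t : ℝ),
      ∑ k ∈ Finset.range n, p.evolN f k i x t ≤ if 0 ≤ t then 1 else 0 := by
    intro n
    induction n with
    | zero => simp
    | succ n ih =>
      intro i x t
      rw [Finset.sum_range_succ']
      have h : ∑ k ∈ Finset.range n, p.evolN f (k + 1) i x t ≤ ∫⁻ τ in Iic t, p.dens i τ := by
        change ∑ k ∈ Finset.range n, ∫⁻ τ, _ ≤ _
        rw [← lintegral_finsetSum _ fun k _ =>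
          measurable_jump_integrand' (measurable_evolN hf k) i x t,
          ← lintegral_indicator measurableSet_Iic]
        refine lintegral_mono fun τ => ?_
        rw [← Finset.mul_sum, ← Finset.mul_sum]
        refine (mul_le_mul_right (mul_le_mul' (gate_le_one i x τ) (ih _ _ _)) _).trans ?_
        by_cases hτ : τ ≤ t <;> simp [indicator, hτ]
      split_ifs with ht
      · have h0 : p.evolN f 0 i x t ≤ ENNReal.ofReal (Real.exp (-(p.Λ i * t))) := by
          change p.tail i t * _ ≤ _
          rw [tail_of_nonneg ht]
          calc _ ≤ ENNReal.ofReal (Real.exp (-(p.Λ i * t))) * (1 * 1) := by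
                gcongr
                exacts [gate_le_one _ _ _, h1 _ _]
            _ = _ := by simp
        refine (add_le_add h h0).trans ?_
        unfold dens
        rw [lintegral_exponentialPDF_eq_antiDeriv (p.Λ_pos i), if_pos ht,
          ← ENNReal.ofReal_add _ (Real.exp_pos _).le]
        · simp
        · have : Real.exp (-(p.Λ i * t)) ≤ 1 := by
            rw [Real.exp_le_one_iff]
            have := mul_nonneg (p.Λ_pos i).le ht
            linarith
          linarith
      · rw [evolN_of_neg f 0 i x (not_le.1 ht), add_zero]
        refine (Finset.sum_eq_zero fun k _ => evolN_of_neg f _ i x (not_le.1 ht)).le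
  refine ENNReal.tsum_le_of_sum_range_le fun n => (key n i x t).trans ?_
  split_ifs <;> simp

/-! ### The forward equations -/

theorem past_add {g : ℝ → ℝ≥0∞} (hg : Measurable g) (g' : ℝ → ℝ≥0∞) (t : ℝ) :
    past (fun s => g s + g' s) t = past g t + past g' t := by
  unfold past; exact lintegral_add_left hg _

theorem past_tsum {g : ℕ → ℝ → ℝ≥0∞} (hg : ∀ n, Measurable (g n)) (t : ℝ) :
    past (fun s => ∑' n, g n s) t = ∑' n, past (g n) t := by
  unfold past; exact lintegral_tsum fun n => (hg n).aemeasurable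

theorem past_of_neg {g : ℝ → ℝ≥0∞} (hg : ∀ s < 0, g s = 0) {t : ℝ} (ht : t < 0) :
    past g t = 0 := by
  unfold past
  rw [setLIntegral_congr_fun (g := fun _ => 0) measurableSet_Iic
    (fun s (hs : s ≤ t) => hg s (hs.trans_lt ht)), lintegral_zero]

theorem measurable_past {g : ℝ → ℝ → ℝ≥0∞} (hg : Measurable fun z : ℝ × ℝ => g z.1 z.2) :
    Measurable fun z : ℝ × ℝ => past (g z.1) z.2 := by
  have : (fun z : ℝ × ℝ => past (g z.1) z.2) =
      fun z : ℝ × ℝ => ∫⁻ s, if s ≤ z.2 then g z.1 s else 0 := by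
    funext z
    rw [past, ← lintegral_indicator measurableSet_Iic]
    rfl
  rw [this]
  refine Measurable.lintegral_prod_right' (f := fun w : (ℝ × ℝ) × ℝ =>
    if w.2 ≤ w.1.2 then g w.1.1 w.2 else 0) ?_
  exact Measurable.ite (measurableSet_le (by fun_prop) (by fun_prop))
    (hg.comp (f := fun w : (ℝ × ℝ) × ℝ => (w.1.1, w.2)) (by fun_prop)) measurable_const

/-- The forward equation: if it holds along the flow, with the gain `h` by a switch, then it holds
for the process. -/
theorem evol_forward {f a c h : Fin 2 → ℝ → ℝ≥0∞} (hf : ∀ j, Measurable (f j))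
    (ha : ∀ j, Measurable (a j)) (hc : ∀ j, Measurable (c j)) (hh : ∀ j, Measurable (h j))
    (hflow : ∀ i, ∀ x ∈ Icc 0 p.B, ∀ t, 0 ≤ t →
      p.free f i x t + past (p.free a i x) t = f i x + past (p.free c i x) t)
    (hgain : ∀ i y, ENNReal.ofReal (p.Λ i) * f (1 - i) y = h i y)
    (i : Fin 2) {x : ℝ} (hx : x ∈ Icc 0 p.B) {t : ℝ} (ht : 0 ≤ t) :
    p.evol f i x t + past (p.evol a i x) t =
      f i x + past (p.evol c i x) t + past (p.evol h i x) t := by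
  have mN : ∀ {g : Fin 2 → ℝ → ℝ≥0∞}, (∀ j, Measurable (g j)) → ∀ n i x,
      Measurable (p.evolN g n i x) := fun hg n i x =>
    (measurable_evolN hg n i).comp measurable_prodMk_left
  have mP : ∀ {g : Fin 2 → ℝ → ℝ≥0∞}, (∀ j, Measurable (g j)) → ∀ n i,
      Measurable fun z : ℝ × ℝ => past (p.evolN g n i z.1) z.2 := fun hg n i =>
    measurable_past (measurable_evolN hg n i)
  -- The initial value belongs to the term without switches. It is extended by zero to negative `t`,
  -- because under `jump` the identity is needed at all times `t - τ`.
  have h0 : ∀ i, ∀ x ∈ Icc 0 p.B, ∀ t, p.evolN f 0 i x t + past (p.evolN a 0 i x) t =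
      past (p.evolN c 0 i x) t + (if 0 ≤ t then f i x else 0) := by
    intro i x hx t
    split_ifs with ht
    · rw [add_comm (past _ _)]; exact hflow i x hx t ht
    · rw [not_le] at ht
      rw [evolN_of_neg _ _ _ _ ht, past_of_neg (fun s hs => evolN_of_neg _ _ _ _ hs) ht,
        past_of_neg (fun s hs => evolN_of_neg _ _ _ _ hs) ht]
  -- With at least one switch no initial value is left. Applying `jump` to the step function in
  -- `h0`, and writing the switching density as `Λ_i` times the survival probability, yields the
  -- accumulated gain `past (free h)`. Further applications of `jump` only raise the number of
  -- switches.
  have h1 : ∀ n i, ∀ x ∈ Icc 0 p.B, ∀ t, p.evolN f (n + 1) i x t + past (p.evolN a (n + 1) i x) t =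
      past (p.evolN c (n + 1) i x) t + past (p.evolN h n i x) t := by
    intro n
    induction n with
    | zero =>
      intro i x hx t
      change p.jump (p.evolN f 0) i x t + past (p.jump (p.evolN a 0) i x) t =
        past (p.jump (p.evolN c 0) i x) t + past (p.free h i x) t
      rw [← jump_past (measurable_evolN ha 0), ← jump_add (measurable_evolN hf 0),
        ← jump_past (measurable_evolN hc 0), jump_congr i x t (fun y hy s => h0 (1 - i) y hy s)
          (g' := fun j y s => past (p.evolN c 0 j y) s + if 0 ≤ s then f j y else 0),
        jump_add (mP hc 0)]
      congr 1
      unfold jump past free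
      rw [← lintegral_indicator measurableSet_Iic]
      refine lintegral_congr fun τ => ?_
      rw [dens_eq_mul_tail]
      by_cases hτ : τ ≤ t
      · simp only [sub_nonneg, hτ, if_true, mem_Iic, indicator_of_mem, ← hgain]
        ring
      · simp [hτ]
    | succ n ih =>
      intro i x hx t
      change p.jump (p.evolN f (n + 1)) i x t + past (p.jump (p.evolN a (n + 1)) i x) t =
        past (p.jump (p.evolN c (n + 1)) i x) t + past (p.jump (p.evolN h n) i x) t
      rw [← jump_past (measurable_evolN ha _), ← jump_add (measurable_evolN hf _),
        ← jump_past (measurable_evolN hc _), ← jump_past (measurable_evolN hh _),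
        ← jump_add (mP hc _)]
      exact jump_congr i x t fun y hy s => ih (1 - i) y hy s
  unfold evol
  rw [past_tsum fun n => mN ha n i x, past_tsum fun n => mN hc n i x,
    past_tsum fun n => mN hh n i x, ← ENNReal.tsum_add, tsum_eq_zero_add' ENNReal.summable,
    tsum_eq_zero_add' (f := fun n => past (p.evolN c n i x) t) ENNReal.summable, h0 i x hx t,
    if_pos ht, tsum_congr fun n => h1 n i x hx t, ENNReal.tsum_add]
  ring

end Params

/-! ### Calculus for nonnegative functions of time -/

theorem past_eq_setLIntegral_Ioc {g : ℝ → ℝ≥0∞} (hg : ∀ s < 0, g s = 0) {t : ℝ} (ht : 0 ≤ t) :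
    past g t = ∫⁻ s in Ioc 0 t, g s := by
  unfold past
  rw [← Iic_union_Ioc_eq_Iic ht, lintegral_union measurableSet_Ioc
    (disjoint_left.2 fun x (hx : x ∈ Iic 0) hx' => (not_lt.2 hx) hx'.1),
    setLIntegral_congr Iio_ae_eq_Iic.symm,
    setLIntegral_congr_fun (g := fun _ => 0) measurableSet_Iio (fun s hs => hg s hs)]
  simp

theorem setLIntegral_Ioc_add {g : ℝ → ℝ≥0∞} {a b c : ℝ} (hab : a ≤ b) (hbc : b ≤ c) :
    ∫⁻ s in Ioc a c, g s = (∫⁻ s in Ioc a b, g s) + ∫⁻ s in Ioc b c, g s := by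
  rw [← Ioc_union_Ioc_eq_Ioc hab hbc, lintegral_union measurableSet_Ioc
    (disjoint_left.2 fun x hx hx' => (not_lt.2 hx.2) hx'.1)]

/-- The fundamental theorem of calculus, the derivative being a difference of two nonnegative
functions. -/
theorem ofReal_add_setLIntegral_eq {G g' g : ℝ → ℝ} {a b : ℝ} (hab : a ≤ b)
    (hG : ∀ s ∈ Icc a b, HasDerivAt G (g s - g' s) s) (hg : ContinuousOn g (Icc a b))
    (hg' : ContinuousOn g' (Icc a b))
    (hg0 : ∀ s ∈ Icc a b, 0 ≤ g s) (hg'0 : ∀ s ∈ Icc a b, 0 ≤ g' s)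
    (ha : 0 ≤ G a) (hb : 0 ≤ G b) :
    ENNReal.ofReal (G b) + ∫⁻ s in Ioc a b, ENNReal.ofReal (g' s) =
      ENNReal.ofReal (G a) + ∫⁻ s in Ioc a b, ENNReal.ofReal (g s) := by
  have hi : IntervalIntegrable g volume a b := hg.intervalIntegrable_of_Icc hab
  have hi' : IntervalIntegrable g' volume a b := hg'.intervalIntegrable_of_Icc hab
  have h0 : 0 ≤ᵐ[volume.restrict (Ioc a b)] g :=
    (ae_restrict_iff' measurableSet_Ioc).2 (.of_forall fun s hs => hg0 s ⟨hs.1.le, hs.2⟩)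
  have h0' : 0 ≤ᵐ[volume.restrict (Ioc a b)] g' :=
    (ae_restrict_iff' measurableSet_Ioc).2 (.of_forall fun s hs => hg'0 s ⟨hs.1.le, hs.2⟩)
  rw [← ofReal_integral_eq_lintegral_ofReal hi.1 h0, ← ofReal_integral_eq_lintegral_ofReal hi'.1 h0',
    ← ENNReal.ofReal_add hb (integral_nonneg_of_ae h0'),
    ← ENNReal.ofReal_add ha (integral_nonneg_of_ae h0),
    ← intervalIntegral.integral_of_le hab, ← intervalIntegral.integral_of_le hab]
  congr 1
  have := intervalIntegral.integral_eq_sub_of_hasDerivAt (f := G) (a := a) (b := b)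
    (f' := fun s => g s - g' s)
    (fun s hs => hG s (by rwa [uIcc_of_le hab] at hs)) (hi.sub hi')
  rw [intervalIntegral.integral_sub hi hi'] at this
  linarith

/-! ### Forward equations in the two regimes -/

namespace Params

variable {p : Params}

theorem measurable_onRegime {h : ℝ → ℝ≥0∞} (hh : Measurable h) (j i : Fin 2) :
    Measurable (onRegime j h i) := by
  unfold onRegime
  by_cases hij : i = j
  · simpa only [hij, if_true] using hh
  · simp only [hij, if_false]; exact measurable_const

theorem free_onRegime_self (i : Fin 2) (h : ℝ → ℝ≥0∞) (x t : ℝ) :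
    p.free (onRegime i h) i x t = p.tail i t * (p.gate i x t * h (p.flow i x t)) := by
  simp [free, onRegime]

theorem free_onRegime_of_ne {i j : Fin 2} (hij : i ≠ j) (h : ℝ → ℝ≥0∞) (x t : ℝ) :
    p.free (onRegime j h) i x t = 0 := by
  simp [free, onRegime, hij]

theorem free_of_neg (f : Fin 2 → ℝ → ℝ≥0∞) (i : Fin 2) (x : ℝ) {s : ℝ} (hs : s < 0) :
    p.free f i x s = 0 := evolN_of_neg f 0 i x hs

theorem hasDerivAt_exp_mul_comp {E e : ℝ → ℝ} (hE : ∀ x, HasDerivAt E (e x) x) (l v x s : ℝ) :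
    HasDerivAt (fun s => Real.exp (-(l * s)) * E (x + v * s))
      (Real.exp (-(l * s)) * (v * e (x + v * s)) - Real.exp (-(l * s)) * (l * E (x + v * s))) s := by
  have h1 : HasDerivAt (fun s : ℝ => -(l * s)) (-l) s := by
    convert! ((hasDerivAt_id s).const_mul l).neg using 1; simp
  have h2 : HasDerivAt (fun s => x + v * s) v s := by
    simpa using ((hasDerivAt_id s).const_mul v).const_add x
  convert! h1.exp.mul ((hE (x + v * s)).comp s h2) using 1
  simp only [Function.comp_apply]
  ring

/-- The forward equation in regime 0. -/
theorem evol_forward_zero {E e : ℝ → ℝ} (hE : ∀ x, HasDerivAt E (e x) x) (he : Continuous e)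
    (hE0 : E 0 = 0) (hE_nonneg : ∀ x, 0 ≤ x → 0 ≤ E x) (he_nonneg : ∀ x, 0 ≤ x → 0 ≤ e x)
    (i : Fin 2) {x : ℝ} (hx : x ∈ Icc 0 p.B) {t : ℝ} (ht : 0 ≤ t) :
    p.evol (onRegime 0 fun y => ENNReal.ofReal (E y)) i x t
      + past (p.evol (onRegime 0 fun y => ENNReal.ofReal (-p.μ 0 * e y + p.Λ 0 * E y)) i x) t =
    onRegime 0 (fun y => ENNReal.ofReal (E y)) i x
      + past (p.evol (onRegime 1 fun y => ENNReal.ofReal (p.Λ 1) * ENNReal.ofReal (E y)) i x) t := by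
  have hEc : Continuous E := continuous_iff_continuousAt.2 fun x => (hE x).continuousAt
  have hz : ∀ i x t, past (p.evol (fun _ _ => 0) i x) t = 0 := fun i x t => by
    have : p.evol (fun _ _ => 0) i x = fun _ => 0 := by
      funext s
      simpa using evol_const_mul (p := p) 0 (f := fun _ _ => 0) (fun _ => measurable_const) i x s
    rw [this, past, lintegral_zero]
  -- In regime 0 the drift decreases `E`, so `-μ₀ e` joins `Λ₀ E` on the loss side and nothing is
  -- gained along the flow.
  have := evol_forward (p := p) (f := onRegime 0 fun y => ENNReal.ofReal (E y))
    (a := onRegime 0 fun y => ENNReal.ofReal (-p.μ 0 * e y + p.Λ 0 * E y)) (c := fun _ _ => 0)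
    (h := onRegime 1 fun y => ENNReal.ofReal (p.Λ 1) * ENNReal.ofReal (E y))
    (measurable_onRegime (by fun_prop) 0) (measurable_onRegime (by fun_prop) 0)
    (fun _ => measurable_const) (measurable_onRegime (by fun_prop) 1) ?_ ?_ i hx ht
  · rw [this, hz, add_zero]
  · intro i x hx t ht
    have hc0 : ∀ i x, past (p.free (fun _ _ => 0) i x) t = 0 := by simp [free, past]
    rw [hc0, add_zero]
    by_cases hi : i = 0
    swap
    · have : p.free (onRegime 0 fun y => ENNReal.ofReal (-p.μ 0 * e y + p.Λ 0 * E y)) i x =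
        fun _ => 0 := funext fun s => free_onRegime_of_ne hi _ x s
      rw [free_onRegime_of_ne hi, this]
      simp [onRegime, past, hi]
    subst hi
    have hμ := p.μ_zero_neg
    -- `x / -μ₀` is the exit time through `0`. If it precedes `t`, the value of `E` at the exit is
    -- `E 0 = 0`, so that stopping the point causes no loss beyond the drift and switching terms.
    have hT : 0 ≤ min t (x / -p.μ 0) := le_min ht (div_nonneg hx.1 (by linarith))
    have hgate : ∀ s, 0 ≤ x + p.μ 0 * s ↔ s ≤ x / -p.μ 0 := fun s => by
      rw [le_div_iff₀ (by linarith)]; constructor <;> intro h <;> linarith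
    have key := ofReal_add_setLIntegral_eq (a := 0) (b := min t (x / -p.μ 0))
      (G := fun s => Real.exp (-(p.Λ 0 * s)) * E (x + p.μ 0 * s)) (g := fun _ => 0)
      (g' := fun s => Real.exp (-(p.Λ 0 * s)) *
        (-p.μ 0 * e (x + p.μ 0 * s) + p.Λ 0 * E (x + p.μ 0 * s))) hT
      (fun s _ => by
        convert! hasDerivAt_exp_mul_comp hE (p.Λ 0) (p.μ 0) x s using 1; ring)
      (by fun_prop) (by fun_prop) (by simp)
      (fun s hs => by
        have h1 := (hgate s).2 (hs.2.trans (min_le_right _ _))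
        have h2 := hE_nonneg _ h1
        have h3 := he_nonneg _ h1
        have h4 := (p.Λ_pos 0).le
        have h5 : 0 ≤ -p.μ 0 := by linarith
        positivity)
      (by simpa using hE_nonneg x hx.1)
      (mul_nonneg (Real.exp_pos _).le (hE_nonneg _ ((hgate _).2 (min_le_right _ _))))
    simp only [mul_zero, neg_zero, Real.exp_zero, one_mul, add_zero, ENNReal.ofReal_zero,
      lintegral_zero] at key
    simp only [onRegime, if_true]
    rw [← key]
    congr 1
    · rw [free_onRegime_self, tail_of_nonneg ht, flow_zero hx.2 ht]
      simp only [gate, hgate]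
      split_ifs with h
      · rw [min_eq_left h, one_mul, ENNReal.ofReal_mul (Real.exp_pos _).le]
      · rw [min_eq_right (not_le.1 h).le]
        have : x + p.μ 0 * (x / -p.μ 0) = 0 := by
          rw [div_neg, mul_neg, mul_div_cancel₀ _ hμ.ne, add_neg_cancel]
        rw [this, hE0]; simp
    · rw [past_eq_setLIntegral_Ioc (fun s hs => free_of_neg _ _ _ hs) ht,
        setLIntegral_Ioc_add hT (min_le_left _ _), setLIntegral_congr_fun (s := Ioc (min _ _) _)
          (g := fun _ => 0) measurableSet_Ioc, lintegral_zero, add_zero]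
      · refine setLIntegral_congr_fun measurableSet_Ioc fun s hs => ?_
        have hs2 := hs.2.trans (min_le_right _ _)
        simp only [free_onRegime_self, tail_of_nonneg hs.1.le, flow_zero hx.2 hs.1.le, gate,
          (hgate s).2 hs2, if_true, one_mul]
        rw [ENNReal.ofReal_mul (Real.exp_pos _).le]
      · intro s hs
        have : ¬ 0 ≤ x + p.μ 0 * s := by
          rw [hgate]
          intro h
          exact (not_lt.2 (le_min hs.2 h)) hs.1
        simp [free, gate, this]
  · intro i y
    fin_cases i <;> simp [onRegime]

/-- The forward equation in regime 1. -/
theorem evol_forward_one {E e : ℝ → ℝ} (hE : ∀ x, HasDerivAt E (e x) x) (he : Continuous e)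
    (hE_nonneg : ∀ x, 0 ≤ x → 0 ≤ E x) (he_nonneg : ∀ x, 0 ≤ x → 0 ≤ e x)
    (i : Fin 2) {x : ℝ} (hx : x ∈ Icc 0 p.B) {t : ℝ} (ht : 0 ≤ t) :
    p.evol (onRegime 1 fun y => ENNReal.ofReal (E y)) i x t
      + past (p.evol (onRegime 1 fun y => ENNReal.ofReal (p.Λ 1 * E y)) i x) t =
    onRegime 1 (fun y => ENNReal.ofReal (E y)) i x
      + past (p.evol (onRegime 1 fun y => if y < p.B then ENNReal.ofReal (p.μ 1 * e y) else 0) i x) t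
      + past (p.evol (onRegime 0 fun y => ENNReal.ofReal (p.Λ 0) * ENNReal.ofReal (E y)) i x) t := by
  have hEc : Continuous E := continuous_iff_continuousAt.2 fun x => (hE x).continuousAt
  have hem : Measurable fun y => if y < p.B then ENNReal.ofReal (p.μ 1 * e y) else 0 :=
    Measurable.ite measurableSet_Iio (by fun_prop) measurable_const
  refine evol_forward (measurable_onRegime (by fun_prop) 1) (measurable_onRegime (by fun_prop) 1)
    (measurable_onRegime hem 1) (measurable_onRegime (by fun_prop) 0) ?_ ?_ i hx ht
  · intro i x hx t ht
    by_cases hi : i = 1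
    swap
    · have h : ∀ h : ℝ → ℝ≥0∞, past (p.free (onRegime 1 h) i x) t = 0 := fun h => by
        have : p.free (onRegime 1 h) i x = fun _ => 0 :=
          funext fun s => free_onRegime_of_ne hi _ x s
        rw [this, past, lintegral_zero]
      rw [free_onRegime_of_ne hi, h, h]
      simp [onRegime, hi]
    subst hi
    have hμ := p.μ_one_pos
    have hΛ := (p.Λ_pos 1).le
    -- The time of reaching `B`, capped at `t`. The path is treated separately on `[0, T]`, where it
    -- moves, and on `(T, t]`, where it rests at `B`.
    set T := min t ((p.B - x) / p.μ 1) with hTdef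
    have hT : 0 ≤ T := le_min ht (div_nonneg (by linarith [hx.2]) hμ.le)
    have hTt : T ≤ t := min_le_left _ _
    have hlt : ∀ s, x + p.μ 1 * s < p.B ↔ s < (p.B - x) / p.μ 1 := fun s => by
      rw [lt_div_iff₀ hμ]; constructor <;> intro h <;> linarith
    have hle : ∀ s ∈ Icc 0 T, x + p.μ 1 * s ≤ p.B := fun s hs => by
      have := (le_div_iff₀ hμ).1 (hs.2.trans (min_le_right _ _)); linarith
    have hpos : ∀ s, 0 ≤ s → 0 ≤ x + p.μ 1 * s := fun s hs => by
      have := hx.1; positivity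
    have hflow1 : ∀ s ∈ Icc 0 T, p.flow 1 x s = x + p.μ 1 * s := fun s hs =>
      min_eq_right (hle s hs)
    have hflow2 : ∀ s ∈ Ioc T t, p.flow 1 x s = p.B ∧ ¬ x + p.μ 1 * s < p.B := fun s hs => by
      have h : ¬ x + p.μ 1 * s < p.B := by
        rw [hlt]; intro h; exact (not_lt.2 (le_min hs.2 h.le)) hs.1
      exact ⟨min_eq_left (not_lt.1 h), h⟩
    have key := ofReal_add_setLIntegral_eq (a := 0) (b := T)
      (G := fun s => Real.exp (-(p.Λ 1 * s)) * E (x + p.μ 1 * s))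
      (g := fun s => Real.exp (-(p.Λ 1 * s)) * (p.μ 1 * e (x + p.μ 1 * s)))
      (g' := fun s => Real.exp (-(p.Λ 1 * s)) * (p.Λ 1 * E (x + p.μ 1 * s))) hT
      (fun s _ => hasDerivAt_exp_mul_comp hE (p.Λ 1) (p.μ 1) x s)
      (by fun_prop) (by fun_prop)
      (fun s hs => by have := he_nonneg _ (hpos s hs.1); positivity)
      (fun s hs => by have := hE_nonneg _ (hpos s hs.1); positivity)
      (by simpa using hE_nonneg x hx.1)
      (mul_nonneg (Real.exp_pos _).le (hE_nonneg _ (hpos T hT)))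
    -- On the resting phase the value of `E` is frozen, so only the switching loss remains. If `T =
    -- t` the interval is empty.
    have key' := ofReal_add_setLIntegral_eq (a := T) (b := t)
      (G := fun s => Real.exp (-(p.Λ 1 * s)) * E (p.flow 1 x t)) (g := fun _ => 0)
      (g' := fun s => Real.exp (-(p.Λ 1 * s)) * (p.Λ 1 * E (p.flow 1 x t))) hTt
      (fun s _ => by
        convert! hasDerivAt_exp_mul_comp (E := fun _ => E (p.flow 1 x t)) (e := fun _ => 0)
          (fun y => hasDerivAt_const y _) (p.Λ 1) 0 x s using 1; ring)
      (by fun_prop) (by fun_prop) (by simp)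
      (fun s hs => by
        have := hE_nonneg _ (flow_mem (hpos t ht)).1; positivity)
      (mul_nonneg (Real.exp_pos _).le (hE_nonneg _ (flow_mem (hpos t ht)).1))
      (mul_nonneg (Real.exp_pos _).le (hE_nonneg _ (flow_mem (hpos t ht)).1))
    have hE_T : E (p.flow 1 x t) = E (x + p.μ 1 * T) := by
      rcases min_choice t ((p.B - x) / p.μ 1) with h | h
      · rw [hTdef, h, ← hTdef.trans h, hflow1 T ⟨hT, le_rfl⟩]
      · congr 1
        rw [hTdef, h, flow, min_eq_left]
        · field_simp; ring
        · have := (div_le_iff₀ hμ).1 (h ▸ hTt : (p.B - x) / p.μ 1 ≤ t); linarith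
    simp only [mul_zero, neg_zero, Real.exp_zero, one_mul, add_zero, ENNReal.ofReal_zero,
      lintegral_zero] at key key'
    rw [past_eq_setLIntegral_Ioc (fun s hs => free_of_neg _ _ _ hs) ht,
      past_eq_setLIntegral_Ioc (fun s hs => free_of_neg _ _ _ hs) ht,
      setLIntegral_Ioc_add hT hTt,
      setLIntegral_Ioc_add (g := p.free (onRegime 1 fun y =>
        if y < p.B then ENNReal.ofReal (p.μ 1 * e y) else 0) 1 x) hT hTt]
    have e1 : p.free (onRegime 1 fun y => ENNReal.ofReal (E y)) 1 x t =
        ENNReal.ofReal (Real.exp (-(p.Λ 1 * t)) * E (p.flow 1 x t)) := by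
      rw [free_onRegime_self, tail_of_nonneg ht, gate_one hx.1 ht, one_mul,
        ENNReal.ofReal_mul (Real.exp_pos _).le]
    have e2 : ∫⁻ s in Ioc 0 T, p.free (onRegime 1 fun y => ENNReal.ofReal (p.Λ 1 * E y)) 1 x s =
        ∫⁻ s in Ioc 0 T, ENNReal.ofReal (Real.exp (-(p.Λ 1 * s)) * (p.Λ 1 * E (x + p.μ 1 * s))) := by
      refine setLIntegral_congr_fun measurableSet_Ioc fun s hs => ?_
      simp only [free_onRegime_self, tail_of_nonneg hs.1.le, gate_one hx.1 hs.1.le, one_mul,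
        hflow1 s ⟨hs.1.le, hs.2⟩]
      rw [← ENNReal.ofReal_mul (Real.exp_pos _).le]
    have e3 : ∫⁻ s in Ioc T t, p.free (onRegime 1 fun y => ENNReal.ofReal (p.Λ 1 * E y)) 1 x s =
        ∫⁻ s in Ioc T t, ENNReal.ofReal (Real.exp (-(p.Λ 1 * s)) * (p.Λ 1 * E (p.flow 1 x t))) := by
      refine setLIntegral_congr_fun measurableSet_Ioc fun s hs => ?_
      have ht' : p.flow 1 x t = p.B := (hflow2 t ⟨hs.1.trans_le hs.2, le_rfl⟩).1
      have hs0 := (hT.trans_lt hs.1).le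
      simp only [free_onRegime_self, tail_of_nonneg hs0, gate_one hx.1 hs0, one_mul,
        (hflow2 s hs).1, ht']
      rw [← ENNReal.ofReal_mul (Real.exp_pos _).le]
    have e4 : ∫⁻ s in Ioc T t, p.free (onRegime 1 fun y =>
        if y < p.B then ENNReal.ofReal (p.μ 1 * e y) else 0) 1 x s = 0 := by
      rw [setLIntegral_congr_fun (g := fun _ => 0) measurableSet_Ioc, lintegral_zero]
      intro s hs
      simp [free_onRegime_self, (hflow2 s hs).1]
    have e5 : ∫⁻ s in Ioc 0 T, p.free (onRegime 1 fun y =>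
        if y < p.B then ENNReal.ofReal (p.μ 1 * e y) else 0) 1 x s =
        ∫⁻ s in Ioc 0 T, ENNReal.ofReal (Real.exp (-(p.Λ 1 * s)) * (p.μ 1 * e (x + p.μ 1 * s))) := by
      -- At `s = T` the point may already be at `B`, where the drift term is switched off; a single
      -- time is negligible.
      rw [← setLIntegral_congr Ioo_ae_eq_Ioc, ← setLIntegral_congr Ioo_ae_eq_Ioc]
      refine setLIntegral_congr_fun measurableSet_Ioo fun s hs => ?_
      have : x + p.μ 1 * s < p.B := (hlt s).2 (hs.2.trans_le (min_le_right _ _))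
      simp only [free_onRegime_self, tail_of_nonneg hs.1.le, gate_one hx.1 hs.1.le, one_mul,
        hflow1 s ⟨hs.1.le, hs.2.le⟩, this, if_true]
      rw [← ENNReal.ofReal_mul (Real.exp_pos _).le]
    rw [e1, e2, e3, e4, e5, add_zero]
    simp only [onRegime, if_true]
    rw [← key, add_comm (∫⁻ s in Ioc 0 T, _), ← add_assoc, key', hE_T]
  · intro i y
    fin_cases i <;> simp [onRegime]

end Params

namespace Params

variable (p : Params)

/-! ### Paths as functions of the clocks -/

/-- The regime after `k` switches, starting in regime `i`. -/
def reg (i : Fin 2) : ℕ → Fin 2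
  | 0 => i
  | k + 1 => 1 - reg i k

/-- The holding times given by the clocks `c`. -/
def hold (c : ℕ → ℝ) (i : Fin 2) (k : ℕ) : ℝ := c k / p.Λ (reg i k)

/-- The switching times given by the clocks `c`. -/
def switch (c : ℕ → ℝ) (i : Fin 2) (k : ℕ) : ℝ := ∑ j ∈ Finset.range k, p.hold c i j

/-- The positions at the switches. -/
def place (c : ℕ → ℝ) (i : Fin 2) (x : ℝ) : ℕ → ℝ
  | 0 => x
  | k + 1 => p.flow (reg i k) (place c i x k) (p.hold c i k)

/-- The value of `f` at time `t`, on survival with exactly `n` switches, for the clocks `c`. -/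
def pathN (f : Fin 2 → ℝ → ℝ≥0∞) : ℕ → (ℕ → ℝ) → Fin 2 → ℝ → ℝ → ℝ≥0∞
  | 0, c, i, x, t => if 0 ≤ t ∧ t < c 0 / p.Λ i then p.gate i x t * f i (p.flow i x t) else 0
  | n + 1, c, i, x, t => p.gate i x (c 0 / p.Λ i) *
      pathN f n (fun k => c (k + 1)) (1 - i) (p.flow i x (c 0 / p.Λ i)) (t - c 0 / p.Λ i)

variable {p}

/-- The path is defined by appending the last switch, whereas `pathN` peels off the first; this and
the next three lemmas translate between the two. -/
theorem reg_succ' (i : Fin 2) (k : ℕ) : reg i (k + 1) = reg (1 - i) k := by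
  induction k with
  | zero => rfl
  | succ k ih => rw [reg, ih, reg]

theorem hold_succ (c : ℕ → ℝ) (i : Fin 2) (k : ℕ) :
    p.hold c i (k + 1) = p.hold (fun k => c (k + 1)) (1 - i) k := by
  rw [hold, reg_succ', hold]

theorem switch_succ' (c : ℕ → ℝ) (i : Fin 2) (k : ℕ) :
    p.switch c i (k + 1) = c 0 / p.Λ i + p.switch (fun k => c (k + 1)) (1 - i) k := by
  rw [switch, Finset.sum_range_succ', add_comm]
  simp only [hold_succ]
  rfl

theorem place_succ' (c : ℕ → ℝ) (i : Fin 2) (x : ℝ) (k : ℕ) : p.place c i x (k + 1) =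
    p.place (fun k => c (k + 1)) (1 - i) (p.flow i x (c 0 / p.Λ i)) k := by
  induction k with
  | zero => rfl
  | succ k ih => rw [place, ih, place, reg_succ', hold_succ]

open Classical in
-- The recursion over the first clock collects one gate per holding time. Survival is thus tested
-- only at the ends of the holding times and at `t`; that this is enough is shown in `alive_iff`.
theorem pathN_eq (f : Fin 2 → ℝ → ℝ≥0∞) (n : ℕ) (c : ℕ → ℝ) (i : Fin 2) (x t : ℝ) :
    p.pathN f n c i x t =
      if (p.switch c i n ≤ t ∧ t < p.switch c i (n + 1)) ∧
        (∀ k < n, 0 ≤ p.place c i x k + p.μ (reg i k) * p.hold c i k) ∧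
        0 ≤ p.place c i x n + p.μ (reg i n) * (t - p.switch c i n)
      then f (reg i n) (p.flow (reg i n) (p.place c i x n) (t - p.switch c i n)) else 0 := by
  induction n generalizing c i x t with
  | zero =>
    simp only [pathN, switch, place, reg, gate, Finset.range_zero, Finset.sum_empty, sub_zero,
      zero_add, Finset.range_one, Finset.sum_singleton, hold, not_lt_zero, IsEmpty.forall_iff,
      implies_true, true_and, ite_and]
    split_ifs <;> simp
  | succ n ih =>
    rw [pathN, ih]
    simp only [Nat.forall_lt_succ_left, switch_succ', reg_succ', place_succ', hold_succ, sub_sub, gate]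
    simp only [le_sub_iff_add_le', sub_lt_iff_lt_add', and_assoc]
    change (if 0 ≤ x + p.μ i * (c 0 / p.Λ i) then 1 else 0) * _ = ite (_ ∧ _ ∧
      0 ≤ x + p.μ i * (c 0 / p.Λ i) ∧ _) _ _
    by_cases h : 0 ≤ x + p.μ i * (c 0 / p.Λ i)
    · simp only [h, if_true, one_mul, true_and]
    · simp [h]

theorem measurable_pathN {f : Fin 2 → ℝ → ℝ≥0∞} (hf : ∀ j, Measurable (f j)) (n : ℕ) (i : Fin 2) :
    Measurable fun z : (ℕ → ℝ) × ℝ × ℝ => p.pathN f n z.1 i z.2.1 z.2.2 := by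
  induction n generalizing i with
  | zero =>
    have h0 : MeasurableSet {z : (ℕ → ℝ) × ℝ × ℝ | 0 ≤ z.2.2} :=
      measurableSet_le (by fun_prop) (by fun_prop)
    have h1 : MeasurableSet {z : (ℕ → ℝ) × ℝ × ℝ | z.2.2 < z.1 0 / p.Λ i} :=
      measurableSet_lt (by fun_prop) (by fun_prop)
    refine Measurable.ite (h0.inter h1) (.mul ?_ ?_) measurable_const
    · exact (measurable_gate i).comp measurable_snd
    · exact (hf i).comp ((measurable_flow i).comp measurable_snd)
  | succ n ih =>
    refine .mul ?_ ?_
    · exact (measurable_gate i).comp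
        (f := fun z : (ℕ → ℝ) × ℝ × ℝ => (z.2.1, z.1 0 / p.Λ i)) (by fun_prop)
    · refine (ih (1 - i)).comp (f := fun z : (ℕ → ℝ) × ℝ × ℝ => (fun k => z.1 (k + 1),
        p.flow i z.2.1 (z.1 0 / p.Λ i), z.2.2 - z.1 0 / p.Λ i)) ?_
      refine .prodMk (by fun_prop) (.prodMk ?_ (by fun_prop))
      exact (measurable_flow i).comp
        (f := fun z : (ℕ → ℝ) × ℝ × ℝ => (z.2.1, z.1 0 / p.Λ i)) (by fun_prop)

end Params

/-! ### Exponential clocks -/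

/-- The substitution `a = lτ` turns a standard exponential clock into a holding time of rate `l`. -/
theorem lintegral_expMeasure_comp_div {l : ℝ} (hl : 0 < l) {h : ℝ → ℝ≥0∞} (hh : Measurable h) :
    ∫⁻ a, h (a / l) ∂(expMeasure 1) = ∫⁻ τ, exponentialPDF l τ * h τ := by
  have hm : Measurable (gammaPDF 1 1) := (measurable_gammaPDFReal 1 1).ennreal_ofReal
  rw [expMeasure, gammaMeasure, lintegral_withDensity_eq_lintegral_mul _ hm (by fun_prop)]
  have h2 := Real.map_volume_mul_left hl.ne'
  have h3 : (volume : Measure ℝ) = ENNReal.ofReal l • Measure.map (l * ·) volume := by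
    rw [h2, smul_smul, ← ENNReal.ofReal_mul hl.le, abs_of_pos (inv_pos.2 hl),
      mul_inv_cancel₀ hl.ne', ENNReal.ofReal_one, one_smul]
  conv_lhs => rw [h3]
  rw [lintegral_smul_measure, lintegral_map (by fun_prop) (by fun_prop), smul_eq_mul,
    ← lintegral_const_mul _ (by fun_prop)]
  refine lintegral_congr fun τ => ?_
  have : gammaPDF 1 1 (l * τ) = exponentialPDF 1 (l * τ) := rfl
  simp only [Pi.mul_apply]
  rw [this, mul_div_cancel_left₀ _ hl.ne', ← mul_assoc]
  congr 1
  rw [exponentialPDF_eq, exponentialPDF_eq, ← ENNReal.ofReal_mul hl.le]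
  congr 1
  by_cases h0 : 0 ≤ τ
  · have : 0 ≤ l * τ := by positivity
    simp [h0, this]
  · have : ¬ 0 ≤ l * τ := by
      rw [not_le] at h0 ⊢; nlinarith
    simp [h0, this]

namespace Params

variable {p : Params}

theorem lintegral_dens_Ioi (i : Fin 2) {t : ℝ} (ht : 0 ≤ t) :
    ∫⁻ τ in Ioi t, p.dens i τ = p.tail i t := by
  have h1 : ∫⁻ τ, p.dens i τ = 1 := lintegral_exponentialPDF_eq_one (p.Λ_pos i)
  have h2 : ∫⁻ τ in Iic t, p.dens i τ = ENNReal.ofReal (1 - Real.exp (-(p.Λ i * t))) := by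
    unfold dens
    rw [lintegral_exponentialPDF_eq_antiDeriv (p.Λ_pos i), if_pos ht]
  have h4 : Real.exp (-(p.Λ i * t)) ≤ 1 := by
    rw [Real.exp_le_one_iff]
    have := mul_nonneg (p.Λ_pos i).le ht
    linarith
  rw [← lintegral_add_compl _ measurableSet_Iic, compl_Iic, h2] at h1
  rw [tail_of_nonneg ht]
  have h3 : ENNReal.ofReal (1 - Real.exp (-(p.Λ i * t)))
      + ENNReal.ofReal (Real.exp (-(p.Λ i * t))) = 1 := by
    rw [← ENNReal.ofReal_add (by linarith) (Real.exp_pos _).le]; simp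
  exact (ENNReal.add_right_inj ENNReal.ofReal_ne_top).1 (h1.trans h3.symm)

end Params

/-! ### Expectations over the clocks -/

namespace Driver

variable {p : Params} {Ω : Type*} [MeasurableSpace Ω] {P : Measure Ω} (X : Driver p P)

/-- The index sets `{k}` and `Ioi k` are disjoint, so they generate independent σ-algebras. This is
the renewal property at a switch. -/
theorem indepFun_clock_tail (k : ℕ) :
    IndepFun (X.clock k) (fun ω j => X.clock (k + 1 + j) ω) P := by
  have h := indep_iSup_of_disjoint (fun i => (X.measurable_clock i).comap_le) X.indep_clock
    (S := {k}) (T := Ioi k) (by simp)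
  refine indep_of_indep_of_le_left (indep_of_indep_of_le_right h ?_) ?_
  · refine (measurable_iff_comap_le (m₁ := ⨆ i ∈ Ioi k, MeasurableSpace.comap (X.clock i) _)).1
      (@measurable_pi_lambda Ω ℕ _ (_) _ _ fun j => ?_)
    rw [measurable_iff_comap_le]
    exact le_iSup₂_of_le (f := fun i (_ : i ∈ Ioi k) => MeasurableSpace.comap (X.clock i) _)
      (k + 1 + j) (by rw [mem_Ioi]; omega) le_rfl
  · exact le_iSup₂_of_le k rfl le_rfl

/-- Integrating out clock `k` leaves the same statement for the clocks from `k + 1` on, with one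
switch fewer; hence the offset `k` is part of the induction. The scaled clock provides the kernel of
`jump`. -/
theorem lintegral_pathN [IsProbabilityMeasure P] {f : Fin 2 → ℝ → ℝ≥0∞}
    (hf : ∀ j, Measurable (f j)) (n k : ℕ) (i : Fin 2) (x t : ℝ) :
    ∫⁻ ω, p.pathN f n (fun j => X.clock (k + j) ω) i x t ∂P = p.evolN f n i x t := by
  induction n generalizing k i x t with
  | zero =>
    change ∫⁻ ω, (fun a => if 0 ≤ t ∧ t < a then p.gate i x t * f i (p.flow i x t) else 0)
      (X.clock k ω / p.Λ i) ∂P = p.free f i x t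
    have hm : Measurable fun a =>
        if 0 ≤ t ∧ t < a then p.gate i x t * f i (p.flow i x t) else 0 :=
      Measurable.ite (by measurability) measurable_const measurable_const
    rw [← lintegral_map (μ := P) (g := X.clock k) (f := fun b => (fun a =>
      if 0 ≤ t ∧ t < a then p.gate i x t * f i (p.flow i x t) else 0) (b / p.Λ i))
      (hm.comp (by fun_prop)) (X.measurable_clock k), X.law_clock,
      lintegral_expMeasure_comp_div (p.Λ_pos i) hm]
    unfold Params.free
    rcases lt_or_ge t 0 with ht | ht
    · simp [not_le.2 ht, Params.tail_of_neg ht]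
    · rw [← Params.lintegral_dens_Ioi i ht, ← lintegral_mul_const _ (Params.measurable_dens i),
        ← lintegral_indicator measurableSet_Ioi]
      refine lintegral_congr fun τ => ?_
      by_cases h : t < τ <;> simp [h, ht, Params.dens]
  | succ n ih =>
    have hm := Params.measurable_pathN (p := p) hf n (1 - i)
    have hG : Measurable fun z : ℝ × (ℕ → ℝ) => p.gate i x (z.1 / p.Λ i) *
        p.pathN f n z.2 (1 - i) (p.flow i x (z.1 / p.Λ i)) (t - z.1 / p.Λ i) := by
      refine .mul ?_ ?_
      · exact (Params.measurable_gate i).comp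
          (f := fun z : ℝ × (ℕ → ℝ) => (x, z.1 / p.Λ i)) (by fun_prop)
      · refine hm.comp (f := fun z : ℝ × (ℕ → ℝ) =>
          (z.2, p.flow i x (z.1 / p.Λ i), t - z.1 / p.Λ i)) ?_
        refine .prodMk (by fun_prop) (.prodMk ?_ (by fun_prop))
        exact (Params.measurable_flow i).comp
          (f := fun z : ℝ × (ℕ → ℝ) => (x, z.1 / p.Λ i)) (by fun_prop)
    have hY : Measurable fun ω (j : ℕ) => X.clock (k + 1 + j) ω :=
      measurable_pi_lambda _ fun j => X.measurable_clock _
    have h1 : ∀ ω, p.pathN f (n + 1) (fun j => X.clock (k + j) ω) i x t =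
        (fun z : ℝ × (ℕ → ℝ) => p.gate i x (z.1 / p.Λ i) *
        p.pathN f n z.2 (1 - i) (p.flow i x (z.1 / p.Λ i)) (t - z.1 / p.Λ i))
        (X.clock k ω, fun j => X.clock (k + 1 + j) ω) := fun ω => by
      simp only [Params.pathN, add_zero, add_assoc, add_comm 1]
    rw [lintegral_congr h1, ← lintegral_map hG ((X.measurable_clock k).prodMk hY),
      (indepFun_iff_map_prod_eq_prod_map_map (X.measurable_clock k).aemeasurable
        hY.aemeasurable).1 (X.indepFun_clock_tail k), lintegral_prod _ hG.aemeasurable, X.law_clock]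
    have h2 : ∀ a, ∫⁻ c, p.gate i x (a / p.Λ i) *
        p.pathN f n c (1 - i) (p.flow i x (a / p.Λ i)) (t - a / p.Λ i)
          ∂(P.map fun ω (j : ℕ) => X.clock (k + 1 + j) ω) =
        p.gate i x (a / p.Λ i) * p.evolN f n (1 - i) (p.flow i x (a / p.Λ i)) (t - a / p.Λ i) := by
      intro a
      have hm' : Measurable fun c =>
          p.pathN f n c (1 - i) (p.flow i x (a / p.Λ i)) (t - a / p.Λ i) :=
        hm.comp (measurable_prodMk_right (y := (p.flow i x (a / p.Λ i), t - a / p.Λ i)))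
      rw [lintegral_const_mul _ hm', lintegral_map hm' hY, ih]
    rw [lintegral_congr h2, lintegral_expMeasure_comp_div (p.Λ_pos i) (h := fun b =>
      p.gate i x b * p.evolN f n (1 - i) (p.flow i x b) (t - b))]
    · rfl
    · refine .mul ?_ ?_
      · exact (Params.measurable_gate i).comp (f := fun z : ℝ => (x, z)) (by fun_prop)
      · refine (Params.measurable_evolN hf n (1 - i)).comp
          (f := fun z : ℝ => (p.flow i x z, t - z)) (.prodMk ?_ (by fun_prop))
        exact (Params.measurable_flow i).comp (f := fun z : ℝ => (x, z)) (by fun_prop)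

/-- The law of the initial pair. -/
def init : Measure (ℝ × Fin 2) := P.map fun ω => (X.x₀ ω, X.s₀ ω)

theorem measurable_init : Measurable fun ω => (X.x₀ ω, X.s₀ ω) :=
  X.measurable_x₀.prodMk X.measurable_s₀

theorem measurable_tsum_pathN {f : Fin 2 → ℝ → ℝ≥0∞}
    (hf : ∀ j, Measurable (f j)) (t : ℝ) : Measurable fun z : (ℝ × Fin 2) × (ℕ → ℝ) =>
      ∑' n, p.pathN f n z.2 z.1.2 z.1.1 t := by
  refine Measurable.tsum fun n => ?_
  have : (fun z : (ℝ × Fin 2) × (ℕ → ℝ) => p.pathN f n z.2 z.1.2 z.1.1 t) = fun z =>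
      if z.1.2 = 0 then p.pathN f n z.2 0 z.1.1 t else p.pathN f n z.2 1 z.1.1 t := by
    funext z
    by_cases h : z.1.2 = 0
    · simp [h]
    · have h1 : z.1.2 = 1 := by omega
      simp [h1]
  rw [this]
  refine Measurable.ite (measurable_fst.snd (measurableSet_singleton 0)) ?_ ?_
  all_goals
    exact (Params.measurable_pathN hf n _).comp
      (f := fun z : (ℝ × Fin 2) × (ℕ → ℝ) => (z.2, z.1.1, t)) (by fun_prop)

/-- The joint law of the initial pair and the clock sequence is a product, so the clocks can be
integrated out for a fixed start. -/
theorem lintegral_pathN_init [IsProbabilityMeasure P] {f : Fin 2 → ℝ → ℝ≥0∞}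
    (hf : ∀ j, Measurable (f j)) (t : ℝ) :
    ∫⁻ ω, ∑' n, p.pathN f n (fun j => X.clock j ω) (X.s₀ ω) (X.x₀ ω) t ∂P =
      ∫⁻ z, p.evol f z.2 z.1 t ∂X.init := by
  have hY : Measurable fun ω (j : ℕ) => X.clock j ω :=
    measurable_pi_lambda _ fun j => X.measurable_clock _
  have hG := measurable_tsum_pathN (p := p) hf t
  rw [← lintegral_map hG (X.measurable_init.prodMk hY),
    (indepFun_iff_map_prod_eq_prod_map_map X.measurable_init.aemeasurable hY.aemeasurable).1
      X.indep_init, lintegral_prod _ hG.aemeasurable]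
  refine lintegral_congr fun z => ?_
  have hm : ∀ n, Measurable fun c => p.pathN f n c z.2 z.1 t := fun n =>
    (Params.measurable_pathN hf n z.2).comp (measurable_prodMk_right (y := (z.1, t)))
  rw [lintegral_tsum fun n => (hm n).aemeasurable]
  refine tsum_congr fun n => ?_
  rw [lintegral_map (hm n) hY]
  simpa using X.lintegral_pathN hf n 0 z.2 z.1 t

end Driver

/-! ### The process along a single path -/

namespace Driver

variable {p : Params} {Ω : Type*} [MeasurableSpace Ω] {P : Measure Ω} (X : Driver p P)

theorem regimeSeq_eq (ω : Ω) (k : ℕ) : X.regimeSeq ω k = Params.reg (X.s₀ ω) k := by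
  induction k with
  | zero => rfl
  | succ k ih => rw [regimeSeq, ih, Params.reg]

theorem holding_eq (ω : Ω) (k : ℕ) :
    X.holding ω k = p.hold (fun j => X.clock j ω) (X.s₀ ω) k := by
  rw [holding, regimeSeq_eq, Params.hold]

theorem switchTime_eq (ω : Ω) (k : ℕ) :
    X.switchTime ω k = p.switch (fun j => X.clock j ω) (X.s₀ ω) k := by
  simp only [switchTime, holding_eq, Params.switch]

theorem posSeq_eq (ω : Ω) (k : ℕ) :
    X.posSeq ω k = p.place (fun j => X.clock j ω) (X.s₀ ω) (X.x₀ ω) k := by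
  induction k with
  | zero => rfl
  | succ k ih => rw [posSeq, ih, Params.place, Params.flow, regimeSeq_eq, holding_eq]

variable {X}

theorem holding_pos {ω : Ω} (h : ∀ k, 0 < X.clock k ω) (k : ℕ) : 0 < X.holding ω k :=
  div_pos (h k) (p.Λ_pos _)

theorem switchTime_strictMono {ω : Ω} (h : ∀ k, 0 < X.clock k ω) :
    StrictMono (X.switchTime ω) := by
  refine strictMono_nat_of_lt_succ fun k => ?_
  rw [switchTime, switchTime, Finset.sum_range_succ]
  linarith [holding_pos h k]

theorem switchTime_succ (ω : Ω) (k : ℕ) :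
    X.switchTime ω (k + 1) = X.switchTime ω k + X.holding ω k := Finset.sum_range_succ _ _

/-- Positive clocks make the switching times strictly increasing, so the set under `sSup` is the
initial segment `Iic n`. -/
theorem switchCount_eq {ω : Ω} (h : ∀ k, 0 < X.clock k ω) {t : ℝ} {n : ℕ}
    (h1 : X.switchTime ω n ≤ t) (h2 : t < X.switchTime ω (n + 1)) : X.switchCount t ω = n := by
  have : {k : ℕ | X.switchTime ω k ≤ t} = Iic n := by
    ext k
    simp only [mem_ofPred_eq, mem_Iic]
    constructor
    · intro hk
      have := (switchTime_strictMono h).lt_iff_lt.1 (hk.trans_lt h2)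
      omega
    · intro hk
      exact ((switchTime_strictMono h).monotone hk).trans h1
  rw [switchCount, this, csSup_Iic]

theorem exists_switchTime_le_lt {ω : Ω} (hinf : ∀ t, ∃ k, t < X.switchTime ω k) {t : ℝ}
    (ht : 0 ≤ t) : ∃ n, X.switchTime ω n ≤ t ∧ t < X.switchTime ω (n + 1) := by
  classical
  have h0 : Nat.find (hinf t) ≠ 0 := by
    intro h
    have := Nat.find_spec (hinf t)
    rw [h] at this
    simp [switchTime] at this
    linarith
  obtain ⟨n, hn⟩ := Nat.exists_eq_succ_of_ne_zero h0
  refine ⟨n, not_lt.1 (Nat.find_min (hinf t) (by omega)), ?_⟩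
  have := Nat.find_spec (hinf t)
  rwa [hn] at this

theorem pos_eq {ω : Ω} (h : ∀ k, 0 < X.clock k ω) {t : ℝ} {n : ℕ}
    (h1 : X.switchTime ω n ≤ t) (h2 : t < X.switchTime ω (n + 1)) :
    X.pos t ω = p.flow (X.regimeSeq ω n) (X.posSeq ω n) (t - X.switchTime ω n) := by
  rw [pos, regime, switchCount_eq h h1 h2, Params.flow]

theorem regime_eq {ω : Ω} (h : ∀ k, 0 < X.clock k ω) {t : ℝ} {n : ℕ}
    (h1 : X.switchTime ω n ≤ t) (h2 : t < X.switchTime ω (n + 1)) :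
    X.regime t ω = X.regimeSeq ω n := by
  rw [regime, switchCount_eq h h1 h2]

/-- Between switches the position before reflection is affine in time, hence nonnegative on the
whole piece once it is so at both ends, and reflection at `B > 0` does not affect the sign. The
uncountably many conditions in `Alive` thus reduce to finitely many. -/
theorem alive_iff {ω : Ω} (h : ∀ k, 0 < X.clock k ω) (hinf : ∀ t, ∃ k, t < X.switchTime ω k)
    {t : ℝ} {n : ℕ} (h1 : X.switchTime ω n ≤ t) (h2 : t < X.switchTime ω (n + 1)) :
    X.Alive t ω ↔
      (∀ k < n, 0 ≤ X.posSeq ω k + p.μ (X.regimeSeq ω k) * X.holding ω k) ∧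
        0 ≤ X.posSeq ω n + p.μ (X.regimeSeq ω n) * (t - X.switchTime ω n) := by
  have hmono := switchTime_strictMono h
  have hflow : ∀ i x τ, 0 ≤ p.flow i x τ ↔ 0 ≤ x + p.μ i * τ := fun i x τ => by
    rw [Params.flow, le_min_iff]; exact and_iff_right p.B_pos.le
  have hT0 : ∀ k, 0 ≤ X.switchTime ω k := fun k => by
    have := hmono.monotone (Nat.zero_le k)
    simpa [switchTime] using this
  constructor
  · intro ha
    refine ⟨fun k hk => ?_, ?_⟩
    · have hle : X.switchTime ω (k + 1) ≤ t := (hmono.monotone hk).trans h1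
      have := ha (X.switchTime ω (k + 1)) ⟨hT0 _, hle⟩
      rw [pos_eq h le_rfl (hmono (Nat.lt_succ_self _)), hflow, sub_self, mul_zero, add_zero,
        posSeq] at this
      exact (hflow _ _ _).1 this
    · have := ha t ⟨(hT0 n).trans h1, le_rfl⟩
      rwa [pos_eq h h1 h2, hflow] at this
  · rintro ⟨ha, hb⟩ u ⟨hu0, hut⟩
    obtain ⟨k, hk1, hk2⟩ := exists_switchTime_le_lt hinf hu0
    have hkn : k ≤ n := by
      have := hmono.lt_iff_lt.1 (hk1.trans_lt (hut.trans_lt h2))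
      omega
    rw [pos_eq h hk1 hk2, hflow]
    have hplace : ∀ j ≤ n, 0 ≤ X.posSeq ω j := by
      intro j hj
      cases j with
      | zero => exact (X.x₀_mem ω).1
      | succ j => exact le_min p.B_pos.le (ha j hj)
    have hseg : ∀ x v s τ : ℝ, 0 ≤ x → 0 ≤ s → s ≤ τ → 0 ≤ x + v * τ → 0 ≤ x + v * s := by
      intro x v s τ hx hs hsτ hv
      rcases le_total 0 v with h | h
      · positivity
      · nlinarith
    rcases hkn.lt_or_eq with hlt | rfl
    · refine hseg _ _ _ _ (hplace k hkn) (by linarith) ?_ (ha k hlt)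
      rw [switchTime_succ] at hk2
      linarith
    · exact hseg _ _ _ _ (hplace k le_rfl) (by linarith) (by linarith) hb

open Classical in
-- Exactly one number of switches is compatible with the time `t`; all other terms vanish.
theorem tsum_pathN {ω : Ω} (h : ∀ k, 0 < X.clock k ω) (hinf : ∀ t, ∃ k, t < X.switchTime ω k)
    (f : Fin 2 → ℝ → ℝ≥0∞) {t : ℝ} (ht : 0 ≤ t) :
    ∑' n, p.pathN f n (fun j => X.clock j ω) (X.s₀ ω) (X.x₀ ω) t =
      if X.Alive t ω then f (X.regime t ω) (X.pos t ω) else 0 := by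
  obtain ⟨n, h1, h2⟩ := exists_switchTime_le_lt hinf ht
  rw [tsum_eq_single n]
  · rw [Params.pathN_eq]
    simp only [← switchTime_eq, ← posSeq_eq, ← regimeSeq_eq, ← holding_eq, h1, h2, true_and]
    rw [pos_eq h h1 h2, regime_eq h h1 h2]
    simp only [alive_iff h hinf h1 h2]
  · intro k hk
    rw [Params.pathN_eq, if_neg]
    rintro ⟨⟨h3, h4⟩, -⟩
    rw [← switchTime_eq] at h3 h4
    exact hk ((switchCount_eq h h3 h4).symm.trans (switchCount_eq h h1 h2))

/-! ### Almost sure properties of the clocks -/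

variable (X)

theorem ae_clock_pos : ∀ᵐ ω ∂P, ∀ k, 0 < X.clock k ω := by
  rw [ae_all_iff]
  intro k
  have h : expMeasure 1 (Iic 0) = 0 := by
    rw [expMeasure, gammaMeasure, withDensity_apply _ measurableSet_Iic,
      setLIntegral_congr Iio_ae_eq_Iic.symm]
    exact lintegral_gammaPDF_of_nonpos le_rfl
  rw [← X.law_clock k, Measure.map_apply (X.measurable_clock k) measurableSet_Iic] at h
  rw [ae_iff]
  simpa [preimage, not_lt] using h

/-- The second Borel–Cantelli lemma: the events that a clock exceeds `1` are independent and have a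
common positive probability. -/
theorem ae_frequently_clock [IsProbabilityMeasure P] :
    ∀ᵐ ω ∂P, ∀ N, ∃ k, N ≤ k ∧ 1 < X.clock k ω := by
  have hc : expMeasure 1 (Ioi 1) ≠ 0 := by
    have := isProbabilityMeasure_expMeasure one_pos
    have h := cdf_expMeasure_eq one_pos 1
    rw [cdf_eq_real, if_pos zero_le_one] at h
    intro h0
    have h1 : (expMeasure 1).real (Iic 1) = 1 := by
      have := prob_compl_eq_zero_iff (μ := expMeasure 1) (s := Iic (1 : ℝ)) measurableSet_Iic
      rw [compl_Iic] at this
      rw [Measure.real, this.1 h0, ENNReal.toReal_one]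
    rw [h1] at h
    have := Real.exp_pos (-(1 * 1))
    linarith
  have hind : iIndepSet (fun k => X.clock k ⁻¹' Ioi 1) P := by
    rw [iIndepSet_iff_meas_biInter fun k => X.measurable_clock k measurableSet_Ioi]
    exact fun s => X.indep_clock.meas_biInter fun i _ => ⟨Ioi 1, measurableSet_Ioi, rfl⟩
  have h := measure_limsup_eq_one (μ := P) (s := fun k => X.clock k ⁻¹' Ioi 1)
    (fun k => X.measurable_clock k measurableSet_Ioi) hind ?_
  · have h' := (mem_ae_iff_prob_eq_one (MeasurableSet.measurableSet_limsup
      fun k => X.measurable_clock k measurableSet_Ioi)).2 h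
    filter_upwards [h'] with ω hω N
    rw [Filter.mem_limsup_iff_frequently_mem, Filter.frequently_atTop] at hω
    exact hω N
  · simp only [← Measure.map_apply (X.measurable_clock _) measurableSet_Ioi, X.law_clock]
    exact ENNReal.tsum_const_eq_top_of_ne_zero hc

/-- Bounded switching times would make the holding times summable, hence eventually smaller than `1
/ max Λ₀ Λ₁`; but infinitely many clocks exceed `1`. This excludes explosion, so that every time
lies between two switches. -/
theorem ae_switchTime_unbounded [IsProbabilityMeasure P] :
    ∀ᵐ ω ∂P, ∀ t, ∃ k, t < X.switchTime ω k := by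
  filter_upwards [X.ae_clock_pos, X.ae_frequently_clock] with ω h1 h2 t
  by_contra! hcon
  have hs : Summable (X.holding ω) :=
    summable_of_sum_range_le (fun k => (holding_pos h1 k).le) hcon
  have h0 := hs.tendsto_atTop_zero
  set M := max (p.Λ 0) (p.Λ 1)
  have hM : ∀ i, p.Λ i ≤ M := by
    intro i; fin_cases i
    exacts [le_max_left _ _, le_max_right _ _]
  have hM0 : 0 < M := (p.Λ_pos 0).trans_le (hM 0)
  have hev := h0.eventually (gt_mem_nhds (inv_pos.2 hM0))
  rw [Filter.eventually_atTop] at hev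
  obtain ⟨N, hN⟩ := hev
  obtain ⟨k, hk, hk1⟩ := h2 N
  have h3 := hN k hk
  rw [holding, div_lt_iff₀ (p.Λ_pos _), inv_mul_eq_div, lt_div_iff₀ hM0] at h3
  have := hM (X.regimeSeq ω k)
  nlinarith

open Classical in
/-- The link between the process and the transition functions. -/
theorem lintegral_alive [IsProbabilityMeasure P] {f : Fin 2 → ℝ → ℝ≥0∞}
    (hf : ∀ j, Measurable (f j)) {t : ℝ} (ht : 0 ≤ t) :
    ∫⁻ ω, (if X.Alive t ω then f (X.regime t ω) (X.pos t ω) else 0) ∂P =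
      ∫⁻ z, p.evol f z.2 z.1 t ∂X.init := by
  rw [← X.lintegral_pathN_init hf t]
  refine lintegral_congr_ae ?_
  filter_upwards [X.ae_clock_pos, X.ae_switchTime_unbounded] with ω h1 h2
  rw [tsum_pathN h1 h2 f ht]

end Driver

/-! ### Averages over an initial law -/

/-- `E_ξ(x) = ∫_0^x e^{-ξa} da`. -/
def expPrim (ξ x : ℝ) : ℝ := ∫ a in (0 : ℝ)..x, Real.exp (-(ξ * a))

theorem hasDerivAt_expPrim (ξ x : ℝ) : HasDerivAt (expPrim ξ) (Real.exp (-(ξ * x))) x :=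
  (Continuous.integral_hasStrictDerivAt (by fun_prop) 0 x).hasDerivAt

theorem continuous_expPrim (ξ : ℝ) : Continuous (expPrim ξ) :=
  continuous_iff_continuousAt.2 fun x => (hasDerivAt_expPrim ξ x).continuousAt

theorem expPrim_zero (ξ : ℝ) : expPrim ξ 0 = 0 := intervalIntegral.integral_same

theorem expPrim_nonneg (ξ : ℝ) {x : ℝ} (hx : 0 ≤ x) : 0 ≤ expPrim ξ x :=
  intervalIntegral.integral_nonneg hx fun _ _ => (Real.exp_pos _).le

/-- The left side has derivative zero. In the forward equations the test function `e^{-ξx}` is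
thereby replaced by `1 - ξ E_ξ`, whose mean is `F_s(t, 0) - ξ L_s`. -/
theorem exp_add_mul_expPrim (ξ x : ℝ) : Real.exp (-(ξ * x)) + ξ * expPrim ξ x = 1 := by
  have h : ∀ y, HasDerivAt (fun y => Real.exp (-(ξ * y)) + ξ * expPrim ξ y) 0 y := fun y => by
    have h1 : HasDerivAt (fun y : ℝ => -(ξ * y)) (-ξ) y := by
      convert! ((hasDerivAt_id y).const_mul ξ).neg using 1; simp
    convert! h1.exp.add ((hasDerivAt_expPrim ξ y).const_mul ξ) using 1
    ring
  have := is_const_of_deriv_eq_zero (fun y => (h y).differentiableAt) (fun y => (h y).deriv) x 0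
  simpa [expPrim_zero] using this

/-- This exhibits `E_ξ` as a mixture of the indicators that define `F_s(t, a)`; it links means of
`E_ξ` with Laplace transforms. -/
theorem ofReal_expPrim_eq_lintegral (ξ : ℝ) {x B : ℝ} (hx : x ∈ Icc 0 B) :
    ENNReal.ofReal (expPrim ξ x) =
      ∫⁻ a in Ioc 0 B, ENNReal.ofReal (Real.exp (-(ξ * a))) * (if a ≤ x then 1 else 0) := by
  have hi : IntegrableOn (fun a : ℝ => Real.exp (-(ξ * a))) (Ioc 0 x) :=
    (Continuous.intervalIntegrable (by fun_prop) 0 x).1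
  rw [expPrim, intervalIntegral.integral_of_le hx.1,
    ofReal_integral_eq_lintegral_ofReal hi (.of_forall fun _ => (Real.exp_pos _).le),
    ← lintegral_indicator measurableSet_Ioc, ← lintegral_indicator measurableSet_Ioc]
  refine lintegral_congr fun a => ?_
  by_cases h0 : 0 < a
  · by_cases h1 : a ≤ x
    · simp [indicator, h0, h1, h1.trans hx.2]
    · simp [indicator, h1]
  · simp [indicator, h0]

theorem expPrim_le (ξ : ℝ) {x B : ℝ} (hx : x ∈ Icc 0 B) : expPrim ξ x ≤ expPrim ξ B := by
  have h : 0 ≤ expPrim ξ B - expPrim ξ x := by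
    rw [expPrim, expPrim, intervalIntegral.integral_interval_sub_left]
    · exact intervalIntegral.integral_nonneg hx.2 fun _ _ => (Real.exp_pos _).le
    all_goals exact Continuous.intervalIntegrable (by fun_prop) _ _
  linarith

/-- The test function of `F_s(·, a)`. -/
def upTo (s : Fin 2) (a : ℝ) : Fin 2 → ℝ → ℝ≥0∞ := onRegime s fun x => if a ≤ x then 1 else 0

namespace Params

variable (p : Params)

/-- The expectation of `f` at time `t`, on survival, for the initial law `ρ`. -/
def mean (ρ : Measure (ℝ × Fin 2)) (f : Fin 2 → ℝ → ℝ≥0∞) (t : ℝ) : ℝ≥0∞ :=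
  ∫⁻ z, p.evol f z.2 z.1 t ∂ρ

/-- `F_s(t, a)` for the initial law `ρ`. -/
def dist (ρ : Measure (ℝ × Fin 2)) (s : Fin 2) (t a : ℝ) : ℝ := (p.mean ρ (upTo s a) t).toReal

/-- `L_s(t, ξ)` for the initial law `ρ`. -/
def lapl (ρ : Measure (ℝ × Fin 2)) (s : Fin 2) (t ξ : ℝ) : ℝ :=
  (p.mean ρ (onRegime s fun x => ENNReal.ofReal (expPrim ξ x)) t).toReal

variable {p}

theorem measurable_upTo_param (s j : Fin 2) :
    Measurable fun z : ℝ × ℝ => upTo s z.1 j z.2 := by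
  unfold upTo onRegime
  by_cases h : j = s
  · simp only [h, if_true]
    exact Measurable.ite (measurableSet_le (by fun_prop) (by fun_prop)) measurable_const
      measurable_const
  · simp only [h, if_false]; exact measurable_const

theorem measurable_upTo (s : Fin 2) (a : ℝ) (j : Fin 2) : Measurable (upTo s a j) :=
  (measurable_upTo_param s j).comp measurable_prodMk_left

theorem upTo_le_one (s : Fin 2) (a : ℝ) (j : Fin 2) (y : ℝ) : upTo s a j y ≤ 1 := by
  unfold upTo onRegime; dsimp only; split_ifs <;> simp

theorem measurable_expPrim_test (s : Fin 2) (ξ : ℝ) (j : Fin 2) :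
    Measurable (onRegime s (fun x => ENNReal.ofReal (expPrim ξ x)) j) :=
  measurable_onRegime (continuous_expPrim ξ).measurable.ennreal_ofReal s j

/-- A function of the regime and the position is measurable if it is so in each regime. -/
theorem measurable_of_regime {α : Type*} [MeasurableSpace α] {g : α × ℝ × Fin 2 → ℝ≥0∞}
    (h : ∀ i, Measurable fun z : α × ℝ => g (z.1, z.2, i)) : Measurable g := by
  have : g = fun z => if z.2.2 = 0 then g (z.1, z.2.1, 0) else g (z.1, z.2.1, 1) := by
    funext ⟨a, x, i⟩
    by_cases hi : i = 0
    · simp [hi]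
    · have h1 : i = 1 := by omega
      simp [h1]
  rw [this]
  refine Measurable.ite (measurable_snd.snd (measurableSet_singleton 0)) ?_ ?_
  all_goals
    exact (h _).comp (f := fun z : α × ℝ × Fin 2 => (z.1, z.2.1)) (by fun_prop)

theorem measurable_evol_pair {f : Fin 2 → ℝ → ℝ≥0∞} (hf : ∀ j, Measurable (f j)) :
    Measurable fun z : ℝ × ℝ × Fin 2 => p.evol f z.2.2 z.2.1 z.1 :=
  measurable_of_regime fun i => (measurable_evol hf i).comp measurable_swap

theorem measurable_evol_pair' {f : Fin 2 → ℝ → ℝ≥0∞} (hf : ∀ j, Measurable (f j)) (t : ℝ) :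
    Measurable fun z : ℝ × Fin 2 => p.evol f z.2 z.1 t :=
  (measurable_evol_pair hf).comp measurable_prodMk_left

theorem measurable_test_pair {f : Fin 2 → ℝ → ℝ≥0∞} (hf : ∀ j, Measurable (f j)) :
    Measurable fun z : ℝ × Fin 2 => f z.2 z.1 := by
  refine (measurable_of_regime (α := Unit) (g := fun z => f z.2.2 z.2.1)
    fun i => (hf i).comp measurable_snd).comp (measurable_prodMk_left (x := ()))

variable {ρ : Measure (ℝ × Fin 2)}

theorem mean_of_neg (f : Fin 2 → ℝ → ℝ≥0∞) {t : ℝ} (ht : t < 0) : p.mean ρ f t = 0 := by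
  unfold mean
  simp [evol_of_neg f _ _ ht]

theorem mean_zero (hρ : ∀ᵐ z ∂ρ, z.1 ∈ Icc 0 p.B) (f : Fin 2 → ℝ → ℝ≥0∞) :
    p.mean ρ f 0 = ∫⁻ z, f z.2 z.1 ∂ρ := by
  refine lintegral_congr_ae ?_
  filter_upwards [hρ] with z hz
  exact evol_zero f z.2 hz

theorem mean_congr {f f' : Fin 2 → ℝ → ℝ≥0∞} (h : ∀ j, ∀ y ∈ Icc 0 p.B, f j y = f' j y) (t : ℝ) :
    p.mean ρ f t = p.mean ρ f' t :=
  lintegral_congr fun z => evol_congr h z.2 z.1 t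

theorem mean_add {f g : Fin 2 → ℝ → ℝ≥0∞} (hf : ∀ j, Measurable (f j)) (hg : ∀ j, Measurable (g j))
    (t : ℝ) : p.mean ρ (fun j y => f j y + g j y) t = p.mean ρ f t + p.mean ρ g t := by
  unfold mean
  rw [← lintegral_add_left (measurable_evol_pair' hf t)]
  exact lintegral_congr fun z => evol_add hf hg z.2 z.1 t

theorem mean_const_mul (c : ℝ≥0∞) {f : Fin 2 → ℝ → ℝ≥0∞} (hf : ∀ j, Measurable (f j)) (t : ℝ) :
    p.mean ρ (fun j y => c * f j y) t = c * p.mean ρ f t := by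
  unfold mean
  rw [← lintegral_const_mul _ (measurable_evol_pair' hf t)]
  exact lintegral_congr fun z => evol_const_mul c hf z.2 z.1 t

theorem dist_nonneg (s : Fin 2) (t a : ℝ) : 0 ≤ p.dist ρ s t a := ENNReal.toReal_nonneg

theorem lapl_nonneg (s : Fin 2) (t ξ : ℝ) : 0 ≤ p.lapl ρ s t ξ := ENNReal.toReal_nonneg

variable [IsProbabilityMeasure ρ]

theorem measurable_mean {f : Fin 2 → ℝ → ℝ≥0∞} (hf : ∀ j, Measurable (f j)) :
    Measurable (p.mean ρ f) := (measurable_evol_pair hf).lintegral_prod_right'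

theorem measurable_mean_upTo (s : Fin 2) (t : ℝ) : Measurable fun a => p.mean ρ (upTo s a) t := by
  unfold mean
  refine Measurable.lintegral_prod_right' (f := fun z : ℝ × ℝ × Fin 2 =>
    p.evol (upTo s z.1) z.2.2 z.2.1 t) ?_
  refine measurable_of_regime fun i => ?_
  exact (measurable_evol_param (measurable_upTo_param s) i).comp
    (f := fun z : ℝ × ℝ => (z.1, z.2, t)) (by fun_prop)

theorem mean_le_one {f : Fin 2 → ℝ → ℝ≥0∞} (hf : ∀ j, Measurable (f j)) (h1 : ∀ j y, f j y ≤ 1)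
    (t : ℝ) : p.mean ρ f t ≤ 1 := by
  refine (lintegral_mono (g := fun _ => 1) fun z : ℝ × Fin 2 =>
    evol_le_one hf h1 z.2 z.1 t).trans ?_
  simp

/-- A test function bounded on `[0, B]` has a bounded mean. -/
theorem mean_le {f : Fin 2 → ℝ → ℝ≥0∞} (hf : ∀ j, Measurable (f j)) {C : ℝ≥0∞}
    (hC : ∀ j, ∀ y ∈ Icc 0 p.B, f j y ≤ C) (t : ℝ) : p.mean ρ f t ≤ C := by
  rcases eq_or_ne C 0 with rfl | h0
  · rw [mean_congr (f' := fun j y => 0 * f j y), mean_const_mul 0 hf, zero_mul]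
    intro j y hy
    rw [zero_mul, ← nonpos_iff_eq_zero]; exact hC j y hy
  rcases eq_or_ne C ⊤ with rfl | hT
  · exact le_top
  -- After rescaling and truncation the test function is at most `1` everywhere, as `mean_le_one`
  -- requires, while on `[0, B]` the truncation changes nothing.
  have hm : ∀ j, Measurable fun y => min (C⁻¹ * f j y) 1 := fun j =>
    ((hf j).const_mul _).min measurable_const
  rw [mean_congr (f' := fun j y => C * min (C⁻¹ * f j y) 1), mean_const_mul C hm]
  · calc _ ≤ C * 1 := by gcongr; exact mean_le_one hm (fun _ _ => min_le_right _ _) t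
      _ = C := mul_one C
  · intro j y hy
    rw [min_eq_left, ← mul_assoc, ENNReal.mul_inv_cancel h0 hT, one_mul]
    calc _ ≤ C⁻¹ * C := by gcongr; exact hC j y hy
      _ = 1 := ENNReal.inv_mul_cancel h0 hT

theorem past_mean {f : Fin 2 → ℝ → ℝ≥0∞} (hf : ∀ j, Measurable (f j)) (t : ℝ) :
    ∫⁻ z, past (p.evol f z.2 z.1) t ∂ρ = past (p.mean ρ f) t := by
  unfold past mean
  rw [lintegral_lintegral_swap]
  exact ((measurable_evol_pair hf).comp measurable_swap).aemeasurable

theorem measurable_past_evol {f : Fin 2 → ℝ → ℝ≥0∞} (hf : ∀ j, Measurable (f j)) (t : ℝ) :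
    Measurable fun z : ℝ × Fin 2 => past (p.evol f z.2 z.1) t := by
  refine (measurable_of_regime (α := Unit) (g := fun z => past (p.evol f z.2.2 z.2.1) t)
    fun i => ?_).comp (measurable_prodMk_left (x := ()))
  exact (measurable_past (measurable_evol hf i)).comp
    (f := fun z : Unit × ℝ => (z.2, t)) (by fun_prop)

theorem mean_forward_zero (hρ : ∀ᵐ z ∂ρ, z.1 ∈ Icc 0 p.B) {E e : ℝ → ℝ}
    (hE : ∀ x, HasDerivAt E (e x) x) (he : Continuous e)
    (hE0 : E 0 = 0) (hE_nonneg : ∀ x, 0 ≤ x → 0 ≤ E x) (he_nonneg : ∀ x, 0 ≤ x → 0 ≤ e x)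
    {t : ℝ} (ht : 0 ≤ t) :
    p.mean ρ (onRegime 0 fun y => ENNReal.ofReal (E y)) t
      + past (p.mean ρ (onRegime 0 fun y => ENNReal.ofReal (-p.μ 0 * e y + p.Λ 0 * E y))) t =
    p.mean ρ (onRegime 0 fun y => ENNReal.ofReal (E y)) 0
      + past (p.mean ρ (onRegime 1 fun y => ENNReal.ofReal (p.Λ 1) * ENNReal.ofReal (E y))) t := by
  have hEc : Continuous E := continuous_iff_continuousAt.2 fun x => (hE x).continuousAt
  have m1 : ∀ j, Measurable (onRegime 0 (fun y => ENNReal.ofReal (E y)) j) :=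
    measurable_onRegime (by fun_prop) 0
  have m2 : ∀ j, Measurable (onRegime 0
    (fun y => ENNReal.ofReal (-p.μ 0 * e y + p.Λ 0 * E y)) j) := measurable_onRegime (by fun_prop) 0
  have m3 : ∀ j, Measurable (onRegime 1
    (fun y => ENNReal.ofReal (p.Λ 1) * ENNReal.ofReal (E y)) j) := measurable_onRegime (by fun_prop) 1
  rw [← past_mean m2, ← past_mean m3, mean_zero hρ, mean,
    ← lintegral_add_left (measurable_evol_pair' m1 t), ← lintegral_add_left (measurable_test_pair m1)]
  refine lintegral_congr_ae ?_
  filter_upwards [hρ] with z hz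
  exact evol_forward_zero hE he hE0 hE_nonneg he_nonneg z.2 hz ht

theorem mean_forward_one (hρ : ∀ᵐ z ∂ρ, z.1 ∈ Icc 0 p.B) {E e : ℝ → ℝ}
    (hE : ∀ x, HasDerivAt E (e x) x) (he : Continuous e)
    (hE_nonneg : ∀ x, 0 ≤ x → 0 ≤ E x) (he_nonneg : ∀ x, 0 ≤ x → 0 ≤ e x)
    {t : ℝ} (ht : 0 ≤ t) :
    p.mean ρ (onRegime 1 fun y => ENNReal.ofReal (E y)) t
      + past (p.mean ρ (onRegime 1 fun y => ENNReal.ofReal (p.Λ 1 * E y))) t =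
    p.mean ρ (onRegime 1 fun y => ENNReal.ofReal (E y)) 0
      + past (p.mean ρ (onRegime 1 fun y =>
          if y < p.B then ENNReal.ofReal (p.μ 1 * e y) else 0)) t
      + past (p.mean ρ (onRegime 0 fun y => ENNReal.ofReal (p.Λ 0) * ENNReal.ofReal (E y))) t := by
  have hEc : Continuous E := continuous_iff_continuousAt.2 fun x => (hE x).continuousAt
  have m1 : ∀ j, Measurable (onRegime 1 (fun y => ENNReal.ofReal (E y)) j) :=
    measurable_onRegime (by fun_prop) 1
  have m2 : ∀ j, Measurable (onRegime 1
    (fun y => ENNReal.ofReal (p.Λ 1 * E y)) j) := measurable_onRegime (by fun_prop) 1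
  have m3 : ∀ j, Measurable (onRegime 0
    (fun y => ENNReal.ofReal (p.Λ 0) * ENNReal.ofReal (E y)) j) := measurable_onRegime (by fun_prop) 0
  have m4 : ∀ j, Measurable (onRegime 1
    (fun y => if y < p.B then ENNReal.ofReal (p.μ 1 * e y) else 0) j) :=
    measurable_onRegime (Measurable.ite measurableSet_Iio (by fun_prop) measurable_const) 1
  rw [← past_mean m2, ← past_mean m3, ← past_mean m4, mean_zero hρ, mean,
    ← lintegral_add_left (measurable_evol_pair' m1 t), ← lintegral_add_left (measurable_test_pair m1),
    ← lintegral_add_right _ (measurable_past_evol m3 t)]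
  refine lintegral_congr_ae ?_
  filter_upwards [hρ] with z hz
  exact evol_forward_one hE he hE_nonneg he_nonneg z.2 hz ht

/-! ### The distribution functions and their transforms -/

theorem mean_upTo_ne_top (s : Fin 2) (t a : ℝ) : p.mean ρ (upTo s a) t ≠ ⊤ :=
  ((mean_le_one (measurable_upTo s a) (upTo_le_one s a) t).trans_lt ENNReal.one_lt_top).ne

theorem dist_le_one (s : Fin 2) (t a : ℝ) : p.dist ρ s t a ≤ 1 :=
  ENNReal.toReal_mono ENNReal.one_ne_top
    (mean_le_one (measurable_upTo s a) (upTo_le_one s a) t)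

theorem measurable_dist (s : Fin 2) (a : ℝ) : Measurable fun t => p.dist ρ s t a :=
  (measurable_mean (measurable_upTo s a)).ennreal_toReal

theorem measurable_dist' (s : Fin 2) (t : ℝ) : Measurable fun a => p.dist ρ s t a :=
  (measurable_mean_upTo s t).ennreal_toReal

theorem mean_expPrim_le (s : Fin 2) (t ξ : ℝ) :
    p.mean ρ (onRegime s fun x => ENNReal.ofReal (expPrim ξ x)) t ≤
      ENNReal.ofReal (expPrim ξ p.B) := by
  refine mean_le (measurable_expPrim_test s ξ) (fun j y hy => ?_) t
  unfold onRegime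
  split_ifs
  · exact ENNReal.ofReal_le_ofReal (expPrim_le ξ hy)
  · exact zero_le

theorem mean_expPrim_ne_top (s : Fin 2) (t ξ : ℝ) :
    p.mean ρ (onRegime s fun x => ENNReal.ofReal (expPrim ξ x)) t ≠ ⊤ :=
  ((mean_expPrim_le s t ξ).trans_lt ENNReal.ofReal_lt_top).ne

theorem lapl_le (s : Fin 2) (t ξ : ℝ) : p.lapl ρ s t ξ ≤ expPrim ξ p.B := by
  have := ENNReal.toReal_mono ENNReal.ofReal_ne_top (mean_expPrim_le (p := p) (ρ := ρ) s t ξ)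
  rwa [ENNReal.toReal_ofReal (expPrim_nonneg ξ p.B_pos.le)] at this

theorem measurable_lapl (s : Fin 2) (ξ : ℝ) : Measurable fun t => p.lapl ρ s t ξ :=
  (measurable_mean (measurable_expPrim_test s ξ)).ennreal_toReal

/-- By linearity of `evol` the mixture over `a` can be taken after the evolution, and by Tonelli
after the average over `ρ`. -/
theorem mean_expPrim_eq_lintegral (s : Fin 2) (t ξ : ℝ) :
    p.mean ρ (onRegime s fun x => ENNReal.ofReal (expPrim ξ x)) t =
      ∫⁻ a in Ioc 0 p.B, ENNReal.ofReal (Real.exp (-(ξ * a))) * p.mean ρ (upTo s a) t := by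
  have hm : ∀ j, Measurable fun z : ℝ × ℝ =>
      ENNReal.ofReal (Real.exp (-(ξ * z.1))) * upTo s z.1 j z.2 := fun j =>
    Measurable.mul (by fun_prop) (measurable_upTo_param s j)
  rw [mean_congr (f' := fun j y =>
    ∫⁻ a in Ioc 0 p.B, ENNReal.ofReal (Real.exp (-(ξ * a))) * upTo s a j y)]
  · unfold mean
    have h1 : ∀ z : ℝ × Fin 2, p.evol (fun j y =>
        ∫⁻ a in Ioc 0 p.B, ENNReal.ofReal (Real.exp (-(ξ * a))) * upTo s a j y) z.2 z.1 t =
        ∫⁻ a in Ioc 0 p.B, ENNReal.ofReal (Real.exp (-(ξ * a))) * p.evol (upTo s a) z.2 z.1 t := by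
      intro z
      rw [evol_lintegral _ (f := fun a j y => ENNReal.ofReal (Real.exp (-(ξ * a))) * upTo s a j y)
        hm]
      exact lintegral_congr fun a => evol_const_mul _ (measurable_upTo s a) z.2 z.1 t
    rw [lintegral_congr h1, lintegral_lintegral_swap]
    · refine lintegral_congr fun a => ?_
      rw [lintegral_const_mul _ (measurable_evol_pair' (measurable_upTo s a) t)]
    · refine Measurable.aemeasurable ?_
      refine (measurable_of_regime (g := fun w : ℝ × ℝ × Fin 2 =>
        ENNReal.ofReal (Real.exp (-(ξ * w.1))) * p.evol (upTo s w.1) w.2.2 w.2.1 t)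
        fun i => ?_).comp measurable_swap
      refine Measurable.mul (by fun_prop) ?_
      exact (measurable_evol_param (measurable_upTo_param s) i).comp
        (f := fun z : ℝ × ℝ => (z.1, z.2, t)) (by fun_prop)
  · intro j y hy
    unfold upTo onRegime
    split_ifs
    · exact ofReal_expPrim_eq_lintegral ξ hy
    · simp

theorem lapl_eq_integral (s : Fin 2) (t ξ : ℝ) :
    p.lapl ρ s t ξ = ∫ a in (0 : ℝ)..p.B, Real.exp (-(ξ * a)) * p.dist ρ s t a := by
  rw [intervalIntegral.integral_of_le p.B_pos.le, lapl, mean_expPrim_eq_lintegral,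
    integral_eq_lintegral_of_nonneg_ae]
  · congr 1
    refine lintegral_congr fun a => ?_
    rw [ENNReal.ofReal_mul (Real.exp_pos _).le, dist, ENNReal.ofReal_toReal (mean_upTo_ne_top s t a)]
  · exact .of_forall fun a => mul_nonneg (Real.exp_pos _).le (dist_nonneg s t a)
  · exact (Measurable.mul (by fun_prop) (measurable_dist' s t)).aestronglyMeasurable

end Params

theorem past_le {g : ℝ → ℝ≥0∞} (hneg : ∀ s < 0, g s = 0) {C : ℝ≥0∞} (hC : ∀ s, g s ≤ C)
    {t : ℝ} (ht : 0 ≤ t) : past g t ≤ C * ENNReal.ofReal t := by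
  rw [past_eq_setLIntegral_Ioc hneg ht]
  refine (lintegral_mono (g := fun _ => C) fun s => hC s).trans ?_
  simp

theorem toReal_past {g : ℝ → ℝ≥0∞} (hg : Measurable g) (hneg : ∀ s < 0, g s = 0)
    (hfin : ∀ s, g s ≠ ⊤) {t : ℝ} (ht : 0 ≤ t) :
    (past g t).toReal = ∫ s in (0 : ℝ)..t, (g s).toReal := by
  rw [past_eq_setLIntegral_Ioc hneg ht, intervalIntegral.integral_of_le ht,
    integral_toReal hg.aemeasurable (.of_forall fun s => (hfin s).lt_top)]

theorem intervalIntegrable_of_bounded {g : ℝ → ℝ} (hg : Measurable g) {C : ℝ}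
    (hC : ∀ s, |g s| ≤ C) (a b : ℝ) : IntervalIntegrable g volume a b := by
  rw [intervalIntegrable_iff]
  exact Measure.integrableOn_of_bounded (by simp) hg.aestronglyMeasurable
    (.of_forall fun s => hC s)

/-! ### The integrated equations for `L_0`, `L_1` and `ψ` -/

namespace Params

variable {p : Params} {ρ : Measure (ℝ × Fin 2)}

/-- The means used in the forward equations, in terms of the boundary functions. -/
theorem toReal_mean_affine [IsProbabilityMeasure ρ] (s : Fin 2) (ξ t : ℝ) {α β : ℝ} (hα : 0 ≤ α)
    (hβ : 0 ≤ β) :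
    p.mean ρ (onRegime s fun y => ENNReal.ofReal (α * Real.exp (-(ξ * y)) + β * expPrim ξ y)) t ≠ ⊤ ∧
    (p.mean ρ (onRegime s fun y =>
        ENNReal.ofReal (α * Real.exp (-(ξ * y)) + β * expPrim ξ y)) t).toReal =
      α * (p.dist ρ s t 0 - ξ * p.lapl ρ s t ξ) + β * p.lapl ρ s t ξ := by
  have hc := continuous_expPrim ξ
  have hm : ∀ j, Measurable (onRegime s (fun y =>
      ENNReal.ofReal (α * Real.exp (-(ξ * y)) + β * expPrim ξ y)) j) :=
    measurable_onRegime (by fun_prop) s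
  have hE := measurable_expPrim_test s ξ
  have hU := measurable_upTo s 0
  -- The identity used is `α e^{-ξy} + β E + α ξ⁺ E = α + (β + α ξ⁻) E` on `[0, B]`. Splitting `ξ`
  -- into its positive and negative parts keeps both sides nonnegative.
  have h := mean_congr (p := p) (ρ := ρ) (f := fun j y => onRegime s (fun y =>
      ENNReal.ofReal (α * Real.exp (-(ξ * y)) + β * expPrim ξ y)) j y
      + ENNReal.ofReal (α * max ξ 0) * onRegime s (fun y => ENNReal.ofReal (expPrim ξ y)) j y)
    (f' := fun j y => ENNReal.ofReal α * upTo s 0 j y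
      + ENNReal.ofReal (β + α * max (-ξ) 0) *
        onRegime s (fun y => ENNReal.ofReal (expPrim ξ y)) j y) (fun j y hy => ?_) t
  · rw [mean_add hm (fun j => (hE j).const_mul _), mean_const_mul _ hE,
      mean_add (fun j => (hU j).const_mul _) (fun j => (hE j).const_mul _), mean_const_mul _ hU,
      mean_const_mul _ hE] at h
    have hU_fin := mean_upTo_ne_top (p := p) (ρ := ρ) s t 0
    have hE_fin := mean_expPrim_ne_top (p := p) (ρ := ρ) s t ξ
    have hfin : p.mean ρ (onRegime s fun y =>
        ENNReal.ofReal (α * Real.exp (-(ξ * y)) + β * expPrim ξ y)) t ≠ ⊤ := by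
      refine ne_top_of_le_ne_top ?_ (le_self_add.trans h.le)
      finiteness
    refine ⟨hfin, ?_⟩
    have h' := congrArg ENNReal.toReal h
    rw [ENNReal.toReal_add hfin (by finiteness), ENNReal.toReal_add (by finiteness) (by finiteness),
      ENNReal.toReal_mul, ENNReal.toReal_mul, ENNReal.toReal_mul, ENNReal.toReal_ofReal hα,
      ENNReal.toReal_ofReal (by positivity), ENNReal.toReal_ofReal (by positivity)] at h'
    change _ + _ * p.lapl ρ s t ξ = _ * p.dist ρ s t 0 + _ * p.lapl ρ s t ξ at h'
    have hmax : max ξ 0 - max (-ξ) 0 = ξ := by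
      rcases le_total 0 ξ with h | h
      · rw [max_eq_left h, max_eq_right (by linarith)]; ring
      · rw [max_eq_right h, max_eq_left (by linarith)]; ring
    linear_combination h' - α * p.lapl ρ s t ξ * hmax
  · unfold upTo onRegime
    dsimp only
    split_ifs with h1 h2
    · have := expPrim_nonneg ξ hy.1
      rw [← ENNReal.ofReal_mul (by positivity), ← ENNReal.ofReal_mul (by positivity), mul_one,
        ← ENNReal.ofReal_add (by positivity) (by positivity),
        ← ENNReal.ofReal_add (by positivity) (by positivity)]
      congr 1
      have h3 := exp_add_mul_expPrim ξ y
      have hmax : max ξ 0 - max (-ξ) 0 = ξ := by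
        rcases le_total 0 ξ with h | h
        · rw [max_eq_left h, max_eq_right (by linarith)]; ring
        · rw [max_eq_right h, max_eq_left (by linarith)]; ring
      linear_combination α * h3 + α * expPrim ξ y * hmax
    · exact absurd hy.1 h2
    · simp

/-- `E_ξ` is an admissible test function in regime 0 because it vanishes at `0`. The result is the
integrated form of `L_0' = μ₀(φ - ξ L_0) - Λ₀ L_0 + Λ₁ L_1`. -/
theorem lapl_forward_zero [IsProbabilityMeasure ρ] (hρ : ∀ᵐ z ∂ρ, z.1 ∈ Icc 0 p.B) (ξ : ℝ)
    {t : ℝ} (ht : 0 ≤ t) :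
    p.lapl ρ 0 t ξ + ∫ u in (0 : ℝ)..t, (-p.μ 0 * (p.dist ρ 0 u 0 - ξ * p.lapl ρ 0 u ξ)
        + p.Λ 0 * p.lapl ρ 0 u ξ) =
      p.lapl ρ 0 0 ξ + ∫ u in (0 : ℝ)..t, p.Λ 1 * p.lapl ρ 1 u ξ := by
  have hc := continuous_expPrim ξ
  have h := mean_forward_zero hρ (hasDerivAt_expPrim ξ) (by fun_prop) (expPrim_zero ξ)
    (fun x => expPrim_nonneg ξ) (fun x _ => (Real.exp_pos _).le) ht
  have hμ : 0 ≤ -p.μ 0 := by linarith [p.μ_zero_neg]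
  have hΛ := (p.Λ_pos 0).le
  have haff := fun u => toReal_mean_affine (p := p) (ρ := ρ) 0 ξ u hμ hΛ
  have hm2 : ∀ u, p.mean ρ (onRegime 1 fun y =>
      ENNReal.ofReal (p.Λ 1) * ENNReal.ofReal (expPrim ξ y)) u = ENNReal.ofReal (p.Λ 1) *
        p.mean ρ (onRegime 1 fun y => ENNReal.ofReal (expPrim ξ y)) u := fun u => by
    rw [← mean_const_mul _ (measurable_expPrim_test 1 ξ)]
    refine mean_congr (fun j y _ => ?_) u
    unfold onRegime; split_ifs <;> simp
  have hfin2 : ∀ u, p.mean ρ (onRegime 1 fun y =>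
      ENNReal.ofReal (p.Λ 1) * ENNReal.ofReal (expPrim ξ y)) u ≠ ⊤ := fun u => by
    rw [hm2]; exact ENNReal.mul_ne_top ENNReal.ofReal_ne_top (mean_expPrim_ne_top 1 u ξ)
  have hM2 := measurable_mean (p := p) (ρ := ρ) (measurable_onRegime (h := fun y =>
      ENNReal.ofReal (p.Λ 1) * ENNReal.ofReal (expPrim ξ y)) (by fun_prop) 1)
  have hM1 := measurable_mean (p := p) (ρ := ρ) (measurable_onRegime (h := fun y =>
      ENNReal.ofReal (-p.μ 0 * Real.exp (-(ξ * y)) + p.Λ 0 * expPrim ξ y)) (by fun_prop) 0)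
  have hp2 : past (p.mean ρ (onRegime 1 fun y =>
      ENNReal.ofReal (p.Λ 1) * ENNReal.ofReal (expPrim ξ y))) t ≠ ⊤ := by
    refine ((past_le (fun s hs => mean_of_neg _ hs) (fun s => (hm2 s).trans_le
      (mul_le_mul_right (mean_expPrim_le 1 s ξ) _)) ht).trans_lt ?_).ne
    finiteness
  have hp1 : past (p.mean ρ (onRegime 0 fun y =>
      ENNReal.ofReal (-p.μ 0 * Real.exp (-(ξ * y)) + p.Λ 0 * expPrim ξ y))) t ≠ ⊤ := by
    refine ne_top_of_le_ne_top ?_ (le_add_self.trans h.le)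
    exact ENNReal.add_ne_top.2 ⟨mean_expPrim_ne_top 0 0 ξ, hp2⟩
  have h' := congrArg ENNReal.toReal h
  rw [ENNReal.toReal_add (mean_expPrim_ne_top 0 t ξ) hp1,
    ENNReal.toReal_add (mean_expPrim_ne_top 0 0 ξ) hp2,
    toReal_past hM1 (fun s hs => mean_of_neg _ hs) (fun s => (haff s).1) ht,
    toReal_past hM2 (fun s hs => mean_of_neg _ hs) hfin2 ht] at h'
  simp only [(haff _).2, hm2, ENNReal.toReal_mul, ENNReal.toReal_ofReal (p.Λ_pos 1).le] at h'
  exact h'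

theorem lapl_forward_one [IsProbabilityMeasure ρ] (hρ : ∀ᵐ z ∂ρ, z.1 ∈ Icc 0 p.B) (ξ : ℝ)
    {t : ℝ} (ht : 0 ≤ t) :
    p.lapl ρ 1 t ξ + ∫ u in (0 : ℝ)..t, p.Λ 1 * p.lapl ρ 1 u ξ =
      p.lapl ρ 1 0 ξ
        + (∫ u in (0 : ℝ)..t, p.μ 1 * (p.dist ρ 1 u 0 - ξ * p.lapl ρ 1 u ξ
            - Real.exp (-(ξ * p.B)) * p.dist ρ 1 u p.B))
        + ∫ u in (0 : ℝ)..t, p.Λ 0 * p.lapl ρ 0 u ξ := by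
  have hc := continuous_expPrim ξ
  have hμ := p.μ_one_pos.le
  have h := mean_forward_one hρ (hasDerivAt_expPrim ξ) (by fun_prop)
    (fun x => expPrim_nonneg ξ) (fun x _ => (Real.exp_pos _).le) ht
  have hm0 : ∀ u, p.mean ρ (onRegime 0 fun y =>
      ENNReal.ofReal (p.Λ 0) * ENNReal.ofReal (expPrim ξ y)) u = ENNReal.ofReal (p.Λ 0) *
        p.mean ρ (onRegime 0 fun y => ENNReal.ofReal (expPrim ξ y)) u := fun u => by
    rw [← mean_const_mul _ (measurable_expPrim_test 0 ξ)]
    refine mean_congr (fun j y _ => ?_) u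
    unfold onRegime; split_ifs <;> simp
  have hm1 : ∀ u, p.mean ρ (onRegime 1 fun y => ENNReal.ofReal (p.Λ 1 * expPrim ξ y)) u =
      ENNReal.ofReal (p.Λ 1) *
        p.mean ρ (onRegime 1 fun y => ENNReal.ofReal (expPrim ξ y)) u := fun u => by
    rw [← mean_const_mul _ (measurable_expPrim_test 1 ξ)]
    refine mean_congr (fun j y _ => ?_) u
    unfold onRegime; split_ifs <;> simp [ENNReal.ofReal_mul (p.Λ_pos 1).le]
  have mif : Measurable fun y : ℝ =>
      if y < p.B then ENNReal.ofReal (p.μ 1 * Real.exp (-(ξ * y))) else 0 :=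
    Measurable.ite measurableSet_Iio (by fun_prop) measurable_const
  -- The drift acts only below `B`. On `[0, B]` the cut-off test function misses exactly the value
  -- at `B`, which contributes `F_1(u, B)`: this is how `ω` enters the equation.
  have hm2 : ∀ u, p.mean ρ (onRegime 1 fun y =>
        if y < p.B then ENNReal.ofReal (p.μ 1 * Real.exp (-(ξ * y))) else 0) u
      + ENNReal.ofReal (p.μ 1 * Real.exp (-(ξ * p.B))) * p.mean ρ (upTo 1 p.B) u =
      p.mean ρ (onRegime 1 fun y =>
        ENNReal.ofReal (p.μ 1 * Real.exp (-(ξ * y)) + 0 * expPrim ξ y)) u := fun u => by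
    rw [← mean_const_mul _ (measurable_upTo 1 p.B),
      ← mean_add (measurable_onRegime mif 1) (fun j => (measurable_upTo 1 p.B j).const_mul _)]
    refine mean_congr (fun j y hy => ?_) u
    unfold upTo onRegime
    dsimp only
    split_ifs with h1 h2 h3 h4
    · exact absurd h2 (not_lt.2 h3)
    · simp
    · have : y = p.B := le_antisymm hy.2 h4
      simp [this]
    · exact absurd (not_lt.1 h2) h4
    · simp
  have haff := fun u => toReal_mean_affine (p := p) (ρ := ρ) 1 ξ u hμ le_rfl
  have hfin2 : ∀ u, p.mean ρ (onRegime 1 fun y =>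
        if y < p.B then ENNReal.ofReal (p.μ 1 * Real.exp (-(ξ * y))) else 0) u ≠ ⊤ := fun u =>
    ne_top_of_le_ne_top (haff u).1 (le_self_add.trans (hm2 u).le)
  have hr2 : ∀ u, (p.mean ρ (onRegime 1 fun y =>
        if y < p.B then ENNReal.ofReal (p.μ 1 * Real.exp (-(ξ * y))) else 0) u).toReal =
      p.μ 1 * (p.dist ρ 1 u 0 - ξ * p.lapl ρ 1 u ξ
            - Real.exp (-(ξ * p.B)) * p.dist ρ 1 u p.B) := fun u => by
    have h1 := congrArg ENNReal.toReal (hm2 u)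
    rw [ENNReal.toReal_add (hfin2 u) (ENNReal.mul_ne_top ENNReal.ofReal_ne_top
      (mean_upTo_ne_top 1 u p.B)), (haff u).2, ENNReal.toReal_mul,
      ENNReal.toReal_ofReal (by positivity)] at h1
    change _ + _ * p.dist ρ 1 u p.B = _ at h1
    linear_combination h1
  have hM0 := measurable_mean (p := p) (ρ := ρ) (measurable_onRegime (h := fun y =>
      ENNReal.ofReal (p.Λ 0) * ENNReal.ofReal (expPrim ξ y)) (by fun_prop) 0)
  have hM1 := measurable_mean (p := p) (ρ := ρ) (measurable_onRegime (h := fun y =>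
      ENNReal.ofReal (p.Λ 1 * expPrim ξ y)) (by fun_prop) 1)
  have hM2 := measurable_mean (p := p) (ρ := ρ) (measurable_onRegime mif 1)
  have hneg : ∀ f : Fin 2 → ℝ → ℝ≥0∞, ∀ s < 0, p.mean ρ f s = 0 := fun f s hs => mean_of_neg f hs
  have hp0 : past (p.mean ρ (onRegime 0 fun y =>
      ENNReal.ofReal (p.Λ 0) * ENNReal.ofReal (expPrim ξ y))) t ≠ ⊤ := by
    refine ((past_le (hneg _) (fun s => (hm0 s).trans_le
      (mul_le_mul_right (mean_expPrim_le 0 s ξ) _)) ht).trans_lt ?_).ne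
    finiteness
  have hp1 : past (p.mean ρ (onRegime 1 fun y => ENNReal.ofReal (p.Λ 1 * expPrim ξ y))) t ≠ ⊤ := by
    refine ((past_le (hneg _) (fun s => (hm1 s).trans_le
      (mul_le_mul_right (mean_expPrim_le 1 s ξ) _)) ht).trans_lt ?_).ne
    finiteness
  have hp2 : past (p.mean ρ (onRegime 1 fun y =>
        if y < p.B then ENNReal.ofReal (p.μ 1 * Real.exp (-(ξ * y))) else 0)) t ≠ ⊤ := by
    obtain ⟨C, hC⟩ : ∃ C : ℝ, ∀ y ∈ Icc 0 p.B, p.μ 1 * Real.exp (-(ξ * y)) ≤ C := by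
      obtain ⟨C, hC⟩ := (isCompact_Icc (a := 0) (b := p.B)).bddAbove_image
        (f := fun y => p.μ 1 * Real.exp (-(ξ * y))) (by fun_prop)
      exact ⟨C, fun y hy => hC (mem_image_of_mem _ hy)⟩
    refine ((past_le (C := ENNReal.ofReal C) (hneg _) (fun s => mean_le (measurable_onRegime mif 1)
      (fun j y hy => ?_) s) ht).trans_lt ?_).ne
    · unfold onRegime
      dsimp only
      split_ifs
      · exact ENNReal.ofReal_le_ofReal (hC y hy)
      · exact zero_le
      · exact zero_le
    · finiteness
  have h' := congrArg ENNReal.toReal h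
  rw [ENNReal.toReal_add (mean_expPrim_ne_top 1 t ξ) hp1,
    ENNReal.toReal_add (ENNReal.add_ne_top.2 ⟨mean_expPrim_ne_top 1 0 ξ, hp2⟩) hp0,
    ENNReal.toReal_add (mean_expPrim_ne_top 1 0 ξ) hp2,
    toReal_past hM1 (hneg _) (fun s => by
      rw [hm1]; exact ENNReal.mul_ne_top ENNReal.ofReal_ne_top (mean_expPrim_ne_top 1 s ξ)) ht,
    toReal_past hM0 (hneg _) (fun s => by
      rw [hm0]; exact ENNReal.mul_ne_top ENNReal.ofReal_ne_top (mean_expPrim_ne_top 0 s ξ)) ht,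
    toReal_past hM2 (hneg _) hfin2 ht] at h'
  simp only [hr2, hm1, hm0, ENNReal.toReal_mul, ENNReal.toReal_ofReal (p.Λ_pos _).le] at h'
  exact h'

/-- The test function `1` in regime 1 has no drift term. In regime 0 the analogous choice is not
available: `1` does not vanish at `0`, where mass is lost. -/
theorem dist_forward [IsProbabilityMeasure ρ] (hρ : ∀ᵐ z ∂ρ, z.1 ∈ Icc 0 p.B)
    {t : ℝ} (ht : 0 ≤ t) :
    p.dist ρ 1 t 0 + ∫ u in (0 : ℝ)..t, p.Λ 1 * p.dist ρ 1 u 0 =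
      p.dist ρ 1 0 0 + ∫ u in (0 : ℝ)..t, p.Λ 0 * p.dist ρ 0 u 0 := by
  have h := mean_forward_one hρ (E := fun _ => 1) (e := fun _ => 0) (fun x => hasDerivAt_const x 1)
    (by fun_prop) (fun _ _ => zero_le_one) (fun _ _ => le_rfl) ht
  have key : ∀ (c : ℝ) (j : Fin 2), 0 ≤ c → ∀ u,
      p.mean ρ (onRegime j fun _ => ENNReal.ofReal c) u =
        ENNReal.ofReal c * p.mean ρ (upTo j 0) u := fun c j hc u => by
    rw [← mean_const_mul _ (measurable_upTo j 0)]
    refine mean_congr (fun i y hy => ?_) u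
    unfold upTo onRegime
    dsimp only
    simp [hy.1]
  have hz : ∀ u, p.mean ρ (onRegime 1 fun y =>
      if y < p.B then ENNReal.ofReal (p.μ 1 * 0) else 0) u = 0 := fun u => by
    have := key 0 1 le_rfl u
    simpa using this
  simp only [mul_one] at h
  rw [funext hz, funext (key _ _ (p.Λ_pos 1).le), key _ _ zero_le_one, key _ _ zero_le_one] at h
  have e0 : (fun u => p.mean ρ (onRegime 0 fun _ => ENNReal.ofReal (p.Λ 0) * ENNReal.ofReal 1) u) =
      fun u => ENNReal.ofReal (p.Λ 0) * p.mean ρ (upTo 0 0) u := funext fun u => by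
    rw [← key _ _ (p.Λ_pos 0).le]; simp
  have hz' : past (fun _ => 0) t = 0 := lintegral_zero
  change _ + _ = _ + _ + past (fun u => p.mean ρ (onRegime 0 fun _ =>
    ENNReal.ofReal (p.Λ 0) * ENNReal.ofReal 1) u) t at h
  rw [e0, hz', add_zero, ENNReal.ofReal_one, one_mul, one_mul] at h
  have hneg : ∀ (i j : Fin 2), ∀ s < 0, ENNReal.ofReal (p.Λ i) * p.mean ρ (upTo j 0) s = 0 :=
    fun i j s hs => by rw [mean_of_neg _ hs, mul_zero]
  have hM : ∀ (i j : Fin 2), Measurable fun s => ENNReal.ofReal (p.Λ i) * p.mean ρ (upTo j 0) s :=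
    fun i j => (measurable_mean (measurable_upTo j 0)).const_mul _
  have hfin : ∀ (i j : Fin 2) s, ENNReal.ofReal (p.Λ i) * p.mean ρ (upTo j 0) s ≠ ⊤ :=
    fun i j s => ENNReal.mul_ne_top ENNReal.ofReal_ne_top (mean_upTo_ne_top j s 0)
  have hp : ∀ (i j : Fin 2), past (fun s => ENNReal.ofReal (p.Λ i) * p.mean ρ (upTo j 0) s) t ≠ ⊤ :=
    fun i j => by
      refine ((past_le (C := ENNReal.ofReal (p.Λ i) * 1) (hneg i j) (fun s => ?_) ht).trans_lt
        (by finiteness)).ne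
      gcongr
      exact mean_le_one (measurable_upTo j 0) (upTo_le_one j 0) s
  have h' := congrArg ENNReal.toReal h
  rw [ENNReal.toReal_add (mean_upTo_ne_top 1 t 0) (hp _ _),
    ENNReal.toReal_add (mean_upTo_ne_top 1 0 0) (hp _ _),
    toReal_past (hM _ _) (hneg _ _) (hfin _ _) ht,
    toReal_past (hM _ _) (hneg _ _) (hfin _ _) ht] at h'
  simp only [ENNReal.toReal_mul, ENNReal.toReal_ofReal (p.Λ_pos _).le] at h'
  exact h'

end Params

/-! ### Solving the equations, in time and under the Laplace transform -/

/-- Variation of constants for an integrated linear equation. -/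
theorem exp_mul_eq_of_integral_eq {Z β : ℝ → ℝ} {k t : ℝ} (ht : 0 ≤ t)
    (hZ : IntervalIntegrable Z volume 0 t) (hβ : IntervalIntegrable β volume 0 t)
    (h : ∀ s ∈ Icc 0 t, Z s = Z 0 + ∫ u in (0 : ℝ)..s, (k * Z u + β u)) :
    Real.exp (-(k * t)) * Z t = Z 0 + ∫ s in (0 : ℝ)..t, β s * Real.exp (-(k * s)) := by
  have hγ : IntervalIntegrable (fun u => k * Z u + β u) volume 0 t := (hZ.const_mul k).add hβ
  have hexp : ∀ s : ℝ, HasDerivAt (fun s => Real.exp (-(k * s))) (-k * Real.exp (-(k * s))) s :=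
    fun s => by
      have h1 : HasDerivAt (fun s : ℝ => -(k * s)) (-k) s := by
        convert! ((hasDerivAt_id s).const_mul k).neg using 1; simp
      convert! h1.exp using 1
      ring
  -- `Z` is only an indefinite integral, differentiable almost everywhere; hence integration by
  -- parts is used in its absolutely continuous form.
  have hac1 : AbsolutelyContinuousOnInterval (fun s => Real.exp (-(k * s))) 0 t :=
    ContDiffOn.absolutelyContinuousOnInterval (by fun_prop)
  have hac2 := hγ.absolutelyContinuousOnInterval_intervalIntegral (c := 0) (by simp)
  have hparts := hac1.integral_deriv_mul_eq_sub hac2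
  have hae := hγ.ae_hasDerivAt_integral
  have hcongr : ∫ s in (0 : ℝ)..t, (deriv (fun s => Real.exp (-(k * s))) s *
        (∫ u in (0 : ℝ)..s, (k * Z u + β u))
        + Real.exp (-(k * s)) * deriv (fun s => ∫ u in (0 : ℝ)..s, (k * Z u + β u)) s) =
      ∫ s in (0 : ℝ)..t, (β s * Real.exp (-(k * s)) + Z 0 * (k * Real.exp (-(k * s)))) := by
    refine intervalIntegral.integral_congr_ae ?_
    filter_upwards [hae] with s hs hst
    rw [uIoc_of_le ht] at hst
    have hst' : s ∈ Icc 0 t := ⟨hst.1.le, hst.2⟩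
    rw [(hexp s).deriv, (hs (by rwa [uIcc_of_le ht]) 0 (by simp)).deriv]
    linear_combination (k * Real.exp (-(k * s))) * h s hst'
  have hint : ∫ s in (0 : ℝ)..t, Z 0 * (k * Real.exp (-(k * s))) =
      Z 0 * (1 - Real.exp (-(k * t))) := by
    rw [intervalIntegral.integral_const_mul, intervalIntegral.integral_eq_sub_of_hasDerivAt
      (f := fun s => -Real.exp (-(k * s)))]
    · simp only [mul_zero, neg_zero, Real.exp_zero]; ring
    · intro s _
      convert! (hexp s).neg using 1
      ring
    · exact Continuous.intervalIntegrable (by fun_prop) _ _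
  rw [hcongr, intervalIntegral.integral_add, hint] at hparts
  · rw [h t ⟨ht, le_rfl⟩]
    simp only [intervalIntegral.integral_same] at hparts
    linear_combination -hparts
  · exact hβ.mul_continuousOn (by fun_prop)
  · exact Continuous.intervalIntegrable (by fun_prop) _ _

theorem integrableOn_exp_mul_of_bounded {f : ℝ → ℝ} (hf : Measurable f) {C : ℝ}
    (hC : ∀ t, |f t| ≤ C) {m : ℝ} (hm : 0 < m) :
    IntegrableOn (fun t => Real.exp (-(m * t)) * f t) (Ioi 0) := by
  have h : IntegrableOn (fun t => Real.exp (-(m * t))) (Ioi 0) := by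
    simpa only [neg_mul] using exp_neg_integrableOn_Ioi 0 hm
  exact Integrable.mul_bdd h hf.aestronglyMeasurable (.of_forall fun t => hC t)

theorem tendsto_partialLaplace {f : ℝ → ℝ} {m : ℝ}
    (h : IntegrableOn (fun t => Real.exp (-(m * t)) * f t) (Ioi 0)) :
    Filter.Tendsto (fun t => Params.partialLaplace f m t) Filter.atTop (𝓝 (laplace f m)) := by
  have := intervalIntegral_tendsto_integral_Ioi 0 h Filter.tendsto_id
  simpa only [mul_comm, laplace, Params.partialLaplace, id] using this

namespace Params

variable {p : Params} {ρ : Measure (ℝ × Fin 2)}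

theorem abs_dist_le [IsProbabilityMeasure ρ] (s : Fin 2) (t a : ℝ) : |p.dist ρ s t a| ≤ 1 := by
  rw [abs_of_nonneg (dist_nonneg s t a)]; exact dist_le_one s t a

theorem abs_lapl_le [IsProbabilityMeasure ρ] (s : Fin 2) (t ξ : ℝ) :
    |p.lapl ρ s t ξ| ≤ expPrim ξ p.B := by
  rw [abs_of_nonneg (lapl_nonneg s t ξ)]; exact lapl_le s t ξ

theorem intervalIntegrable_dist [IsProbabilityMeasure ρ] (s : Fin 2) (c a b : ℝ) :
    IntervalIntegrable (fun t => p.dist ρ s t c) volume a b :=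
  intervalIntegrable_of_bounded (measurable_dist s c) (fun t => abs_dist_le s t c) a b

theorem intervalIntegrable_lapl [IsProbabilityMeasure ρ] (s : Fin 2) (ξ a b : ℝ) :
    IntervalIntegrable (fun t => p.lapl ρ s t ξ) volume a b :=
  intervalIntegrable_of_bounded (measurable_lapl s ξ) (fun t => abs_lapl_le s t ξ) a b

theorem dist_one_sub_add_integral [IsProbabilityMeasure ρ] (hρ : ∀ᵐ z ∂ρ, z.1 ∈ Icc 0 p.B)
    {t : ℝ} (ht : 0 ≤ t) : p.dist ρ 1 t 0 - p.dist ρ 1 0 0 +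
      ∫ u in (0 : ℝ)..t, (p.Λ 1 * p.dist ρ 1 u 0 - p.Λ 0 * p.dist ρ 0 u 0) = 0 := by
  rw [intervalIntegral.integral_sub ((intervalIntegrable_dist 1 0 0 t).const_mul _)
    ((intervalIntegrable_dist 0 0 0 t).const_mul _)]
  linarith [dist_forward hρ ht]

/-- The hypotheses say that `(α, β)` is a left eigenvector, with eigenvalue `k`, of the matrix of
the system for `(L_0, L_1)`. The combination then satisfies a scalar equation `Z' = kZ + source`, in
which the source consists of boundary functions only. -/
theorem eigen_combination [IsProbabilityMeasure ρ] (hρ : ∀ᵐ z ∂ρ, z.1 ∈ Icc 0 p.B) {ξ k α β : ℝ}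
    (h0 : α * (-p.μ 0 * ξ - p.Λ 0) + β * p.Λ 0 = k * α)
    (h1 : α * p.Λ 1 + β * (-p.μ 1 * ξ - p.Λ 1) = k * β) {t : ℝ} (ht : 0 ≤ t) :
    Real.exp (-(k * t)) * (α * p.lapl ρ 0 t ξ + β * p.lapl ρ 1 t ξ) =
      α * (p.lapl ρ 0 0 ξ + p.μ 0 * partialLaplace (fun u => p.dist ρ 0 u 0) k t)
      + β * (p.lapl ρ 1 0 ξ + p.μ 1 * partialLaplace (fun u => p.dist ρ 1 u 0) k t
        - p.μ 1 * Real.exp (-(ξ * p.B)) * partialLaplace (fun u => p.dist ρ 1 u p.B) k t) := by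
  have iL := fun s b => intervalIntegrable_lapl (p := p) (ρ := ρ) s ξ 0 b
  have iD := fun s c b => intervalIntegrable_dist (p := p) (ρ := ρ) s c 0 b
  have key := exp_mul_eq_of_integral_eq (k := k) (t := t)
    (Z := fun t => α * p.lapl ρ 0 t ξ + β * p.lapl ρ 1 t ξ)
    (β := fun u => α * p.μ 0 * p.dist ρ 0 u 0 + (β * p.μ 1 * p.dist ρ 1 u 0
      - β * p.μ 1 * Real.exp (-(ξ * p.B)) * p.dist ρ 1 u p.B)) ht
    (((iL 0 t).const_mul _).add ((iL 1 t).const_mul _))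
    (((iD 0 0 t).const_mul _).add (((iD 1 0 t).const_mul _).sub ((iD 1 p.B t).const_mul _))) ?_
  · rw [key]
    have e : ∀ s, (α * p.μ 0 * p.dist ρ 0 s 0 + (β * p.μ 1 * p.dist ρ 1 s 0
        - β * p.μ 1 * Real.exp (-(ξ * p.B)) * p.dist ρ 1 s p.B)) * Real.exp (-(k * s)) =
        α * p.μ 0 * (p.dist ρ 0 s 0 * Real.exp (-(k * s)))
        + (β * p.μ 1 * (p.dist ρ 1 s 0 * Real.exp (-(k * s)))
        - β * p.μ 1 * Real.exp (-(ξ * p.B)) * (p.dist ρ 1 s p.B * Real.exp (-(k * s)))) :=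
      fun s => by ring
    have iE := fun s c => (iD s c t).mul_continuousOn
      (g := fun s => Real.exp (-(k * s))) (by fun_prop)
    simp only [e]
    rw [intervalIntegral.integral_add ((iE 0 0).const_mul _)
      (((iE 1 0).const_mul _).sub ((iE 1 p.B).const_mul _)),
      intervalIntegral.integral_sub ((iE 1 0).const_mul _) ((iE 1 p.B).const_mul _),
      intervalIntegral.integral_const_mul, intervalIntegral.integral_const_mul,
      intervalIntegral.integral_const_mul]
    unfold partialLaplace
    ring
  · intro s hs
    have f0 := lapl_forward_zero hρ ξ hs.1
    have f1 := lapl_forward_one hρ ξ hs.1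
    have e0 : ∀ u, -p.μ 0 * (p.dist ρ 0 u 0 - ξ * p.lapl ρ 0 u ξ) + p.Λ 0 * p.lapl ρ 0 u ξ =
      -p.μ 0 * p.dist ρ 0 u 0 + (p.μ 0 * ξ + p.Λ 0) * p.lapl ρ 0 u ξ := fun u => by ring
    have e1 : ∀ u, p.μ 1 * (p.dist ρ 1 u 0 - ξ * p.lapl ρ 1 u ξ
            - Real.exp (-(ξ * p.B)) * p.dist ρ 1 u p.B) =
      p.μ 1 * p.dist ρ 1 u 0 - (p.μ 1 * ξ * p.lapl ρ 1 u ξ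
        + p.μ 1 * Real.exp (-(ξ * p.B)) * p.dist ρ 1 u p.B) := fun u => by ring
    have e2 : ∀ u, k * (α * p.lapl ρ 0 u ξ + β * p.lapl ρ 1 u ξ)
      + (α * p.μ 0 * p.dist ρ 0 u 0 + (β * p.μ 1 * p.dist ρ 1 u 0
      - β * p.μ 1 * Real.exp (-(ξ * p.B)) * p.dist ρ 1 u p.B)) =
      (k * α * p.lapl ρ 0 u ξ + k * β * p.lapl ρ 1 u ξ)
      + (α * p.μ 0 * p.dist ρ 0 u 0 + (β * p.μ 1 * p.dist ρ 1 u 0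
      - β * p.μ 1 * Real.exp (-(ξ * p.B)) * p.dist ρ 1 u p.B)) := fun u => by ring
    simp only [e0, e1] at f0 f1
    simp only [e2]
    rw [intervalIntegral.integral_add ((iD 0 0 s).const_mul _) ((iL 0 s).const_mul _)] at f0
    rw [intervalIntegral.integral_sub ((iD 1 0 s).const_mul _)
        (((iL 1 s).const_mul _).add ((iD 1 p.B s).const_mul _)),
      intervalIntegral.integral_add ((iL 1 s).const_mul _) ((iD 1 p.B s).const_mul _)] at f1
    rw [intervalIntegral.integral_add (((iL 0 s).const_mul _).add ((iL 1 s).const_mul _))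
        (((iD 0 0 s).const_mul _).add (((iD 1 0 s).const_mul _).sub ((iD 1 p.B s).const_mul _))),
      intervalIntegral.integral_add ((iL 0 s).const_mul _) ((iL 1 s).const_mul _),
      intervalIntegral.integral_add ((iD 0 0 s).const_mul _)
        (((iD 1 0 s).const_mul _).sub ((iD 1 p.B s).const_mul _)),
      intervalIntegral.integral_sub ((iD 1 0 s).const_mul _) ((iD 1 p.B s).const_mul _)]
    simp only [intervalIntegral.integral_const_mul] at f0 f1 ⊢
    linear_combination α * f0 + β * f1 + (∫ u in (0 : ℝ)..s, p.lapl ρ 0 u ξ) * h0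
      + (∫ u in (0 : ℝ)..s, p.lapl ρ 1 u ξ) * h1

/-- The eigenvectors `(μ₁ξ + k + Λ₁, Λ₁)` for `k = m, n` share their second component, so the
difference of the two scalar solutions is `(m - n) L_0`. The normalization `(Λ₀, μ₀ξ + k + Λ₀)`
isolates `L_1` in the same way. -/
theorem lapl_eq_sol [IsProbabilityMeasure ρ] (hρ : ∀ᵐ z ∂ρ, z.1 ∈ Icc 0 p.B) (ξ : ℝ) {t : ℝ}
    (ht : 0 ≤ t) :
    p.lapl ρ 0 t ξ = p.solL₀ (fun u => p.dist ρ 0 u 0) (fun u => p.dist ρ 1 u 0)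
        (fun u => p.dist ρ 1 u p.B) (p.lapl ρ 0 0 ξ) (p.lapl ρ 1 0 ξ) t ξ ∧
      p.lapl ρ 1 t ξ = p.solL₁ (fun u => p.dist ρ 0 u 0) (fun u => p.dist ρ 1 u 0)
        (fun u => p.dist ρ 1 u p.B) (p.lapl ρ 0 0 ξ) (p.lapl ρ 1 0 ξ) t ξ := by
  have hG : ∀ k, p.IsRoot ξ k → _ := fun k hk =>
    eigen_combination hρ (k := k) (ξ := ξ) (α := p.μ 1 * ξ + k + p.Λ 1) (β := p.Λ 1)
    (by unfold IsRoot at hk; linear_combination -hk) (by ring) ht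
  have hH : ∀ k, p.IsRoot ξ k → _ := fun k hk =>
    eigen_combination hρ (k := k) (ξ := ξ) (α := p.Λ 0) (β := p.μ 0 * ξ + k + p.Λ 0)
    (by ring) (by unfold IsRoot at hk; linear_combination -hk) ht
  have gm := hG _ (p.isRoot_m ξ)
  have gn := hG _ (p.isRoot_n ξ)
  have hm := hH _ (p.isRoot_m ξ)
  have hn := hH _ (p.isRoot_n ξ)
  have hmn : -p.n ξ + p.m ξ ≠ 0 := by linarith [p.n_lt_m ξ]
  have hexp : ∀ k : ℝ, Real.exp (k * t) * Real.exp (-(k * t)) = 1 := fun k => by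
    rw [← Real.exp_add, add_neg_cancel, Real.exp_zero]
  have hem := hexp (p.m ξ)
  have hen := hexp (p.n ξ)
  unfold solL₀ solL₁
  dsimp only
  rw [Real.exp_add, Real.exp_add]
  generalize p.m ξ = m at *
  generalize p.n ξ = n at *
  generalize Real.exp (m * t) = em at *
  generalize Real.exp (n * t) = en at *
  constructor
  · field_simp
    linear_combination em * gm - en * gn - ((p.μ 1 * ξ + m + p.Λ 1) * p.lapl ρ 0 t ξ
      + p.Λ 1 * p.lapl ρ 1 t ξ) * hem + ((p.μ 1 * ξ + n + p.Λ 1) * p.lapl ρ 0 t ξ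
      + p.Λ 1 * p.lapl ρ 1 t ξ) * hen
  · field_simp
    linear_combination em * hm - en * hn - (p.Λ 0 * p.lapl ρ 0 t ξ
      + (p.μ 0 * ξ + m + p.Λ 0) * p.lapl ρ 1 t ξ) * hem + (p.Λ 0 * p.lapl ρ 0 t ξ
      + (p.μ 0 * ξ + n + p.Λ 0) * p.lapl ρ 1 t ξ) * hen

theorem hasLaplace_dist [IsProbabilityMeasure ρ] (s : Fin 2) (a : ℝ) {m : ℝ} (hm : 0 < m) :
    HasLaplace (fun t => p.dist ρ s t a) m (laplace (fun t => p.dist ρ s t a) m) :=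
  ⟨integrableOn_exp_mul_of_bounded (measurable_dist s a) (fun t => abs_dist_le s t a) hm, rfl⟩

theorem tendsto_exp_mul_bounded {Z : ℝ → ℝ} {C : ℝ} (hC : ∀ t, |Z t| ≤ C) {m : ℝ} (hm : 0 < m) :
    Filter.Tendsto (fun t => Real.exp (-(m * t)) * Z t) Filter.atTop (𝓝 0) := by
  have h : Filter.Tendsto (fun t => Real.exp (-(m * t))) Filter.atTop (𝓝 0) :=
    Real.tendsto_exp_neg_atTop_nhds_zero.comp (Filter.tendsto_id.const_mul_atTop hm)
  refine squeeze_zero_norm (a := fun t => Real.exp (-(m * t)) * C) (fun t => ?_)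
    (by simpa using h.mul_const C)
  rw [norm_mul, Real.norm_of_nonneg (Real.exp_pos _).le]
  gcongr
  exact hC t

/-- The Laplace transforms of the boundary functions solve the linear system. -/
theorem sys_dist [IsProbabilityMeasure ρ] (hρ : ∀ᵐ z ∂ρ, z.1 ∈ Icc 0 p.B) {m : ℝ} (hm : 0 < m) :
    p.Sys m (p.lapl ρ 0 0) (p.lapl ρ 1 0) (p.dist ρ 1 0 0)
      (laplace (fun t => p.dist ρ 1 t 0) m) (laplace (fun t => p.dist ρ 1 t p.B) m) := by
  have hlim := fun s a => tendsto_partialLaplace (hasLaplace_dist (p := p) (ρ := ρ) s a hm).1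
  -- The transform of the equation for `ψ`, used below to eliminate `φ`. It comes from variation of
  -- constants with `k = m`, after writing `ψ' = mψ + (Λ₀φ - (Λ₁ + m)ψ)`, as `t` tends to infinity.
  have hc : p.dist ρ 1 0 0 + p.Λ 0 * laplace (fun t => p.dist ρ 0 t 0) m
      - (p.Λ 1 + m) * laplace (fun t => p.dist ρ 1 t 0) m = 0 := by
    refine tendsto_nhds_unique (f := fun t => Real.exp (-(m * t)) * p.dist ρ 1 t 0)
      (l := Filter.atTop) ?_ (tendsto_exp_mul_bounded (fun t => abs_dist_le 1 t 0) hm)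
    refine (((hlim 0 0).const_mul (p.Λ 0)).const_add _ |>.sub
      ((hlim 1 0).const_mul (p.Λ 1 + m))).congr' ?_
    filter_upwards [Filter.eventually_ge_atTop 0] with t ht
    have iD := fun s b => intervalIntegrable_dist (p := p) (ρ := ρ) s 0 0 b
    rw [exp_mul_eq_of_integral_eq (Z := fun t => p.dist ρ 1 t 0)
      (β := fun t => p.Λ 0 * p.dist ρ 0 t 0 - (p.Λ 1 + m) * p.dist ρ 1 t 0) ht (iD 1 t)
      (((iD 0 t).const_mul _).sub ((iD 1 t).const_mul _))]
    · have iE := fun s => (iD s t).mul_continuousOn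
        (g := fun s => Real.exp (-(m * s))) (by fun_prop)
      unfold partialLaplace
      rw [← intervalIntegral.integral_const_mul, ← intervalIntegral.integral_const_mul, add_sub_assoc,
        ← intervalIntegral.integral_sub ((iE 0).const_mul _) ((iE 1).const_mul _)]
      congr 2
      funext s
      ring
    · intro s hs
      have h := dist_one_sub_add_integral hρ hs.1
      have e : ∀ u, m * p.dist ρ 1 u 0 + (p.Λ 0 * p.dist ρ 0 u 0 - (p.Λ 1 + m) * p.dist ρ 1 u 0) =
          -(p.Λ 1 * p.dist ρ 1 u 0 - p.Λ 0 * p.dist ρ 0 u 0) := fun u => by ring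
      simp only [e, intervalIntegral.integral_neg]
      linarith
  have key : ∀ V, p.IsUW m V → p.SysEq V m (p.lapl ρ 0 0) (p.lapl ρ 1 0) (p.dist ρ 1 0 0)
      (laplace (fun t => p.dist ρ 1 t 0) m) (laplace (fun t => p.dist ρ 1 t p.B) m) := by
    intro V hV
    have hroot := hV.isRoot
    rw [sysEq_iff]
    set ξ := -(V / (2 * p.μ 0 * p.μ 1)) with hξ
    have hexp : Real.exp (V * p.B / (2 * p.μ 0 * p.μ 1)) = Real.exp (-(ξ * p.B)) := by
      rw [hξ]; congr 1; ring
    have hVξ : V = -(2 * p.μ 0 * p.μ 1 * ξ) := by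
      have h0 := p.μ_zero_neg.ne
      have h1 := p.μ_one_pos.ne'
      rw [hξ]; field_simp
    set α := p.μ 1 * ξ + m + p.Λ 1 with hα
    -- At this `ξ` the number `m` is an eigenvalue. The eigencombination is bounded in time, so
    -- `e^{-mt}` times it tends to zero and the right side of `eigen_combination` vanishes in the
    -- limit.
    have hz : α * (p.lapl ρ 0 0 ξ + p.μ 0 * laplace (fun u => p.dist ρ 0 u 0) m)
      + p.Λ 1 * (p.lapl ρ 1 0 ξ + p.μ 1 * laplace (fun u => p.dist ρ 1 u 0) m
        - p.μ 1 * Real.exp (-(ξ * p.B)) * laplace (fun u => p.dist ρ 1 u p.B) m) = 0 := by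
      refine tendsto_nhds_unique (f := fun t => Real.exp (-(m * t)) *
        (α * p.lapl ρ 0 t ξ + p.Λ 1 * p.lapl ρ 1 t ξ)) (l := Filter.atTop) ?_
        (tendsto_exp_mul_bounded (C := |α| * expPrim ξ p.B + |p.Λ 1| * expPrim ξ p.B)
          (fun t => ?_) hm)
      · refine Filter.Tendsto.congr' ?_
          ((((hlim 0 0).const_mul (p.μ 0)).const_add (p.lapl ρ 0 0 ξ) |>.const_mul α).add
          ((((hlim 1 0).const_mul (p.μ 1)).const_add (p.lapl ρ 1 0 ξ) |>.sub
            ((hlim 1 p.B).const_mul (p.μ 1 * Real.exp (-(ξ * p.B))))).const_mul (p.Λ 1)))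
        filter_upwards [Filter.eventually_ge_atTop 0] with t ht
        rw [eigen_combination hρ (k := m) _ _ ht]
        · unfold IsRoot at hroot; linear_combination -hroot
        · ring
      · refine (abs_add_le _ _).trans ?_
        rw [abs_mul, abs_mul]
        gcongr
        exacts [abs_lapl_le 0 t ξ, abs_lapl_le 1 t ξ]
    rw [hexp]
    unfold coef
    rw [hα] at hz
    have h0 := p.μ_zero_neg.ne
    have hdiv : p.Λ 0 / p.μ 0 * (-2 * m * p.μ 0 - 2 * p.Λ 1 * p.μ 0 + V) * p.lapl ρ 0 0 ξ =
        -(2 * p.Λ 0 * (m + p.Λ 1 + p.μ 1 * ξ)) * p.lapl ρ 0 0 ξ := by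
      rw [hVξ]; field_simp; ring
    rw [hdiv, hVξ]
    -- The multiplier of `hc` is chosen to cancel the transform of `φ` in `hz`.
    linear_combination (-2 * p.Λ 0) * hz + (2 * p.μ 0 * (m + p.Λ 1 + p.μ 1 * ξ)) * hc
  exact ⟨key _ (p.isUW_U hm), key _ (p.isUW_W hm)⟩

end Params

/-! ### Transfer to the process -/

theorem HasLaplace.congr {f g : ℝ → ℝ} {m v : ℝ} (h : HasLaplace f m v)
    (hfg : ∀ t, 0 ≤ t → g t = f t) : HasLaplace g m v := by
  have he : EqOn (fun t => Real.exp (-(m * t)) * g t) (fun t => Real.exp (-(m * t)) * f t)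
      (Ioi 0) := fun t ht => by simp only [hfg t (le_of_lt ht)]
  refine ⟨h.1.congr_fun he.symm measurableSet_Ioi, ?_⟩
  rw [← h.2]
  exact setIntegral_congr_fun measurableSet_Ioi he

theorem partialLaplace_congr {f g : ℝ → ℝ} (hfg : ∀ t, 0 ≤ t → g t = f t) (k : ℝ) {t : ℝ}
    (ht : 0 ≤ t) : Params.partialLaplace g k t = Params.partialLaplace f k t := by
  refine intervalIntegral.integral_congr fun s hs => ?_
  rw [uIcc_of_le ht] at hs
  simp only [hfg s hs.1]

/-- The derivative of a function given by an integral on `[0, ∞)`. -/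
theorem hasDerivAt_of_integral_eq {f g : ℝ → ℝ} (h : ∀ t, 0 ≤ t → f t = f 0 + ∫ u in (0 : ℝ)..t, g u)
    {t g' : ℝ} (ht : 0 < t) (hd : HasDerivAt (fun t => ∫ u in (0 : ℝ)..t, g u) g' t) :
    HasDerivAt f g' t := by
  refine (hd.const_add (f 0)).congr_of_eventuallyEq ?_
  filter_upwards [lt_mem_nhds ht] with s hs
  exact h s hs.le

/-- Lebesgue differentiation applies on each `[0, n]`, and countably many of these intervals exhaust
the half-line. -/
theorem ae_hasDerivAt_of_integral_eq {f g : ℝ → ℝ}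
    (h : ∀ t, 0 ≤ t → f t = f 0 + ∫ u in (0 : ℝ)..t, g u)
    (hg : ∀ t, 0 ≤ t → IntervalIntegrable g volume 0 t) :
    ∀ᵐ t : ℝ, 0 < t → HasDerivAt f (g t) t := by
  have h1 : ∀ n : ℕ, ∀ᵐ t : ℝ, t ∈ uIcc (0 : ℝ) n → ∀ c ∈ uIcc (0 : ℝ) n,
      HasDerivAt (fun t => ∫ u in c..t, g u) (g t) t := fun n =>
    (hg n (Nat.cast_nonneg n)).ae_hasDerivAt_integral
  filter_upwards [ae_all_iff.2 h1] with t ht ht0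
  obtain ⟨n, hn⟩ := exists_nat_ge t
  refine hasDerivAt_of_integral_eq h ht0 (ht n ?_ 0 (by simp))
  rw [uIcc_of_le (Nat.cast_nonneg n)]
  exact ⟨ht0.le, hn⟩

namespace Driver

variable {p : Params} {Ω : Type*} [MeasurableSpace Ω] {P : Measure Ω} (X : Driver p P)

theorem init_mem : ∀ᵐ z ∂X.init, z.1 ∈ Icc 0 p.B := by
  rw [init, ae_map_iff X.measurable_init.aemeasurable (measurable_fst measurableSet_Icc)]
  exact .of_forall X.x₀_mem

variable [IsProbabilityMeasure P]

instance : IsProbabilityMeasure X.init := Measure.isProbabilityMeasure_map X.measurable_init.aemeasurable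

/-- Survival quantifies over uncountably many times, so measurability of the event is not immediate.
Its indicator agrees almost surely with a measurable sum of path functions, which makes the event
null measurable. For `t < 0` the sides differ in general: `Alive` is then vacuous, while `dist`
vanishes. -/
theorem F_eq_dist (s : Fin 2) {t : ℝ} (ht : 0 ≤ t) (a : ℝ) : X.F s t a = p.dist X.init s t a := by
  classical
  have hf := Params.measurable_upTo s a
  have hY : Measurable fun ω (j : ℕ) => X.clock j ω :=
    measurable_pi_lambda _ fun j => X.measurable_clock _
  set S := {ω | X.Alive t ω ∧ a ≤ X.pos t ω ∧ X.regime t ω = s} with hS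
  have hind : ∀ ω, S.indicator (fun _ => (1 : ℝ≥0∞)) ω =
      if X.Alive t ω then upTo s a (X.regime t ω) (X.pos t ω) else 0 := fun ω => by
    simp only [indicator, hS, upTo, onRegime]
    by_cases h1 : X.Alive t ω <;> by_cases h2 : a ≤ X.pos t ω <;> by_cases h3 : X.regime t ω = s <;>
      simp [h1, h2, h3]
  have hmeas : AEMeasurable (S.indicator fun _ => (1 : ℝ≥0∞)) P := by
    refine ⟨_, (measurable_tsum_pathN (p := p) hf t).comp (X.measurable_init.prodMk hY), ?_⟩
    filter_upwards [X.ae_clock_pos, X.ae_switchTime_unbounded] with ω h1 h2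
    rw [hind]
    exact (tsum_pathN h1 h2 _ ht).symm
  have hnull : NullMeasurableSet S P := (aemeasurable_indicator_const_iff 1).1 hmeas
  rw [F, Params.dist, Params.mean, ← X.lintegral_alive hf ht, Measure.real,
    ← lintegral_indicator_one₀ hnull]
  congr 1
  exact lintegral_congr hind

theorem L_eq_lapl (s : Fin 2) {t : ℝ} (ht : 0 ≤ t) (ξ : ℝ) : X.L s t ξ = p.lapl X.init s t ξ := by
  rw [L, Params.lapl_eq_integral]
  simp only [X.F_eq_dist s ht]

theorem φ_eq {t : ℝ} (ht : 0 ≤ t) : X.φ t = p.dist X.init 0 t 0 := X.F_eq_dist 0 ht 0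

theorem ψ_eq {t : ℝ} (ht : 0 ≤ t) : X.ψ t = p.dist X.init 1 t 0 := X.F_eq_dist 1 ht 0

theorem ω_eq {t : ℝ} (ht : 0 ≤ t) : X.ω t = p.dist X.init 1 t p.B := X.F_eq_dist 1 ht p.B

theorem intervalIntegrable_F (s : Fin 2) (a : ℝ) {t : ℝ} (ht : 0 ≤ t) :
    IntervalIntegrable (fun u => X.F s u a) volume 0 t := by
  refine (Params.intervalIntegrable_dist (p := p) (ρ := X.init) s a 0 t).congr ?_
  intro u hu
  rw [uIoc_of_le ht] at hu
  exact (X.F_eq_dist s hu.1.le a).symm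

theorem sys {m : ℝ} (hm : 0 < m) : ∃ Ψ Θ : ℝ,
    HasLaplace X.ψ m Ψ ∧ HasLaplace X.ω m Θ ∧ p.Sys m (X.L 0 0) (X.L 1 0) (X.ψ 0) Ψ Θ := by
  refine ⟨_, _, (Params.hasLaplace_dist 1 0 hm).congr fun t => X.ψ_eq,
    (Params.hasLaplace_dist 1 p.B hm).congr fun t => X.ω_eq, ?_⟩
  rw [X.ψ_eq le_rfl, funext (X.L_eq_lapl 0 le_rfl), funext (X.L_eq_lapl 1 le_rfl)]
  exact Params.sys_dist X.init_mem hm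

theorem integrated_equation {t : ℝ} (ht : 0 ≤ t) :
    X.ψ t - X.ψ 0 + ∫ τ in (0 : ℝ)..t, (p.Λ 1 * X.ψ τ - p.Λ 0 * X.φ τ) = 0 := by
  rw [X.ψ_eq ht, X.ψ_eq le_rfl]
  refine Eq.trans ?_ (Params.dist_one_sub_add_integral X.init_mem ht)
  congr 1
  refine intervalIntegral.integral_congr fun u hu => ?_
  rw [uIcc_of_le ht] at hu
  simp only [X.ψ_eq hu.1, X.φ_eq hu.1]

theorem ψ_eq_integral {t : ℝ} (ht : 0 ≤ t) :
    X.ψ t = X.ψ 0 + ∫ τ in (0 : ℝ)..t, -(p.Λ 1 * X.ψ τ - p.Λ 0 * X.φ τ) := by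
  rw [intervalIntegral.integral_neg]
  linarith [X.integrated_equation ht]

theorem intervalIntegrable_rhs {t : ℝ} (ht : 0 ≤ t) :
    IntervalIntegrable (fun τ => -(p.Λ 1 * X.ψ τ - p.Λ 0 * X.φ τ)) volume 0 t :=
  (((X.intervalIntegrable_F 1 0 ht).const_mul _).sub
    ((X.intervalIntegrable_F 0 0 ht).const_mul _)).neg

theorem ae_deriv_ψ : ∀ᵐ t : ℝ, 0 < t → DifferentiableAt ℝ X.ψ t ∧
    deriv X.ψ t + p.Λ 1 * X.ψ t - p.Λ 0 * X.φ t = 0 := by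
  filter_upwards [ae_hasDerivAt_of_integral_eq (fun t => X.ψ_eq_integral)
    (fun t => X.intervalIntegrable_rhs)] with t ht ht0
  refine ⟨(ht ht0).differentiableAt, ?_⟩
  rw [(ht ht0).deriv]
  ring

theorem deriv_ψ {t : ℝ} (ht : 0 < t) (hφ : ContinuousAt X.φ t) : DifferentiableAt ℝ X.ψ t ∧
    deriv X.ψ t + p.Λ 1 * X.ψ t - p.Λ 0 * X.φ t = 0 := by
  -- As an indefinite integral `ψ` is continuous at every `t > 0`, so the integrand is continuous
  -- wherever `φ` is.
  have hψ : ContinuousAt X.ψ t := by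
    have h1 : 0 ≤ t + 1 := by linarith
    have hc := intervalIntegral.continuousOn_primitive_interval'
      (X.intervalIntegrable_rhs h1) left_mem_uIcc
    rw [uIcc_of_le h1] at hc
    have hc' := (hc.continuousAt (Icc_mem_nhds ht (lt_add_one t))).const_add (X.ψ 0)
    refine hc'.congr ?_
    filter_upwards [lt_mem_nhds ht] with s hs
    exact (X.ψ_eq_integral hs.le).symm
  have hd : HasDerivAt X.ψ (-(p.Λ 1 * X.ψ t - p.Λ 0 * X.φ t)) t := by
    refine hasDerivAt_of_integral_eq (fun t => X.ψ_eq_integral) ht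
      (intervalIntegral.integral_hasDerivAt_right (X.intervalIntegrable_rhs ht.le) ?_ (by fun_prop))
    have h1 : 0 ≤ t + 1 := by linarith
    refine ⟨Ioc 0 (t + 1), ?_, ?_⟩
    · exact Ioc_mem_nhds ht (lt_add_one t)
    · exact (X.intervalIntegrable_rhs h1).1.aestronglyMeasurable
  refine ⟨hd.differentiableAt, ?_⟩
  rw [hd.deriv]
  ring

theorem L_eq_sol {t : ℝ} (ht : 0 ≤ t) (ξ : ℝ) :
    X.L 0 t ξ = p.solL₀ X.φ X.ψ X.ω (X.L 0 0 ξ) (X.L 1 0 ξ) t ξ ∧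
      X.L 1 t ξ = p.solL₁ X.φ X.ψ X.ω (X.L 0 0 ξ) (X.L 1 0 ξ) t ξ := by
  have h := Params.lapl_eq_sol (p := p) X.init_mem ξ ht
  have hφ := fun k => partialLaplace_congr (fun t => X.φ_eq (t := t)) k ht
  have hψ := fun k => partialLaplace_congr (fun t => X.ψ_eq (t := t)) k ht
  have hω := fun k => partialLaplace_congr (fun t => X.ω_eq (t := t)) k ht
  simp only [Params.solL₀, Params.solL₁, hφ, hψ, hω, X.L_eq_lapl _ ht, X.L_eq_lapl _ le_rfl] at h ⊢
  exact h

end Driver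

/-! ### Derivatives with respect to the starting point -/

theorem lintegral_comp_affine {h : ℝ → ℝ≥0∞} (hh : Measurable h) (a : ℝ) {v : ℝ} (hv : v ≠ 0) :
    ∫⁻ τ, h (a + v * τ) = ENNReal.ofReal |v⁻¹| * ∫⁻ c, h c := by
  have h1 : Measurable fun c => h (a + c) := by fun_prop
  rw [← lintegral_map (f := fun c => h (a + c)) (g := fun τ => v * τ) h1 (by fun_prop),
    Real.map_volume_mul_left hv, lintegral_smul_measure, lintegral_add_left_eq_self, smul_eq_mul]

namespace Params

variable (p : Params)

/-- The indicator of the event that the point, starting at `x`, is inside the domain after the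
time `τ` spent in regime `i`, without reflection at `B`. -/
def absorb (i : Fin 2) (x τ : ℝ) : ℝ≥0∞ := if x + p.μ i * τ ∈ Ioc 0 p.B then 1 else 0

/-- The expectation of `g` at the first switch, for a point that is also killed at `B`. -/
def kill (g : Fin 2 → ℝ → ℝ → ℝ≥0∞) (i : Fin 2) (x t : ℝ) : ℝ≥0∞ :=
  ∫⁻ τ, p.dens i τ * (p.absorb i x τ * g (1 - i) (x + p.μ i * τ) (t - τ))

/-- The contribution of the boundary `0` to the derivative with respect to the starting point. -/
def src (G : ℝ → ℝ≥0∞) (i : Fin 2) (x t : ℝ) : ℝ≥0∞ :=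
  if i = 0 then ENNReal.ofReal (-p.μ 0)⁻¹ * (p.dens 0 (x / -p.μ 0) * G (t - x / -p.μ 0)) else 0

/-- `g` is the derivative of `G` with respect to the starting point, and a point that starts
at `0` in regime 0 is stopped. -/
structure IsPrim (G g : Fin 2 → ℝ → ℝ → ℝ≥0∞) : Prop where
  zero : ∀ t, G 0 0 t = 0
  eq_add : ∀ i, ∀ a ∈ Icc 0 p.B, ∀ t, G i a t = G i 0 t + ∫⁻ b in Ioc 0 a, g i b t

variable {p}

theorem measurable_absorb (i : Fin 2) : Measurable fun z : ℝ × ℝ => p.absorb i z.1 z.2 := by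
  unfold absorb
  refine Measurable.ite ?_ measurable_const measurable_const
  exact measurableSet_Ioc.preimage (f := fun z : ℝ × ℝ => z.1 + p.μ i * z.2) (by fun_prop)

theorem measurable_kill_integrand {g : Fin 2 → ℝ → ℝ → ℝ≥0∞}
    (hg : ∀ j, Measurable fun z : ℝ × ℝ => g j z.1 z.2) (i : Fin 2) :
    Measurable fun w : (ℝ × ℝ) × ℝ =>
      p.dens i w.2 * (p.absorb i w.1.1 w.2 *
        g (1 - i) (w.1.1 + p.μ i * w.2) (w.1.2 - w.2)) := by
  refine ((measurable_dens i).comp measurable_snd).mul (.mul ?_ ?_)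
  · exact (measurable_absorb i).comp (f := fun w : (ℝ × ℝ) × ℝ => (w.1.1, w.2)) (by fun_prop)
  · exact (hg (1 - i)).comp (f := fun w : (ℝ × ℝ) × ℝ =>
      (w.1.1 + p.μ i * w.2, w.1.2 - w.2)) (by fun_prop)

theorem measurable_kill {g : Fin 2 → ℝ → ℝ → ℝ≥0∞}
    (hg : ∀ j, Measurable fun z : ℝ × ℝ => g j z.1 z.2) (i : Fin 2) :
    Measurable fun z : ℝ × ℝ => p.kill g i z.1 z.2 :=
  Measurable.lintegral_prod_right' (measurable_kill_integrand hg i)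

theorem measurable_kill_integrand' {g : Fin 2 → ℝ → ℝ → ℝ≥0∞}
    (hg : ∀ j, Measurable fun z : ℝ × ℝ => g j z.1 z.2) (i : Fin 2) (x t : ℝ) :
    Measurable fun τ => p.dens i τ * (p.absorb i x τ * g (1 - i) (x + p.μ i * τ) (t - τ)) :=
  (measurable_kill_integrand hg i).comp (measurable_prodMk_left (x := (x, t)))

theorem measurable_src {G : ℝ → ℝ≥0∞} (hG : Measurable G) (i : Fin 2) :
    Measurable fun z : ℝ × ℝ => p.src G i z.1 z.2 := by
  have := measurable_dens (p := p) 0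
  unfold src
  by_cases h : i = 0
  · simp only [h, if_true]; fun_prop
  · simp only [h, if_false]; exact measurable_const

theorem kill_tsum {g : ℕ → Fin 2 → ℝ → ℝ → ℝ≥0∞}
    (hg : ∀ n j, Measurable fun z : ℝ × ℝ => g n j z.1 z.2) (i : Fin 2) (x t : ℝ) :
    p.kill (fun j y s => ∑' n, g n j y s) i x t = ∑' n, p.kill (g n) i x t := by
  unfold kill
  rw [← lintegral_tsum fun n => (measurable_kill_integrand' (hg n) i x t).aemeasurable]
  simp only [ENNReal.tsum_mul_left]

theorem src_tsum (G : ℕ → ℝ → ℝ≥0∞) (i : Fin 2) (x t : ℝ) :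
    p.src (fun s => ∑' n, G n s) i x t = ∑' n, p.src (G n) i x t := by
  unfold src
  split_ifs
  · simp only [ENNReal.tsum_mul_left]
  · simp

theorem kill_past {g : Fin 2 → ℝ → ℝ → ℝ≥0∞}
    (hg : ∀ j, Measurable fun z : ℝ × ℝ => g j z.1 z.2) (i : Fin 2) (x t : ℝ) :
    p.kill (fun j y => past (g j y)) i x t = past (p.kill g i x) t := by
  unfold past kill
  rw [lintegral_lintegral_swap (μ := volume.restrict (Iic t)) (f := fun s τ =>
    p.dens i τ * (p.absorb i x τ * g (1 - i) (x + p.μ i * τ) (s - τ)))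
    ((measurable_kill_integrand hg i).comp
      (f := fun w : ℝ × ℝ => ((x, w.1), w.2)) (by fun_prop)).aemeasurable]
  refine lintegral_congr fun τ => ?_
  have hm : Measurable fun s => g (1 - i) (x + p.μ i * τ) s :=
    (hg (1 - i)).comp measurable_prodMk_left
  rw [lintegral_const_mul _ (by fun_prop), lintegral_const_mul _ (by fun_prop)]
  congr 2
  beta_reduce
  rw [← lintegral_indicator measurableSet_Iic, ← lintegral_indicator measurableSet_Iic,
    ← lintegral_sub_right_eq_self _ τ]
  refine lintegral_congr fun s => ?_
  simp [indicator]

theorem past_comp_sub (G : ℝ → ℝ≥0∞) (c t : ℝ) :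
    past (fun s => G (s - c)) t = past G (t - c) := by
  unfold past
  rw [← lintegral_indicator measurableSet_Iic, ← lintegral_indicator measurableSet_Iic,
    ← lintegral_sub_right_eq_self ((Iic (t - c)).indicator G) c]
  refine lintegral_congr fun s => ?_
  simp [indicator]

theorem src_past {G : ℝ → ℝ≥0∞} (hG : Measurable G) (i : Fin 2) (x t : ℝ) :
    p.src (past G) i x t = past (p.src G i x) t := by
  unfold src
  split_ifs
  · rw [← past_comp_sub, past, past, ← lintegral_const_mul _ (by fun_prop),
      ← lintegral_const_mul _ (by fun_prop)]
  · simp [past]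

/-- Translation along the flow without reflection. -/
theorem setLIntegral_absorb (i : Fin 2) (a τ : ℝ) (h : ℝ → ℝ≥0∞) :
    ∫⁻ b in Ioc 0 a, p.absorb i b τ * h (b + p.μ i * τ) =
      ∫⁻ c in Ioc (p.μ i * τ) (a + p.μ i * τ) ∩ Ioc 0 p.B, h c := by
  rw [← lintegral_indicator measurableSet_Ioc,
    ← lintegral_indicator (measurableSet_Ioc.inter measurableSet_Ioc)]
  conv_rhs => rw [← lintegral_add_right_eq_self _ (p.μ i * τ)]
  refine lintegral_congr fun b => ?_
  simp only [indicator, mem_inter_iff, mem_Ioc, absorb, lt_add_iff_pos_left, add_le_add_iff_right]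
  split_ifs <;> simp_all

/-- A point at `0` in regime 0 leaves at once, before any switch. -/
theorem jump_zero_zero (G : Fin 2 → ℝ → ℝ → ℝ≥0∞) (t : ℝ) : p.jump G 0 0 t = 0 := by
  have hμ := p.μ_zero_neg
  rw [Params.jump, ← lintegral_zero (μ := (volume : Measure ℝ))]
  refine lintegral_congr_ae ?_
  filter_upwards [Measure.ae_ne volume (0 : ℝ)] with τ hτ
  rcases lt_or_gt_of_ne hτ with h | h
  · rw [dens_of_neg h, zero_mul]
  · have : ¬ 0 ≤ 0 + p.μ 0 * τ := by nlinarith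
    rw [gate, if_neg this, zero_mul, mul_zero]

theorem setLIntegral_kill {g : Fin 2 → ℝ → ℝ → ℝ≥0∞}
    (hg : ∀ j, Measurable fun z : ℝ × ℝ => g j z.1 z.2) (i : Fin 2) (a t : ℝ) :
    ∫⁻ b in Ioc 0 a, p.kill g i b t = ∫⁻ τ, p.dens i τ *
      ∫⁻ c in Ioc (p.μ i * τ) (a + p.μ i * τ) ∩ Ioc 0 p.B, g (1 - i) c (t - τ) := by
  unfold kill
  rw [lintegral_lintegral_swap (μ := volume.restrict (Ioc 0 a))
    (f := fun b τ => p.dens i τ * (p.absorb i b τ * g (1 - i) (b + p.μ i * τ) (t - τ)))]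
  · refine lintegral_congr fun τ => ?_
    rw [lintegral_const_mul, setLIntegral_absorb i a τ fun c => g (1 - i) c (t - τ)]
    refine .mul ((measurable_absorb i).comp measurable_prodMk_right) ?_
    exact (hg (1 - i)).comp (f := fun b => (b + p.μ i * τ, t - τ)) (by fun_prop)
  · exact ((measurable_kill_integrand hg i).comp
      (f := fun w : ℝ × ℝ => ((w.1, t), w.2)) (by fun_prop)).aemeasurable

theorem measurable_gate_mul {H : ℝ → ℝ≥0∞} (hH : Measurable H) (i : Fin 2) (a : ℝ) :
    Measurable fun τ => p.dens i τ * (p.gate i a τ * H τ) :=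
  (measurable_dens i).mul (((measurable_gate i).comp measurable_prodMk_left).mul hH)

/-- Substitute `b = -μ₀τ`, the starting point from which `0` is reached at time `τ`. The condition
`b ≤ a` becomes that of a switch before the exit from `a`. -/
theorem setLIntegral_src {H : ℝ → ℝ≥0∞} (hH : Measurable H) (a t : ℝ) :
    ∫⁻ b in Ioc 0 a, p.src H 0 b t = ∫⁻ τ, p.dens 0 τ * (p.gate 0 a τ * H (t - τ)) := by
  have hμ := p.μ_zero_neg
  have hd := measurable_dens (p := p) 0
  have hm : Measurable fun τ => p.dens 0 (τ / -p.μ 0) * H (t - τ / -p.μ 0) := by fun_prop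
  have key := lintegral_comp_affine
    (h := (Ioc 0 a).indicator fun τ => p.dens 0 (τ / -p.μ 0) * H (t - τ / -p.μ 0))
    (hm.indicator measurableSet_Ioc) 0 (v := -p.μ 0) (by linarith)
  rw [abs_of_pos (by simpa using hμ), lintegral_indicator measurableSet_Ioc,
    ← lintegral_const_mul _ hm] at key
  simp only [src, if_true]
  rw [← key]
  refine lintegral_congr_ae ?_
  filter_upwards [Measure.ae_ne volume (0 : ℝ)] with τ hτ
  rcases lt_or_gt_of_ne hτ with h | h
  · have : ¬ 0 < -p.μ 0 * τ := by nlinarith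
    simp only [dens_of_neg h, indicator, zero_add, mem_Ioc, this, false_and, if_false, zero_mul]
  · have h1 : 0 < -p.μ 0 * τ := by nlinarith
    have h2 : -p.μ 0 * τ / -p.μ 0 = τ := mul_div_cancel_left₀ _ (neg_ne_zero.2 hμ.ne)
    have h3 : 0 ≤ a + p.μ 0 * τ ↔ -p.μ 0 * τ ≤ a := by constructor <;> intro h <;> linarith
    simp only [zero_add, indicator, mem_Ioc, h1, h2, true_and, gate, h3]
    split_ifs <;> simp

/-- Insert `G_1(a + μ₀τ) = G_1(0) + ∫_0^{a + μ₀τ} g_1`. The constant part depends on `a` only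
through the exit time and gives `src`; the integral, translated back along the flow, gives `kill`.
-/
theorem IsPrim.jump_zero {G g : Fin 2 → ℝ → ℝ → ℝ≥0∞} (h : p.IsPrim G g)
    (hG : ∀ j, Measurable fun z : ℝ × ℝ => G j z.1 z.2)
    (hg : ∀ j, Measurable fun z : ℝ × ℝ => g j z.1 z.2) {a : ℝ} (ha : a ∈ Icc 0 p.B) (t : ℝ) :
    p.jump G 0 a t = ∫⁻ b in Ioc 0 a, (p.src (G 1 0) 0 b t + p.kill g 0 b t) := by
  have hμ := p.μ_zero_neg
  have hG10 : Measurable (G 1 0) := (hG 1).comp measurable_prodMk_left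
  have hms : Measurable fun b => p.src (G 1 0) 0 b t :=
    (measurable_src hG10 0).comp measurable_prodMk_right
  have hs : Measurable fun τ => G 1 0 (t - τ) := by fun_prop
  rw [lintegral_add_left hms, setLIntegral_kill hg, setLIntegral_src hG10,
    ← lintegral_add_left (measurable_gate_mul hs 0 a), Params.jump]
  refine lintegral_congr_ae ?_
  filter_upwards [Measure.ae_ne volume (0 : ℝ)] with τ hτ
  rcases lt_or_gt_of_ne hτ with hτ | hτ
  · rw [dens_of_neg hτ, zero_mul, zero_mul, zero_mul, zero_add]
  rw [← mul_add, flow_zero ha.2 hτ.le, gate]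
  congr 1
  have h0 : p.μ 0 * τ < 0 := by nlinarith
  split_ifs with hx
  · rw [one_mul, one_mul, sub_zero, h.eq_add 1 _ ⟨hx, by linarith [ha.2]⟩]
    congr 3
    ext c
    simp only [mem_inter_iff, mem_Ioc]
    constructor
    · intro hc; exact ⟨⟨by linarith, hc.2⟩, hc.1, by linarith [ha.2]⟩
    · intro hc; exact ⟨hc.2.1, hc.1.2⟩
  · have : Ioc (p.μ 0 * τ) (a + p.μ 0 * τ) ∩ Ioc 0 p.B = ∅ := by
      ext c
      simp only [mem_inter_iff, mem_Ioc, mem_empty_iff_false, iff_false]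
      intro hc; exact hx (by linarith)
    rw [this, Measure.restrict_empty, lintegral_zero_measure, zero_mul, zero_mul, zero_add]

/-- The reflected position no longer depends on `a` once `B` has been reached, so only switches
before that time contribute to the derivative. This is why the derivative evolves by `kill` although
the process itself is reflected. -/
theorem IsPrim.jump_one {G g : Fin 2 → ℝ → ℝ → ℝ≥0∞} (h : p.IsPrim G g)
    (hG : ∀ j, Measurable fun z : ℝ × ℝ => G j z.1 z.2)
    (hg : ∀ j, Measurable fun z : ℝ × ℝ => g j z.1 z.2) {a : ℝ} (ha : a ∈ Icc 0 p.B) (t : ℝ) :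
    p.jump G 1 a t = p.jump G 1 0 t + ∫⁻ b in Ioc 0 a, p.kill g 1 b t := by
  have hμ := p.μ_one_pos
  rw [setLIntegral_kill hg, Params.jump, Params.jump,
    ← lintegral_add_left (measurable_jump_integrand' hG 1 0 t)]
  refine lintegral_congr fun τ => ?_
  rcases lt_or_ge τ 0 with hτ | hτ
  · rw [dens_of_neg hτ, zero_mul, zero_mul, zero_mul, zero_add]
  have h0 : 0 ≤ p.μ 1 * τ := by positivity
  have e : (1 : Fin 2) - 1 = 0 := rfl
  have hf0 : p.flow 1 0 τ ∈ Icc 0 p.B := flow_mem (by simpa using h0)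
  have hfa : p.flow 1 a τ ∈ Icc 0 p.B := flow_mem (by linarith [ha.1])
  have hle : p.flow 1 0 τ ≤ p.flow 1 a τ := min_le_min_left _ (by linarith [ha.1])
  rw [← mul_add, gate_one ha.1 hτ, gate_one le_rfl hτ, one_mul, one_mul, e, h.eq_add 0 _ hfa,
    h.eq_add 0 _ hf0, setLIntegral_Ioc_add hf0.1 hle, add_assoc]
  congr 5
  ext c
  simp only [flow, mem_inter_iff, mem_Ioc, zero_add, min_lt_iff, le_min_iff]
  constructor
  · rintro ⟨h1, h2, h3⟩
    have : p.μ 1 * τ < c := by rcases h1 with h1 | h1 <;> linarith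
    exact ⟨⟨this, h3⟩, by linarith, h2⟩
  · rintro ⟨⟨h1, h2⟩, h3, h4⟩
    exact ⟨Or.inr h1, h4, h2⟩

/-- The derivative, with respect to the starting point, of the expectation at the first switch. -/
theorem IsPrim.jump {G g : Fin 2 → ℝ → ℝ → ℝ≥0∞} (h : p.IsPrim G g)
    (hG : ∀ j, Measurable fun z : ℝ × ℝ => G j z.1 z.2)
    (hg : ∀ j, Measurable fun z : ℝ × ℝ => g j z.1 z.2) :
    p.IsPrim (p.jump G) fun i a t => p.src (G 1 0) i a t + p.kill g i a t := by
  refine ⟨jump_zero_zero G, fun i a ha t => ?_⟩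
  by_cases hi : i = 0
  · subst hi
    rw [jump_zero_zero, zero_add, h.jump_zero hG hg ha]
  · have hi : i = 1 := by omega
    subst hi
    simp only [src, one_ne_zero, if_false, zero_add]
    exact h.jump_one hG hg ha t

theorem IsPrim.tsum {G g : ℕ → Fin 2 → ℝ → ℝ → ℝ≥0∞} (h : ∀ n, p.IsPrim (G n) (g n))
    (hg : ∀ n j, Measurable fun z : ℝ × ℝ => g n j z.1 z.2) :
    p.IsPrim (fun i a t => ∑' n, G n i a t) fun i a t => ∑' n, g n i a t := by
  refine ⟨fun t => by simp [fun n => (h n).zero t], fun i a ha t => ?_⟩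
  have hm : ∀ n, Measurable fun b => g n i b t := fun n =>
    (hg n i).comp measurable_prodMk_right
  rw [lintegral_tsum fun n => (hm n).aemeasurable, ← ENNReal.tsum_add]
  exact tsum_congr fun n => (h n).eq_add i a ha t

/-- The derivatives, with respect to the starting point, by the number of switches: `g₀` without
any switch, and `G n` are the values with `n` switches, for the start at `0` in regime 1. -/
def diffN (p : Params) (G : ℕ → ℝ → ℝ≥0∞) (g₀ : Fin 2 → ℝ → ℝ → ℝ≥0∞) :
    ℕ → Fin 2 → ℝ → ℝ → ℝ≥0∞
  | 0 => g₀
  | n + 1 => fun i a t => p.src (G n) i a t + p.kill (diffN p G g₀ n) i a t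

/-- The sum of `diffN` over the number of switches. -/
def diff (p : Params) (G : ℕ → ℝ → ℝ≥0∞) (g₀ : Fin 2 → ℝ → ℝ → ℝ≥0∞) (i : Fin 2) (a t : ℝ) :
    ℝ≥0∞ := ∑' n, p.diffN G g₀ n i a t

section Diff

variable {G : ℕ → ℝ → ℝ≥0∞} {g₀ : Fin 2 → ℝ → ℝ → ℝ≥0∞}

theorem measurable_diffN (hG : ∀ n, Measurable (G n))
    (hg : ∀ j, Measurable fun z : ℝ × ℝ => g₀ j z.1 z.2) (n : ℕ) (i : Fin 2) :
    Measurable fun z : ℝ × ℝ => p.diffN G g₀ n i z.1 z.2 := by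
  induction n generalizing i with
  | zero => exact hg i
  | succ n ih => exact (measurable_src (hG n) i).add (measurable_kill ih i)

theorem measurable_diff (hG : ∀ n, Measurable (G n))
    (hg : ∀ j, Measurable fun z : ℝ × ℝ => g₀ j z.1 z.2) (i : Fin 2) :
    Measurable fun z : ℝ × ℝ => p.diff G g₀ i z.1 z.2 :=
  Measurable.tsum fun n => measurable_diffN hG hg n i

/-- The equation of the first switch for the derivative. -/
theorem diff_eq (hG : ∀ n, Measurable (G n))
    (hg : ∀ j, Measurable fun z : ℝ × ℝ => g₀ j z.1 z.2) (i : Fin 2) (a t : ℝ) :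
    p.diff G g₀ i a t =
      g₀ i a t + (p.src (fun s => ∑' n, G n s) i a t + p.kill (p.diff G g₀) i a t) := by
  rw [diff, tsum_eq_zero_add' ENNReal.summable, src_tsum]
  change _ = _ + (_ + p.kill (fun j y s => ∑' n, p.diffN G g₀ n j y s) i a t)
  rw [kill_tsum fun n => measurable_diffN hG hg n, ← ENNReal.tsum_add]
  rfl

/-- `IsPrim.jump` differentiates one term of the recursion from the previous one. Since all
derivatives are nonnegative, summing over the number of switches needs no convergence hypothesis. -/
theorem isPrim_diff {H : ℕ → Fin 2 → ℝ → ℝ → ℝ≥0∞}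
    (hH : ∀ n j, Measurable fun z : ℝ × ℝ => H n j z.1 z.2)
    (hg : ∀ j, Measurable fun z : ℝ × ℝ => g₀ j z.1 z.2) (h0 : p.IsPrim (H 0) g₀)
    (hs : ∀ n, H (n + 1) = p.jump (H n)) :
    p.IsPrim (fun i a t => ∑' n, H n i a t) (p.diff (fun n => H n 1 0) g₀) := by
  have hG : ∀ n, Measurable (H n 1 0) := fun n => (hH n 1).comp measurable_prodMk_left
  refine IsPrim.tsum (g := p.diffN (fun n => H n 1 0) g₀) (fun n => ?_)
    fun n => measurable_diffN hG hg n
  induction n with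
  | zero => exact h0
  | succ n ih => rw [hs]; exact ih.jump (hH n) (measurable_diffN hG hg n)

theorem diffN_past (hG : ∀ n, Measurable (G n))
    (hg : ∀ j, Measurable fun z : ℝ × ℝ => g₀ j z.1 z.2) (n : ℕ) :
    p.diffN (fun n => past (G n)) (fun i a => past (g₀ i a)) n =
      fun i a => past (p.diffN G g₀ n i a) := by
  induction n with
  | zero => rfl
  | succ n ih =>
    funext i a t
    have hm : Measurable fun t => p.src (G n) i a t :=
      (measurable_src (p := p) (hG n) i).comp (f := fun t => (a, t)) (by fun_prop)
    have h1 : p.diffN (fun n => past (G n)) (fun i a => past (g₀ i a)) (n + 1) i a t =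
      p.src (past (G n)) i a t +
        p.kill (p.diffN (fun n => past (G n)) (fun i a => past (g₀ i a)) n) i a t := rfl
    have h2 : p.diffN G g₀ (n + 1) i a =
      fun t => p.src (G n) i a t + p.kill (p.diffN G g₀ n) i a t := rfl
    rw [h1, h2, past_add hm, src_past (hG n), ih, kill_past (measurable_diffN hG hg n)]

end Diff

end Params

namespace Params

variable (p : Params)

/-! ### The fundamental solutions -/

/-- The derivative of `ψ` with respect to the starting point. -/
def psiDiff : Fin 2 → ℝ → ℝ → ℝ≥0∞ :=
  p.diff (fun n => p.evolN (upTo 1 0) n 1 0) fun _ _ _ => 0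

/-- The time at which `B` is reached from `a` without any switch. -/
def arrival (a : ℝ) : ℝ := (p.B - a) / p.μ 1

/-- The mass of the arrival at `B`, from `a`, without any switch. -/
def arrivalMass (a : ℝ) : ℝ≥0∞ := ENNReal.ofReal (p.μ 1)⁻¹ * p.tail 1 (p.arrival a)

/-- The distribution function, in time, of the arrival at `B` without any switch. -/
def atom (i : Fin 2) (a t : ℝ) : ℝ≥0∞ :=
  if i = 1 then p.arrivalMass a * (if p.arrival a ≤ t then 1 else 0) else 0

/-- The derivative of `∫_0^t ω` with respect to the starting point. -/
def cumOmegaDiff : Fin 2 → ℝ → ℝ → ℝ≥0∞ :=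
  p.diff (fun n => past (p.evolN (upTo 1 p.B) n 1 0)) p.atom

/-- `1 - μ₀/μ₁` -/
def slope : ℝ := 1 + -p.μ 0 / p.μ 1

/-- The density of the time of arrival at `B` after exactly one switch. -/
def hit (i : Fin 2) (a s : ℝ) : ℝ≥0∞ :=
  if i = 0 then
    ENNReal.ofReal p.slope⁻¹ * (p.dens 0 ((s - p.arrival a) / p.slope) *
      (p.absorb 0 a ((s - p.arrival a) / p.slope) *
        p.arrivalMass (a + p.μ 0 * ((s - p.arrival a) / p.slope))))
  else 0

/-- The derivative of `ω` with respect to the starting point, without its atom. -/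
def omegaDiff : Fin 2 → ℝ → ℝ → ℝ≥0∞ :=
  p.diff (fun n => p.evolN (upTo 1 p.B) (n + 1) 1 0) fun i a s =>
    p.src (p.evolN (upTo 1 p.B) 0 1 0) i a s + p.hit i a s

variable {p}

theorem measurable_evolN_time {f : Fin 2 → ℝ → ℝ≥0∞} (hf : ∀ j, Measurable (f j)) (n : ℕ)
    (i : Fin 2) (x : ℝ) : Measurable (p.evolN f n i x) :=
  (measurable_evolN hf n i).comp (f := fun t => (x, t)) (by fun_prop)

theorem measurable_evol_time {f : Fin 2 → ℝ → ℝ≥0∞} (hf : ∀ j, Measurable (f j))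
    (i : Fin 2) (x : ℝ) : Measurable (p.evol f i x) :=
  (measurable_evol hf i).comp (f := fun t => (x, t)) (by fun_prop)

theorem measurable_psiDiff (i : Fin 2) : Measurable fun z : ℝ × ℝ => p.psiDiff i z.1 z.2 :=
  measurable_diff (fun n => measurable_evolN_time (measurable_upTo 1 0) n 1 0)
    (fun _ => measurable_const) i

/-- Without a switch, being in regime 1 and not stopped has probability `e^{-Λ₁t}` for every start
in regime 1, so the recursion for the derivative begins with zero. -/
theorem isPrim_psiDiff : p.IsPrim (p.evol (upTo 1 0)) p.psiDiff := by
  refine isPrim_diff (H := p.evolN (upTo 1 0)) (fun n j => measurable_evolN (measurable_upTo 1 0) n j)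
    (fun _ => measurable_const) ?_ fun n => rfl
  have h0 : ∀ a t, p.evolN (upTo 1 0) 0 0 a t = 0 := fun a t =>
    free_onRegime_of_ne (by decide) _ a t
  have h1 : ∀ a ∈ Icc 0 p.B, ∀ t, p.evolN (upTo 1 0) 0 1 a t = p.tail 1 t := fun a ha t => by
    change p.free _ 1 a t = _
    rcases lt_or_ge t 0 with ht | ht
    · rw [free_of_neg _ _ _ ht, tail_of_neg ht]
    · have h : 0 ≤ a + p.μ 1 * t := by have := p.μ_one_pos; have := ha.1; positivity
      rw [upTo, free_onRegime_self, gate_one ha.1 ht, if_pos (flow_mem h).1, mul_one, mul_one]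
  refine ⟨fun t => h0 0 t, fun i a ha t => ?_⟩
  rw [lintegral_zero, add_zero]
  by_cases hi : i = 0
  · subst hi; rw [h0, h0]
  · have hi : i = 1 := by omega
    subst hi
    rw [h1 a ha, h1 0 ⟨le_rfl, p.B_pos.le⟩]

theorem psiDiff_eq (i : Fin 2) (a t : ℝ) :
    p.psiDiff i a t = 0 + (p.src (p.evol (upTo 1 0) 1 0) i a t + p.kill p.psiDiff i a t) :=
  diff_eq (fun n => measurable_evolN_time (measurable_upTo 1 0) n 1 0)
    (fun _ => measurable_const) i a t

theorem measurable_arrival : Measurable p.arrival := by unfold arrival; fun_prop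

theorem measurable_arrivalMass : Measurable p.arrivalMass :=
  ((measurable_tail 1).comp measurable_arrival).const_mul _

theorem measurable_atom (i : Fin 2) : Measurable fun z : ℝ × ℝ => p.atom i z.1 z.2 := by
  have h1 := measurable_arrival (p := p)
  have h2 := measurable_arrivalMass (p := p)
  unfold atom
  by_cases h : i = 1
  · simp only [h, if_true]
    exact .mul (by fun_prop) (.ite (measurableSet_le (by fun_prop) (by fun_prop))
      measurable_const measurable_const)
  · simp only [h, if_false]; exact measurable_const

theorem slope_pos : 0 < p.slope := by
  have h := p.μ_zero_neg
  have h1 := p.μ_one_pos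
  have : 0 < -p.μ 0 / p.μ 1 := div_pos (by linarith) h1
  unfold slope; linarith

theorem measurable_hit (i : Fin 2) : Measurable fun z : ℝ × ℝ => p.hit i z.1 z.2 := by
  have h1 := measurable_arrival (p := p)
  have h2 := measurable_arrivalMass (p := p)
  have h3 := measurable_dens (p := p) 0
  have h4 : Measurable fun z : ℝ × ℝ => p.absorb 0 z.1 ((z.2 - p.arrival z.1) / p.slope) :=
    (measurable_absorb 0).comp (f := fun z : ℝ × ℝ => (z.1, (z.2 - p.arrival z.1) / p.slope))
      (by fun_prop)
  unfold hit
  by_cases h : i = 0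
  · simp only [h, if_true]; fun_prop
  · simp only [h, if_false]; exact measurable_const

theorem measurable_pastN (n : ℕ) (j : Fin 2) :
    Measurable fun z : ℝ × ℝ => past (p.evolN (upTo 1 p.B) n j z.1) z.2 :=
  measurable_past (measurable_evolN (measurable_upTo 1 p.B) n j)

theorem measurable_pastN_time (n : ℕ) : Measurable (past (p.evolN (upTo 1 p.B) n 1 0)) :=
  (measurable_pastN n 1).comp (f := fun t => (0, t)) (by fun_prop)

theorem measurable_cumOmegaDiff (i : Fin 2) :
    Measurable fun z : ℝ × ℝ => p.cumOmegaDiff i z.1 z.2 :=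
  measurable_diff measurable_pastN_time measurable_atom i

theorem measurable_omegaDiff_zero (i : Fin 2) : Measurable fun z : ℝ × ℝ =>
    p.src (p.evolN (upTo 1 p.B) 0 1 0) i z.1 z.2 + p.hit i z.1 z.2 :=
  (measurable_src (measurable_evolN_time (measurable_upTo 1 p.B) 0 1 0) i).add (measurable_hit i)

theorem measurable_omegaDiff (i : Fin 2) : Measurable fun z : ℝ × ℝ => p.omegaDiff i z.1 z.2 :=
  measurable_diff (fun n => measurable_evolN_time (measurable_upTo 1 p.B) (n + 1) 1 0)
    measurable_omegaDiff_zero i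

theorem free_upTo_B {a : ℝ} (ha : a ∈ Icc 0 p.B) (t : ℝ) :
    p.free (upTo 1 p.B) 1 a t = p.tail 1 t * (if p.arrival a ≤ t then 1 else 0) := by
  rcases lt_or_ge t 0 with ht | ht
  · rw [free_of_neg _ _ _ ht, tail_of_neg ht, zero_mul]
  · rw [upTo, free_onRegime_self, gate_one ha.1 ht, one_mul]
    have : p.B ≤ p.flow 1 a t ↔ p.arrival a ≤ t := by
      rw [flow, arrival, le_min_iff, div_le_iff₀ p.μ_one_pos]
      constructor
      · rintro ⟨-, h⟩; linarith
      · intro h; exact ⟨le_rfl, by linarith⟩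
    simp only [this]

theorem arrival_antitone {a b : ℝ} (h : a ≤ b) : p.arrival b ≤ p.arrival a :=
  div_le_div_of_nonneg_right (by linarith) p.μ_one_pos.le

/-- The substitution `s = arrival b` reverses the orientation and carries `(0, a]` to `[arrival a,
arrival 0)`; the factor `1/μ₁` in `arrivalMass` is its Jacobian. -/
theorem setLIntegral_atom (a t : ℝ) : ∫⁻ b in Ioc 0 a, p.atom 1 b t =
    ∫⁻ s, (Ico (p.arrival a) (p.arrival 0) ∩ Iic t).indicator (p.tail 1) s := by
  have hμ := p.μ_one_pos
  have key := lintegral_comp_affine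
    (h := (Ico (p.arrival a) (p.arrival 0) ∩ Iic t).indicator (p.tail 1))
    ((measurable_tail 1).indicator (measurableSet_Ico.inter measurableSet_Iic))
    (p.arrival 0) (v := -(p.μ 1)⁻¹) (neg_ne_zero.2 (inv_ne_zero hμ.ne'))
  rw [inv_neg, inv_inv, abs_neg, abs_of_pos hμ] at key
  have h1 : ∀ h : ℝ≥0∞, ENNReal.ofReal (p.μ 1)⁻¹ * (ENNReal.ofReal (p.μ 1) * h) = h := fun h => by
    rw [← mul_assoc, ← ENNReal.ofReal_mul (inv_nonneg.2 hμ.le), inv_mul_cancel₀ hμ.ne',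
      ENNReal.ofReal_one, one_mul]
  have h2 : ∀ b, p.arrival 0 + -(p.μ 1)⁻¹ * b = p.arrival b := fun b => by
    unfold arrival; field_simp; ring
  rw [← h1 (∫⁻ s, _), ← key, ← lintegral_const_mul' _ _ ENNReal.ofReal_ne_top,
    ← lintegral_indicator measurableSet_Ioc]
  refine lintegral_congr fun b => ?_
  rw [h2]
  have h3 : p.arrival a ≤ p.arrival b ↔ b ≤ a := by
    unfold arrival; rw [div_le_div_iff_of_pos_right hμ]; constructor <;> intro h <;> linarith
  have h4 : p.arrival b < p.arrival 0 ↔ 0 < b := by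
    unfold arrival; rw [div_lt_div_iff_of_pos_right hμ]; constructor <;> intro h <;> linarith
  simp only [indicator, mem_inter_iff, mem_Ioc, mem_Ico, mem_Iic, atom, if_true, h3, h4,
    arrivalMass]
  by_cases hb : 0 < b ∧ b ≤ a
  · by_cases ht : p.arrival b ≤ t <;> simp [hb.1, hb.2, ht]
  · rw [if_neg hb, if_neg fun h => hb ⟨h.1.2, h.1.1⟩, mul_zero]

/-- Without a switch the probability of being at `B` jumps, as a function of the start, where
`arrival a = t`. It has no density in `a`, but its time integral has one; hence `∫_0^t ω` is
differentiated in place of `ω`. -/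
theorem isPrim_atom : p.IsPrim (fun i a => past (p.evolN (upTo 1 p.B) 0 i a)) p.atom := by
  have h0 : ∀ a t, past (p.evolN (upTo 1 p.B) 0 0 a) t = 0 := fun a t => by
    have : ∀ s, p.evolN (upTo 1 p.B) 0 0 a s = 0 := fun s =>
      free_onRegime_of_ne (by decide) _ a s
    simp only [past, this, lintegral_zero]
  refine ⟨h0 0, fun i a ha t => ?_⟩
  by_cases hi : i = 0
  · subst hi; simp [h0, atom]
  have hi : i = 1 := by omega
  subst hi
  have h1 : ∀ b ∈ Icc 0 p.B, past (p.evolN (upTo 1 p.B) 0 1 b) t =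
      ∫⁻ s, (Ici (p.arrival b) ∩ Iic t).indicator (p.tail 1) s := fun b hb => by
    rw [past, ← lintegral_indicator measurableSet_Iic]
    refine lintegral_congr fun s => ?_
    change (Iic t).indicator (p.free (upTo 1 p.B) 1 b) s = _
    simp only [indicator, free_upTo_B hb, mem_inter_iff, mem_Ici, mem_Iic]
    by_cases h1 : s ≤ t <;> by_cases h2 : p.arrival b ≤ s <;> simp [h1, h2]
  have h2 := arrival_antitone (p := p) ha.1
  rw [h1 a ha, h1 0 ⟨le_rfl, p.B_pos.le⟩, setLIntegral_atom, ← lintegral_add_left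
    ((measurable_tail 1).indicator (measurableSet_Ici.inter measurableSet_Iic))]
  refine lintegral_congr fun s => ?_
  simp only [indicator, mem_inter_iff, mem_Ici, mem_Iic, mem_Ico]
  by_cases hs : s ≤ t
  · by_cases h3 : p.arrival 0 ≤ s
    · simp [hs, h3, h2.trans h3, not_lt.2 h3]
    · by_cases h4 : p.arrival a ≤ s <;> simp [hs, h3, h4, not_le.1 h3]
  · simp [hs]

theorem past_evol (f : Fin 2 → ℝ → ℝ≥0∞) (hf : ∀ j, Measurable (f j)) (i : Fin 2) (a t : ℝ) :
    past (p.evol f i a) t = ∑' n, past (p.evolN f n i a) t :=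
  past_tsum (fun n => measurable_evolN_time hf n i a) t

theorem isPrim_cumOmegaDiff :
    p.IsPrim (fun i a => past (p.evol (upTo 1 p.B) i a)) p.cumOmegaDiff := by
  have h := isPrim_diff (H := fun n i a => past (p.evolN (upTo 1 p.B) n i a)) measurable_pastN
    measurable_atom isPrim_atom fun n => by
      funext i a t
      exact (jump_past (measurable_evolN (measurable_upTo 1 p.B) n) i a t).symm
  have e : (fun i a => past (p.evol (upTo 1 p.B) i a)) =
      fun i a t => ∑' n, past (p.evolN (upTo 1 p.B) n i a) t := by
    funext i a t; exact past_evol _ (measurable_upTo 1 p.B) i a t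
  rw [e]
  exact h

theorem cumOmegaDiff_eq (i : Fin 2) (a t : ℝ) :
    p.cumOmegaDiff i a t = p.atom i a t +
      (p.src (past (p.evol (upTo 1 p.B) 1 0)) i a t + p.kill p.cumOmegaDiff i a t) := by
  have e : past (p.evol (upTo 1 p.B) 1 0) =
      fun t => ∑' n, past (p.evolN (upTo 1 p.B) n 1 0) t := by
    funext t; exact past_evol _ (measurable_upTo 1 p.B) 1 0 t
  rw [e]
  exact diff_eq measurable_pastN_time measurable_atom i a t

/-- The distribution function of the time of arrival after exactly one switch. -/
theorem kill_atom (i : Fin 2) (a t : ℝ) : p.kill p.atom i a t = past (p.hit i a) t := by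
  by_cases hi : i = 0
  swap
  · have : i = 1 := by omega
    subst this
    simp [kill, atom, hit, past]
  subst hi
  have hκ := slope_pos (p := p)
  have hμ := p.μ_one_pos
  have hm : Measurable fun s => p.dens 0 ((s - p.arrival a) / p.slope) *
      (p.absorb 0 a ((s - p.arrival a) / p.slope) *
        p.arrivalMass (a + p.μ 0 * ((s - p.arrival a) / p.slope))) := by
    have h2 := measurable_arrivalMass (p := p)
    have h3 := measurable_dens (p := p) 0
    have h4 : Measurable fun s => p.absorb 0 a ((s - p.arrival a) / p.slope) :=
      (measurable_absorb 0).comp (f := fun s => (a, (s - p.arrival a) / p.slope)) (by fun_prop)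
    fun_prop
  have key := lintegral_comp_affine (hm.indicator (measurableSet_Iic (a := t))) (p.arrival a) hκ.ne'
  rw [abs_of_pos (inv_pos.2 hκ), lintegral_indicator measurableSet_Iic,
    ← lintegral_const_mul _ hm] at key
  simp only [past, hit, if_true]
  rw [← key, kill]
  refine lintegral_congr fun τ => ?_
  have h1 : (p.arrival a + p.slope * τ - p.arrival a) / p.slope = τ := by
    rw [add_sub_cancel_left, mul_div_cancel_left₀ _ hκ.ne']
  -- Moving back for the time `τ` delays the arrival by `τ` plus the time `-μ₀τ/μ₁` needed to regain
  -- the distance, that is by `slope * τ` in all. One switch thus spreads the atom into a density.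
  have h2 : p.arrival (a + p.μ 0 * τ) ≤ t - τ ↔ p.arrival a + p.slope * τ ≤ t := by
    have : p.arrival (a + p.μ 0 * τ) + τ = p.arrival a + p.slope * τ := by
      unfold arrival slope; field_simp; ring
    rw [← this, le_sub_iff_add_le]
  simp only [indicator, mem_Iic, h1, atom, sub_zero, if_true, h2]
  split_ifs <;> simp

theorem diffN_succ_eq (G : ℕ → ℝ → ℝ≥0∞) (g₀ : Fin 2 → ℝ → ℝ → ℝ≥0∞) (n : ℕ) :
    p.diffN G g₀ (n + 1) = p.diffN (fun n => G (n + 1)) (p.diffN G g₀ 1) n := by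
  induction n with
  | zero => rfl
  | succ n ih =>
    funext i a t
    change p.src (G (n + 1)) i a t + p.kill (p.diffN G g₀ (n + 1)) i a t = _
    rw [ih]
    rfl

/-- Only the term without switches carries the atom. From one switch on the recursion starts from a
time integral, by `kill_atom`, and every further step commutes with `past`. -/
theorem cumOmegaDiff_eq_past (i : Fin 2) (a t : ℝ) :
    p.cumOmegaDiff i a t = p.atom i a t + past (p.omegaDiff i a) t := by
  have hG := fun n => measurable_evolN_time (p := p) (measurable_upTo 1 p.B) (n + 1) 1 0
  have hm : ∀ n, Measurable (p.diffN (fun n => p.evolN (upTo 1 p.B) (n + 1) 1 0) (fun i a s =>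
      p.src (p.evolN (upTo 1 p.B) 0 1 0) i a s + p.hit i a s) n i a) := fun n =>
    (measurable_diffN (p := p) hG measurable_omegaDiff_zero n i).comp
      (f := fun t => (a, t)) (by fun_prop)
  have h1 : p.diffN (fun n => past (p.evolN (upTo 1 p.B) n 1 0)) p.atom 1 = fun i a => past fun s =>
      p.src (p.evolN (upTo 1 p.B) 0 1 0) i a s + p.hit i a s := by
    funext i a t
    change p.src (past (p.evolN (upTo 1 p.B) 0 1 0)) i a t + p.kill p.atom i a t = _
    have h0 := measurable_evolN_time (p := p) (measurable_upTo 1 p.B) 0 1 0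
    have hs : Measurable fun s => p.src (p.evolN (upTo 1 p.B) 0 1 0) i a s :=
      (measurable_src (p := p) h0 i).comp (f := fun t => (a, t)) (by fun_prop)
    rw [past_add hs, src_past h0, kill_atom]
  rw [cumOmegaDiff, diff, tsum_eq_zero_add' ENNReal.summable]
  congr 1
  have h2 : past (p.omegaDiff i a) t = ∑' n, past (p.diffN
      (fun n => p.evolN (upTo 1 p.B) (n + 1) 1 0) (fun i a s =>
        p.src (p.evolN (upTo 1 p.B) 0 1 0) i a s + p.hit i a s) n i a) t :=
    past_tsum hm t
  rw [h2]
  refine tsum_congr fun n => ?_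
  rw [diffN_succ_eq, h1, diffN_past hG measurable_omegaDiff_zero]

end Params

/-! ### Laplace transforms of nonnegative functions -/

/-- The Laplace transform of a nonnegative function that vanishes at negative times. -/
def lap (g : ℝ → ℝ≥0∞) (m : ℝ) : ℝ≥0∞ := ∫⁻ t, ENNReal.ofReal (Real.exp (-(m * t))) * g t

/-- Tonelli and `∫_s^∞ e^{-mt} dt = e^{-ms}/m`, the latter read off from the total mass of the
exponential density. It recovers the transform of a measure from that of its distribution function.
-/
theorem lap_measure_Iic (ν : Measure ℝ) [SFinite ν] {m : ℝ} (hm : 0 < m) :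
    lap (fun t => ν (Iic t)) m =
      ENNReal.ofReal m⁻¹ * ∫⁻ s, ENNReal.ofReal (Real.exp (-(m * s))) ∂ν := by
  have h1 : ∀ t, ENNReal.ofReal (Real.exp (-(m * t))) * ν (Iic t) =
      ∫⁻ s, (if s ≤ t then ENNReal.ofReal (Real.exp (-(m * t))) else 0) ∂ν := fun t => by
    have : ∀ s, (if s ≤ t then ENNReal.ofReal (Real.exp (-(m * t))) else 0) =
        (Iic t).indicator (fun _ => ENNReal.ofReal (Real.exp (-(m * t)))) s := fun s => by
      simp [indicator]
    simp only [this]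
    rw [lintegral_indicator_const measurableSet_Iic]
  have hmeas : Measurable fun z : ℝ × ℝ =>
      if z.2 ≤ z.1 then ENNReal.ofReal (Real.exp (-(m * z.1))) else 0 :=
    .ite (measurableSet_le (by fun_prop) (by fun_prop)) (by fun_prop) measurable_const
  unfold lap
  simp only [h1]
  rw [lintegral_lintegral_swap (f := fun t s =>
    if s ≤ t then ENNReal.ofReal (Real.exp (-(m * t))) else 0) hmeas.aemeasurable,
    ← lintegral_const_mul _ (by fun_prop)]
  refine lintegral_congr fun s => ?_
  have h2 : ∀ t, (if s ≤ t then ENNReal.ofReal (Real.exp (-(m * t))) else 0) =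
      ENNReal.ofReal m⁻¹ * ENNReal.ofReal (Real.exp (-(m * s))) *
        exponentialPDF m (t - s) := fun t => by
    rw [exponentialPDF_eq]
    simp only [sub_nonneg]
    split_ifs
    · rw [← ENNReal.ofReal_mul (by positivity), ← ENNReal.ofReal_mul (by positivity)]
      congr 1
      have : Real.exp (-(m * s)) * Real.exp (-(m * (t - s))) = Real.exp (-(m * t)) := by
        rw [← Real.exp_add]; congr 1; ring
      rw [← this]; field_simp
    · simp
  have h3 : Measurable fun t => exponentialPDF m (t - s) :=
    (measurable_exponentialPDFReal m).ennreal_ofReal.comp (by fun_prop)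
  simp only [h2]
  rw [lintegral_const_mul _ h3, lintegral_sub_right_eq_self, lintegral_exponentialPDF_eq_one hm,
    mul_one]

theorem withDensity_Iic (g : ℝ → ℝ≥0∞) (t : ℝ) : volume.withDensity g (Iic t) = past g t :=
  withDensity_apply _ measurableSet_Iic

theorem lap_eq_withDensity {g : ℝ → ℝ≥0∞} (hg : Measurable g) (m : ℝ) :
    ∫⁻ s, ENNReal.ofReal (Real.exp (-(m * s))) ∂(volume.withDensity g) = lap g m := by
  rw [lintegral_withDensity_eq_lintegral_mul _ hg (by fun_prop)]
  exact lintegral_congr fun s => mul_comm _ _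

theorem lap_past {g : ℝ → ℝ≥0∞} (hg : Measurable g) {m : ℝ} (hm : 0 < m) :
    lap (past g) m = ENNReal.ofReal m⁻¹ * lap g m := by
  rw [← lap_eq_withDensity hg, ← lap_measure_Iic _ hm]
  simp only [withDensity_Iic]

theorem lap_comp_sub (g : ℝ → ℝ≥0∞) (c m : ℝ) :
    lap (fun t => g (t - c)) m = ENNReal.ofReal (Real.exp (-(m * c))) * lap g m := by
  unfold lap
  rw [← lintegral_const_mul' _ _ ENNReal.ofReal_ne_top, ← lintegral_add_right_eq_self _ c]
  refine lintegral_congr fun t => ?_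
  beta_reduce
  rw [← mul_assoc, ← ENNReal.ofReal_mul (Real.exp_pos _).le, ← Real.exp_add, add_sub_cancel_right]
  congr 3; ring

theorem lap_const_mul {g : ℝ → ℝ≥0∞} (hg : Measurable g) (c : ℝ≥0∞) (m : ℝ) :
    lap (fun t => c * g t) m = c * lap g m := by
  unfold lap
  rw [← lintegral_const_mul _ (by fun_prop)]
  exact lintegral_congr fun t => mul_left_comm _ _ _

theorem lap_add {g : ℝ → ℝ≥0∞} (hg : Measurable g) (g' : ℝ → ℝ≥0∞) (m : ℝ) :
    lap (fun t => g t + g' t) m = lap g m + lap g' m := by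
  unfold lap
  rw [← lintegral_add_left (by fun_prop)]
  exact lintegral_congr fun t => mul_add _ _ _

theorem lap_lintegral {α : Type*} [MeasurableSpace α] (ν : Measure α) [SFinite ν]
    {g : α → ℝ → ℝ≥0∞} (hg : Measurable fun z : α × ℝ => g z.1 z.2) (m : ℝ) :
    lap (fun t => ∫⁻ a, g a t ∂ν) m = ∫⁻ a, lap (g a) m ∂ν := by
  unfold lap
  rw [lintegral_lintegral_swap (f := fun a t => ENNReal.ofReal (Real.exp (-(m * t))) * g a t)]
  · refine lintegral_congr fun t => ?_
    have : Measurable fun a => g a t := hg.comp measurable_prodMk_right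
    rw [lintegral_const_mul _ this]
  · exact (Measurable.mul (by fun_prop) hg).aemeasurable

theorem measurable_lap {α : Type*} [MeasurableSpace α] {g : α → ℝ → ℝ≥0∞}
    (hg : Measurable fun z : α × ℝ => g z.1 z.2) (m : ℝ) : Measurable fun a => lap (g a) m :=
  Measurable.lintegral_prod_right' (f := fun z : α × ℝ =>
    ENNReal.ofReal (Real.exp (-(m * z.2))) * g z.1 z.2) (Measurable.mul (by fun_prop) hg)

/-- The transition between Laplace transforms of nonnegative and of real functions. -/
theorem hasLaplace_of_lap {g : ℝ → ℝ≥0∞} (hg : Measurable g) (hneg : ∀ t < 0, g t = 0) {m v : ℝ}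
    (hv : 0 ≤ v) (h : lap g m = ENNReal.ofReal v) : HasLaplace (fun t => (g t).toReal) m v := by
  have hfin : lap g m ≠ ∞ := by rw [h]; exact ENNReal.ofReal_ne_top
  have hmeas : Measurable fun t => ENNReal.ofReal (Real.exp (-(m * t))) * g t := by fun_prop
  have e : ∀ t, (ENNReal.ofReal (Real.exp (-(m * t))) * g t).toReal =
      Real.exp (-(m * t)) * (g t).toReal := fun t => by
    rw [ENNReal.toReal_mul, ENNReal.toReal_ofReal (Real.exp_pos _).le]
  have hi := integrable_toReal_of_lintegral_ne_top hmeas.aemeasurable hfin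
  simp only [e] at hi
  refine ⟨hi.integrableOn, ?_⟩
  have h2 : ∫ t, Real.exp (-(m * t)) * (g t).toReal = v := by
    have := integral_toReal hmeas.aemeasurable (ae_lt_top hmeas hfin)
    simp only [e] at this
    rw [this]
    change (lap g m).toReal = v
    rw [h, ENNReal.toReal_ofReal hv]
  rw [laplace, ← integral_Ici_eq_integral_Ioi, setIntegral_eq_integral_of_forall_compl_eq_zero, h2]
  intro t ht
  rw [hneg t (by simpa using ht), ENNReal.toReal_zero, mul_zero]

theorem HasLaplace.lap_eq {g : ℝ → ℝ≥0∞} (hneg : ∀ t < 0, g t = 0) (hfin : ∀ t, g t ≠ ∞)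
    {m v : ℝ} (h : HasLaplace (fun t => (g t).toReal) m v) : lap g m = ENNReal.ofReal v := by
  rw [← h.2, laplace, ofReal_integral_eq_lintegral_ofReal h.1
    (.of_forall fun t => mul_nonneg (Real.exp_pos _).le ENNReal.toReal_nonneg), lap,
    setLIntegral_congr Ioi_ae_eq_Ici, ← lintegral_indicator measurableSet_Ici]
  refine lintegral_congr fun t => ?_
  rcases lt_or_ge t 0 with ht | ht
  · rw [hneg t ht, mul_zero, indicator_of_notMem (by simpa using ht)]
  · rw [indicator_of_mem (by simpa using ht), ENNReal.ofReal_mul (Real.exp_pos _).le,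
      ENNReal.ofReal_toReal (hfin t)]

theorem quasiMeasurePreserving_affine (a : ℝ) {v : ℝ} (hv : v ≠ 0) :
    Measure.QuasiMeasurePreserving (fun τ : ℝ => a + v * τ) := by
  have hm : Measurable fun τ : ℝ => a + v * τ := by fun_prop
  refine ⟨hm, Measure.AbsolutelyContinuous.mk fun s hs h0 => ?_⟩
  have key := lintegral_comp_affine (measurable_const.indicator hs (f := fun _ => (1 : ℝ≥0∞))) a hv
  rw [lintegral_indicator_const hs, h0, mul_zero, mul_zero] at key
  rw [Measure.map_apply hm hs, ← one_mul (volume _), ← lintegral_indicator_const (hm hs)]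
  exact key

/-! ### Transforms along the recursion, and continuity in the starting point -/

namespace Params

variable {p : Params}

theorem lap_src (G : ℝ → ℝ≥0∞) (hG : Measurable G) {x : ℝ} (hx : 0 ≤ x) (m : ℝ) :
    lap (p.src G 0 x) m = ENNReal.ofReal
      ((-p.μ 0)⁻¹ * (p.Λ 0 * Real.exp (-((p.Λ 0 + m) * (x / -p.μ 0))))) * lap G m := by
  have h0 := p.μ_zero_neg
  have h1 := p.Λ_pos 0
  have h2 : 0 ≤ x / -p.μ 0 := div_nonneg hx (by linarith)
  have h3 : 0 ≤ (-p.μ 0)⁻¹ := inv_nonneg.2 (by linarith)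
  have e : p.src G 0 x = fun t => ENNReal.ofReal ((-p.μ 0)⁻¹ *
      (p.Λ 0 * Real.exp (-(p.Λ 0 * (x / -p.μ 0))))) * G (t - x / -p.μ 0) := by
    funext t
    rw [src, if_pos rfl, dens_of_nonneg h2, ← mul_assoc, ← ENNReal.ofReal_mul h3]
  rw [e, lap_const_mul (by fun_prop), lap_comp_sub, ← mul_assoc, ← ENNReal.ofReal_mul (by positivity)]
  congr 2
  rw [mul_assoc, mul_assoc, ← Real.exp_add]
  congr 3; ring_nf

theorem lap_kill {g : Fin 2 → ℝ → ℝ → ℝ≥0∞}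
    (hg : ∀ j, Measurable fun z : ℝ × ℝ => g j z.1 z.2) (i : Fin 2) (x m : ℝ) :
    lap (p.kill g i x) m = ∫⁻ τ, p.dens i τ * (ENNReal.ofReal (Real.exp (-(m * τ))) *
      (p.absorb i x τ * lap (g (1 - i) (x + p.μ i * τ)) m)) := by
  have h := lap_lintegral (volume : Measure ℝ) (g := fun τ t =>
    p.dens i τ * (p.absorb i x τ * g (1 - i) (x + p.μ i * τ) (t - τ)))
    ((measurable_kill_integrand hg i).comp
      (f := fun w : ℝ × ℝ => ((x, w.2), w.1)) (by fun_prop)) m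
  change lap (fun t => ∫⁻ τ, _) m = _
  rw [h]
  refine lintegral_congr fun τ => ?_
  have hm : Measurable fun t => g (1 - i) (x + p.μ i * τ) (t - τ) :=
    (hg (1 - i)).comp (f := fun t => (x + p.μ i * τ, t - τ)) (by fun_prop)
  rw [lap_const_mul (by fun_prop), lap_const_mul hm, lap_comp_sub, mul_left_comm (p.absorb i x τ)]

theorem μ_ne_zero (i : Fin 2) : p.μ i ≠ 0 := by
  by_cases h : i = 0
  · rw [h]; exact p.μ_zero_neg.ne
  · have : i = 1 := by omega
    rw [this]; exact p.μ_one_pos.ne'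

/-- The expectation of `u` at the first switch for a point that is killed at `0` and `B`,
discounted with the rate `m`. -/
def discount (p : Params) (m : ℝ) (u : ℝ → ℝ≥0∞) (i : Fin 2) (x : ℝ) : ℝ≥0∞ :=
  ∫⁻ τ, p.dens i τ * (ENNReal.ofReal (Real.exp (-(m * τ))) *
    (p.absorb i x τ * u (x + p.μ i * τ)))

/-- The position at the switch is an affine function of `τ`, so null sets of positions pull back to
null sets of switching times. After a switch, an identity for almost every position has become one
for every starting point. -/
theorem discount_congr {u v : ℝ → ℝ≥0∞} (h : u =ᵐ[volume.restrict (Ioc 0 p.B)] v) (m : ℝ)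
    (i : Fin 2) (x : ℝ) : p.discount m u i x = p.discount m v i x := by
  refine lintegral_congr_ae ?_
  rw [Filter.EventuallyEq, ae_restrict_iff' measurableSet_Ioc] at h
  filter_upwards [(quasiMeasurePreserving_affine x (p.μ_ne_zero i)).ae h] with τ hτ
  unfold absorb
  split_ifs with hx
  · rw [hτ hx]
  · simp

theorem continuousAt_indicator_Ioc {u : ℝ → ℝ≥0∞} (hu : Continuous u) {c B : ℝ} (h0 : c ≠ 0)
    (hB : c ≠ B) : ContinuousAt ((Ioc 0 B).indicator u) c := by
  by_cases h : c ∈ Ioo 0 B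
  · refine hu.continuousAt.congr ?_
    filter_upwards [Ioo_mem_nhds h.1 h.2] with y hy
    rw [indicator_of_mem (Ioo_subset_Ioc_self hy)]
  · have h' : c ∉ Icc 0 B := fun hc =>
      h ⟨lt_of_le_of_ne hc.1 h0.symm, lt_of_le_of_ne hc.2 hB⟩
    refine (continuousAt_const (y := (0 : ℝ≥0∞))).congr ?_
    filter_upwards [isClosed_Icc.isOpen_compl.mem_nhds h'] with y hy
    rw [indicator_of_notMem fun hc => hy (Ioc_subset_Icc_self hc)]

/-- Dominated convergence: the indicator of `(0, B]` is discontinuous only at `0` and `B`, which are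
met for a null set of switching times. -/
theorem continuous_discount {u : ℝ → ℝ} (hu : Continuous u) {m : ℝ} (hm : 0 < m) (i : Fin 2) :
    Continuous (p.discount m (fun c => ENNReal.ofReal (u c)) i) := by
  have hd := measurable_dens (p := p) i
  obtain ⟨M, hM⟩ := (isCompact_Icc (a := 0) (b := p.B)).exists_bound_of_continuousOn hu.continuousOn
  have e : ∀ x τ, p.absorb i x τ * ENNReal.ofReal (u (x + p.μ i * τ)) =
      (Ioc 0 p.B).indicator (fun c => ENNReal.ofReal (u c)) (x + p.μ i * τ) := fun x τ => by
    unfold absorb indicator; split_ifs <;> simp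
  unfold discount
  simp only [e]
  refine continuous_iff_continuousAt.2 fun x => ?_
  refine tendsto_lintegral_filter_of_dominated_convergence
    (fun τ => p.dens i τ * ENNReal.ofReal M) (.of_forall fun y => ?_) (.of_forall fun y =>
      .of_forall fun τ => ?_) ?_ ?_
  · have : Measurable ((Ioc 0 p.B).indicator fun c => ENNReal.ofReal (u c)) :=
      (by fun_prop : Measurable fun c => ENNReal.ofReal (u c)).indicator measurableSet_Ioc
    fun_prop
  · rcases lt_or_ge τ 0 with hτ | hτ
    · rw [dens_of_neg hτ, zero_mul, zero_mul]
    · gcongr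
      refine (mul_le_of_le_one_left' ?_).trans ?_
      · rw [ENNReal.ofReal_le_one, Real.exp_le_one_iff]
        have := mul_nonneg hm.le hτ; linarith
      · unfold indicator
        split_ifs with hc
        · exact ENNReal.ofReal_le_ofReal ((le_abs_self _).trans (hM _ (Ioc_subset_Icc_self hc)))
        · exact bot_le
  · rw [lintegral_mul_const _ hd]
    have : ∫⁻ τ, p.dens i τ = 1 := lintegral_exponentialPDF_eq_one (p.Λ_pos i)
    rw [this, one_mul]; exact ENNReal.ofReal_ne_top
  · have hne := fun c : ℝ => (quasiMeasurePreserving_affine x (p.μ_ne_zero i)).ae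
      (Measure.ae_ne volume c)
    filter_upwards [hne 0, hne p.B] with τ h0 hB
    refine ENNReal.Tendsto.const_mul (ENNReal.Tendsto.const_mul ?_ (Or.inr ENNReal.ofReal_ne_top))
      (Or.inr ENNReal.ofReal_ne_top)
    have hc : Continuous fun c => ENNReal.ofReal (u c) := ENNReal.continuous_ofReal.comp hu
    exact ContinuousAt.comp (f := fun y => y + p.μ i * τ)
      (continuousAt_indicator_Ioc hc h0 hB) (by fun_prop)

theorem ae_eq_of_setLIntegral_Ioc_eq {u v : ℝ → ℝ≥0∞} (hu : Measurable u) (hv : Measurable v)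
    {B : ℝ} (hfin : ∫⁻ b in Ioc 0 B, v b ≠ ∞)
    (h : ∀ a ∈ Icc 0 B, ∫⁻ b in Ioc 0 a, u b = ∫⁻ b in Ioc 0 a, v b) (hB : 0 ≤ B) :
    u =ᵐ[volume.restrict (Ioc 0 B)] v := by
  have hfin' : ∫⁻ b in Ioc 0 B, u b ≠ ∞ := by rwa [h B ⟨hB, le_rfl⟩]
  rw [← withDensity_eq_iff hu.aemeasurable hv.aemeasurable hfin']
  have : IsFiniteMeasure ((volume.restrict (Ioc 0 B)).withDensity u) :=
    isFiniteMeasure_withDensity hfin'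
  refine Measure.ext_of_Iic _ _ fun a => ?_
  rw [withDensity_apply _ measurableSet_Iic, withDensity_apply _ measurableSet_Iic,
    Measure.restrict_restrict measurableSet_Iic]
  rcases lt_or_ge a 0 with ha | ha
  · have : Iic a ∩ Ioc 0 B = ∅ := by
      ext c; simp only [mem_inter_iff, mem_Iic, mem_Ioc, mem_empty_iff_false, iff_false]
      intro hc; linarith [hc.1, hc.2.1]
    rw [this]; simp
  · have : Iic a ∩ Ioc 0 B = Ioc 0 (min a B) := by
      ext c; simp only [mem_inter_iff, mem_Iic, mem_Ioc, le_min_iff]; tauto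
    rw [this, h _ ⟨le_min ha hB, min_le_right _ _⟩]

theorem IsPrim.lap_eq_add {G g : Fin 2 → ℝ → ℝ → ℝ≥0∞} (hP : p.IsPrim G g)
    (hG : ∀ i, Measurable (G i 0)) (hg : ∀ j, Measurable fun z : ℝ × ℝ => g j z.1 z.2)
    (i : Fin 2) {a : ℝ} (ha : a ∈ Icc 0 p.B) (m : ℝ) :
    lap (G i a) m = lap (G i 0) m + ∫⁻ b in Ioc 0 a, lap (g i b) m := by
  rw [← lap_lintegral (volume.restrict (Ioc 0 a)) (hg i), ← lap_add (hG i)]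
  congr 1
  funext t
  exact hP.eq_add i a ha t

/-- If the Laplace transforms of the functions `G i a` are the primitives of the continuous
functions `h i`, then `h i` are the Laplace transforms of the derivatives. -/
theorem IsPrim.lap_eq {G g g₀ : Fin 2 → ℝ → ℝ → ℝ≥0∞} (hP : p.IsPrim G g)
    (hG : ∀ i, Measurable (G i 0)) (hg : ∀ j, Measurable fun z : ℝ × ℝ => g j z.1 z.2)
    (hg₀ : ∀ j, Measurable fun z : ℝ × ℝ => g₀ j z.1 z.2)
    (heq : ∀ i a t, g i a t = g₀ i a t + (p.src (G 1 0) i a t + p.kill g i a t))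
    {m : ℝ} (hm : 0 < m) {h : Fin 2 → ℝ → ℝ} (hh : ∀ i, Continuous (h i)) {C : Fin 2 → ℝ}
    (hC : ∀ i, ∀ a ∈ Icc 0 p.B, 0 ≤ C i + ∫ b in (0 : ℝ)..a, h i b)
    (hlap : ∀ i, ∀ a ∈ Icc 0 p.B, lap (G i a) m = ENNReal.ofReal (C i + ∫ b in (0 : ℝ)..a, h i b))
    (hβ : ∀ i, ContinuousOn (fun a => lap (g₀ i a) m) (Icc 0 p.B)) (i : Fin 2) {a : ℝ}
    (ha : a ∈ Icc 0 p.B) : 0 ≤ h i a ∧ lap (g i a) m = ENNReal.ofReal (h i a) := by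
  have hB := p.B_pos.le
  have h0mem : (0 : ℝ) ∈ Icc 0 p.B := ⟨le_rfl, hB⟩
  have hC0 : ∀ i, 0 ≤ C i := fun i => by simpa using hC i 0 h0mem
  have hlap0 : ∀ i, lap (G i 0) m = ENNReal.ofReal (C i) := fun i => by simpa using hlap i 0 h0mem
  have hsum : ∀ i, ∀ a ∈ Icc 0 p.B, ENNReal.ofReal (C i + ∫ b in (0 : ℝ)..a, h i b) =
      ENNReal.ofReal (C i) + ∫⁻ b in Ioc 0 a, lap (g i b) m := fun i a ha => by
    rw [← hlap i a ha, ← hlap0, hP.lap_eq_add hG hg i ha]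
  have hder : ∀ i x, HasDerivAt (fun a => C i + ∫ b in (0 : ℝ)..a, h i b) (h i x) x := fun i x =>
    ((hh i).integral_hasStrictDerivAt 0 x).hasDerivAt.const_add _
  -- The sign of `h` is not assumed. The transform of `G i a` grows with `a` because it is the
  -- integral of a nonnegative derivative; thus its smooth primitive is monotone and `h ≥ 0`.
  have hmono : ∀ i, MonotoneOn (fun a => C i + ∫ b in (0 : ℝ)..a, h i b) (Icc 0 p.B) := by
    intro i x hx y hy hxy
    refine (ENNReal.ofReal_le_ofReal_iff (hC i y hy)).1 ?_
    rw [hsum i x hx, hsum i y hy]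
    gcongr
  have hnn : ∀ i, ∀ x ∈ Icc 0 p.B, 0 ≤ h i x := fun i x hx => by
    rw [← (hder i x).hasDerivWithinAt.derivWithin (uniqueDiffOn_Icc p.B_pos x hx)]
    exact (hmono i).derivWithin_nonneg
  have hint : ∀ i, ∀ a ∈ Icc 0 p.B,
      ∫⁻ b in Ioc 0 a, ENNReal.ofReal (h i b) = ENNReal.ofReal (∫ b in (0 : ℝ)..a, h i b) := by
    intro i a ha
    rw [intervalIntegral.integral_of_le ha.1, ofReal_integral_eq_lintegral_ofReal]
    · exact ((hh i).intervalIntegrable 0 a).1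
    · filter_upwards [ae_restrict_mem measurableSet_Ioc] with b hb
      exact hnn i b ⟨hb.1.le, hb.2.trans ha.2⟩
  have hprim : ∀ i, ∀ a ∈ Icc 0 p.B,
      ∫⁻ b in Ioc 0 a, lap (g i b) m = ∫⁻ b in Ioc 0 a, ENNReal.ofReal (h i b) := by
    intro i a ha
    have h1 := hsum i a ha
    rw [ENNReal.ofReal_add (hC0 i) (intervalIntegral.integral_nonneg ha.1 fun b hb =>
      hnn i b ⟨hb.1, hb.2.trans ha.2⟩)] at h1
    rw [hint i a ha]
    exact (ENNReal.add_right_inj ENNReal.ofReal_ne_top).1 h1.symm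
  have hae : ∀ i, (fun b => lap (g i b) m) =ᵐ[volume.restrict (Ioc 0 p.B)]
      fun b => ENNReal.ofReal (h i b) := fun i => by
    refine ae_eq_of_setLIntegral_Ioc_eq (measurable_lap (hg i) m) (by have := hh i; fun_prop) ?_
      (hprim i) hB
    rw [hint i _ ⟨hB, le_rfl⟩]; exact ENNReal.ofReal_ne_top
  -- The equation of the first switch expresses the transform through the almost-everywhere class of
  -- `h` only, and this expression is continuous in `a`. It upgrades `hae` to an identity at every
  -- point of `[0, B]`.
  have hrep : ∀ a ∈ Icc 0 p.B, lap (g i a) m = lap (g₀ i a) m + (lap (p.src (G 1 0) i a) m +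
      p.discount m (fun c => ENNReal.ofReal (h (1 - i) c)) i a) := by
    intro a _
    have e : g i a = fun t => g₀ i a t + (p.src (G 1 0) i a t + p.kill g i a t) := by
      funext t; exact heq i a t
    have hm0 : Measurable fun t => g₀ i a t := (hg₀ i).comp (f := fun t => (a, t)) (by fun_prop)
    have hms : Measurable fun t => p.src (G 1 0) i a t :=
      (measurable_src (p := p) (hG 1) i).comp (f := fun t => (a, t)) (by fun_prop)
    conv_lhs => rw [e]
    rw [lap_add hm0, lap_add hms, lap_kill hg, ← discount_congr (hae (1 - i))]
    rfl
  have hcont : ContinuousOn (fun a => lap (g i a) m) (Icc 0 p.B) := by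
    refine ContinuousOn.congr ((hβ i).add (ContinuousOn.add ?_
      (continuous_discount (hh (1 - i)) hm i).continuousOn)) hrep
    by_cases hi : i = 0
    · subst hi
      refine ContinuousOn.congr (f := fun x => ENNReal.ofReal
        ((-p.μ 0)⁻¹ * (p.Λ 0 * Real.exp (-((p.Λ 0 + m) * (x / -p.μ 0))))) * lap (G 1 0) m)
        ?_ fun x hx => lap_src _ (hG 1) hx.1 m
      refine Continuous.continuousOn ?_
      refine ENNReal.continuous_mul_const (by rw [hlap0]; exact ENNReal.ofReal_ne_top) |>.comp
        (ENNReal.continuous_ofReal.comp ?_)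
      fun_prop
    · have hi : i = 1 := by omega
      subst hi
      have : ∀ a, lap (p.src (G 1 0) 1 a) m = 0 := fun a => by simp [lap, src]
      simp only [this]
      exact continuousOn_const
  refine ⟨hnn i a ha, ?_⟩
  refine Measure.eqOn_Icc_of_ae_eq volume p.B_pos.ne ?_ hcont
    (ENNReal.continuous_ofReal.comp (hh i)).continuousOn ha
  rw [← restrict_Ioc_eq_restrict_Icc]
  exact hae i

end Params

namespace Params

variable (p : Params)

/-! ### The Laplace transforms of the fundamental solutions -/

/-- Laplace transform of `ψ` at `m`, for the initial condition `δ_a` in regime `i`. -/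
def psiHat (m : ℝ) (i : Fin 2) (a : ℝ) : ℝ := if i = 0 then p.ψ₀Hat m a else p.ψ₁Hat m a

/-- Laplace transform of `ω` at `m`, for the initial condition `δ_a` in regime `i`. -/
def omegaHat (m : ℝ) (i : Fin 2) (a : ℝ) : ℝ := if i = 0 then p.ω₀Hat m a else p.ω₁Hat m a

variable {p}

theorem continuous_eU (m : ℝ) : Continuous (p.eU m) := by unfold eU; fun_prop

theorem continuous_eW (m : ℝ) : Continuous (p.eW m) := by unfold eW; fun_prop

theorem continuous_omegaHat (m : ℝ) (i : Fin 2) : Continuous (p.omegaHat m i) := by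
  have h1 := continuous_eU (p := p) m
  have h2 := continuous_eW (p := p) m
  unfold omegaHat ω₀Hat ω₁Hat
  by_cases h : i = 0
  · simp only [h, if_true]; fun_prop
  · simp only [h, if_false]; fun_prop

theorem continuous_psiHat (m : ℝ) (i : Fin 2) : Continuous (p.psiHat m i) := by
  have h1 := continuous_eU (p := p) m
  have h2 := continuous_eW (p := p) m
  unfold psiHat ψ₀Hat ψ₁Hat ω₀Hat ω₁Hat
  by_cases h : i = 0
  · simp only [h, if_true]; fun_prop
  · simp only [h, if_false]; fun_prop

theorem integral_linear_eq {Ψ Θ : ℝ → ℝ} (hΨ : Continuous Ψ) (hΘ : Continuous Θ) {α β γ ξ : ℝ}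
    (h : ∀ b, α * Θ b + β * Ψ b = γ * Real.exp (-(ξ * b))) (a : ℝ) :
    α * (∫ b in (0 : ℝ)..a, Θ b) + β * (∫ b in (0 : ℝ)..a, Ψ b) = γ * expPrim ξ a := by
  rw [expPrim, ← intervalIntegral.integral_const_mul, ← intervalIntegral.integral_const_mul,
    ← intervalIntegral.integral_const_mul, ← intervalIntegral.integral_add]
  · simp only [h]
  · exact (hΘ.const_mul α).intervalIntegrable _ _
  · exact (hΨ.const_mul β).intervalIntegrable _ _

theorem sys_unique {m : ℝ} (hm : 0 < m) {l₀ l₁ : ℝ → ℝ} {c Ψ Θ Ψ' Θ' : ℝ}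
    (h : p.Sys m l₀ l₁ c Ψ Θ) (h' : p.Sys m l₀ l₁ c Ψ' Θ') : Ψ = Ψ' ∧ Θ = Θ' := by
  rw [p.sys_iff hm l₀ l₁ c _ _ rfl rfl] at h h'
  have hΘ := h.2.trans h'.2.symm
  exact ⟨by rw [h.1, h'.1, hΘ], hΘ⟩

/-- The system is linear and `E_ξ(a)` is the integral of the delta data over `b` from `0` to `a`, so
its solution is the integral of the explicit solutions. -/
theorem sys_prim_zero {m : ℝ} (hm : 0 < m) (a : ℝ) :
    p.Sys m (fun ξ => expPrim ξ a) 0 0 (∫ b in (0 : ℝ)..a, p.psiHat m 0 b)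
      (∫ b in (0 : ℝ)..a, p.omegaHat m 0 b) := by
  have h := fun b => (p.sys_delta_zero_iff hm b (p.psiHat m 0 b) (p.omegaHat m 0 b)).2 ⟨rfl, rfl⟩
  have key : ∀ V, (∀ b, p.SysEq V m (deltaHat b) 0 0 (p.psiHat m 0 b) (p.omegaHat m 0 b)) →
      p.SysEq V m (fun ξ => expPrim ξ a) 0 0 (∫ b in (0 : ℝ)..a, p.psiHat m 0 b)
        (∫ b in (0 : ℝ)..a, p.omegaHat m 0 b) := fun V hV => by
    simp only [sysEq_iff] at hV ⊢
    simp only [deltaHat, Pi.zero_apply, mul_zero, zero_add, zero_sub] at hV ⊢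
    rw [← neg_mul]
    refine integral_linear_eq (continuous_psiHat m 0) (continuous_omegaHat m 0) (fun b => ?_) a
    rw [hV]; ring
  exact ⟨key _ fun b => (h b).1, key _ fun b => (h b).2⟩

/-- For a start in regime 1 one has `ψ(0) = 1`, which adds the explicit solution for constant data
to the integrated delta solutions. -/
theorem sys_prim_one {m : ℝ} (hm : 0 < m) (a : ℝ) :
    p.Sys m 0 (fun ξ => expPrim ξ a) 1 (p.ψ₂Hat 1 m + ∫ b in (0 : ℝ)..a, p.psiHat m 1 b)
      (p.ω₂Hat 1 m + ∫ b in (0 : ℝ)..a, p.omegaHat m 1 b) := by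
  have h := fun b => (p.sys_delta_one_iff hm b (p.psiHat m 1 b) (p.omegaHat m 1 b)).2 ⟨rfl, rfl⟩
  have h2 := (p.sys_const_iff hm 1 (p.ψ₂Hat 1 m) (p.ω₂Hat 1 m)).2 ⟨rfl, rfl⟩
  have key : ∀ V, (∀ b, p.SysEq V m 0 (deltaHat b) 0 (p.psiHat m 1 b) (p.omegaHat m 1 b)) →
      p.SysEq V m 0 0 1 (p.ψ₂Hat 1 m) (p.ω₂Hat 1 m) →
      p.SysEq V m 0 (fun ξ => expPrim ξ a) 1 (p.ψ₂Hat 1 m + ∫ b in (0 : ℝ)..a, p.psiHat m 1 b)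
        (p.ω₂Hat 1 m + ∫ b in (0 : ℝ)..a, p.omegaHat m 1 b) := fun V hV h2 => by
    simp only [sysEq_iff] at hV h2 ⊢
    simp only [deltaHat, Pi.zero_apply, mul_zero, zero_add, sub_zero, add_zero] at hV h2 ⊢
    have := integral_linear_eq (continuous_psiHat m 1) (continuous_omegaHat m 1) hV a
    linear_combination this + h2
  exact ⟨key _ (fun b => (h b).1) h2.1, key _ (fun b => (h b).2) h2.2⟩

/-- The Laplace transforms of the boundary functions for a deterministic start. -/
theorem laplace_evol {m : ℝ} (hm : 0 < m) (i : Fin 2) {a : ℝ} (ha : a ∈ Icc 0 p.B) :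
    HasLaplace (fun t => (p.evol (upTo 1 0) i a t).toReal) m
      ((if i = 0 then 0 else p.ψ₂Hat 1 m) + ∫ b in (0 : ℝ)..a, p.psiHat m i b) ∧
    HasLaplace (fun t => (p.evol (upTo 1 p.B) i a t).toReal) m
      ((if i = 0 then 0 else p.ω₂Hat 1 m) + ∫ b in (0 : ℝ)..a, p.omegaHat m i b) := by
  set ρ : Measure (ℝ × Fin 2) := Measure.dirac (a, i)
  have hmean : ∀ f t, p.mean ρ f t = p.evol f i a t := fun f t => by
    rw [mean, lintegral_dirac]
  have hdist : ∀ x, (fun t => p.dist ρ 1 t x) = fun t => (p.evol (upTo 1 x) i a t).toReal :=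
    fun x => by funext t; rw [dist, hmean]
  have hρ : ∀ᵐ z ∂ρ, z.1 ∈ Icc 0 p.B := by
    rw [ae_dirac_iff (measurable_fst measurableSet_Icc)]; exact ha
  have hsys := sys_dist hρ hm
  have hl : ∀ s, p.lapl ρ s 0 = fun ξ => if i = s then expPrim ξ a else 0 := fun s => by
    funext ξ
    rw [lapl, hmean, evol_zero _ _ ha, onRegime]
    split_ifs
    · rw [ENNReal.toReal_ofReal (expPrim_nonneg ξ ha.1)]
    · rfl
  have hd : p.dist ρ 1 0 0 = if i = 1 then 1 else 0 := by
    rw [dist, hmean, evol_zero _ _ ha, upTo, onRegime]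
    split_ifs <;> simp_all
  rw [hl, hl, hd] at hsys
  have hval : laplace (fun t => p.dist ρ 1 t 0) m =
        (if i = 0 then 0 else p.ψ₂Hat 1 m) + ∫ b in (0 : ℝ)..a, p.psiHat m i b ∧
      laplace (fun t => p.dist ρ 1 t p.B) m =
        (if i = 0 then 0 else p.ω₂Hat 1 m) + ∫ b in (0 : ℝ)..a, p.omegaHat m i b := by
    by_cases hi : i = 0
    · subst hi
      simp only [if_true, zero_ne_one, if_false, zero_add] at hsys ⊢
      exact sys_unique hm hsys (sys_prim_zero hm a)
    · have hi : i = 1 := by omega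
      subst hi
      simp only [if_true, one_ne_zero, if_false] at hsys ⊢
      exact sys_unique hm hsys (sys_prim_one hm a)
  rw [← hval.1, ← hval.2, ← hdist, ← hdist]
  exact ⟨hasLaplace_dist 1 0 hm, hasLaplace_dist 1 p.B hm⟩

theorem evol_upTo_le_one (s : Fin 2) (x : ℝ) (i : Fin 2) (a t : ℝ) :
    p.evol (upTo s x) i a t ≤ 1 :=
  evol_le_one (measurable_upTo s x) (upTo_le_one s x) i a t

theorem evol_upTo_ne_top (s : Fin 2) (x : ℝ) (i : Fin 2) (a t : ℝ) :
    p.evol (upTo s x) i a t ≠ ∞ :=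
  ((evol_upTo_le_one s x i a t).trans_lt ENNReal.one_lt_top).ne

theorem laplace_toReal_nonneg {g : ℝ → ℝ≥0∞} {m v : ℝ}
    (h : HasLaplace (fun t => (g t).toReal) m v) : 0 ≤ v := by
  rw [← h.2]
  exact setIntegral_nonneg measurableSet_Ioi fun t _ =>
    mul_nonneg (Real.exp_pos _).le ENNReal.toReal_nonneg

theorem lap_psiDiff {m : ℝ} (hm : 0 < m) (i : Fin 2) {a : ℝ} (ha : a ∈ Icc 0 p.B) :
    0 ≤ p.psiHat m i a ∧ lap (p.psiDiff i a) m = ENNReal.ofReal (p.psiHat m i a) := by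
  refine isPrim_psiDiff.lap_eq (g₀ := fun _ _ _ => 0)
    (fun i => measurable_evol_time (measurable_upTo 1 0) i 0) measurable_psiDiff
    (fun _ => measurable_const) psiDiff_eq hm (continuous_psiHat m)
    (C := fun i => if i = 0 then 0 else p.ψ₂Hat 1 m)
    (fun i a ha => laplace_toReal_nonneg (laplace_evol hm i ha).1)
    (fun i a ha => (laplace_evol hm i ha).1.lap_eq (fun t ht => evol_of_neg _ _ _ ht)
      (evol_upTo_ne_top 1 0 i a)) (fun i => ?_) i ha
  simp only [lap, mul_zero, lintegral_zero]
  exact continuousOn_const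

theorem lap_atom_one (a : ℝ) {m : ℝ} (hm : 0 < m) : lap (p.atom 1 a) m =
    ENNReal.ofReal m⁻¹ * (p.arrivalMass a * ENNReal.ofReal (Real.exp (-(m * p.arrival a)))) := by
  have h := lap_measure_Iic (p.arrivalMass a • Measure.dirac (p.arrival a)) hm
  rw [lintegral_smul_measure, lintegral_dirac, smul_eq_mul] at h
  rw [← h]
  congr 1
  funext t
  rw [Measure.smul_apply, Measure.dirac_apply' _ measurableSet_Iic, smul_eq_mul, atom, if_pos rfl]
  simp [indicator]

theorem continuousOn_lap_atom {m : ℝ} (hm : 0 < m) (i : Fin 2) :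
    ContinuousOn (fun a => lap (p.atom i a) m) (Icc 0 p.B) := by
  by_cases hi : i = 0
  · subst hi
    simp only [lap, atom, zero_ne_one, if_false, mul_zero, lintegral_zero]
    exact continuousOn_const
  · have hi : i = 1 := by omega
    subst hi
    refine ContinuousOn.congr (f := fun a => ENNReal.ofReal (m⁻¹ * ((p.μ 1)⁻¹ *
      (Real.exp (-(p.Λ 1 * p.arrival a)) * Real.exp (-(m * p.arrival a)))))) ?_ fun a ha => ?_
    · refine (ENNReal.continuous_ofReal.comp ?_).continuousOn
      unfold arrival
      fun_prop
    · have h0 : 0 ≤ p.arrival a := div_nonneg (by linarith [ha.2]) p.μ_one_pos.le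
      have h1 : 0 ≤ (p.μ 1)⁻¹ := inv_nonneg.2 p.μ_one_pos.le
      beta_reduce
      rw [lap_atom_one a hm, arrivalMass, tail_of_nonneg h0, mul_assoc,
        ENNReal.ofReal_mul (inv_nonneg.2 hm.le), ENNReal.ofReal_mul h1,
        ENNReal.ofReal_mul (Real.exp_pos _).le]

/-- Integration in time multiplies transforms by `1/m`, so `IsPrim.lap_eq` is applied with `h = m⁻¹
* omegaHat`. The required continuity in `a` holds for the transform of the atom, though not for the
atom itself. -/
theorem lap_cumOmegaDiff {m : ℝ} (hm : 0 < m) (i : Fin 2) {a : ℝ} (ha : a ∈ Icc 0 p.B) :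
    0 ≤ p.omegaHat m i a ∧
      lap (p.cumOmegaDiff i a) m = ENNReal.ofReal m⁻¹ * ENNReal.ofReal (p.omegaHat m i a) := by
  have hm' : 0 < m⁻¹ := inv_pos.2 hm
  have e : ∀ i a, m⁻¹ * (if i = 0 then 0 else p.ω₂Hat 1 m) +
      ∫ b in (0 : ℝ)..a, m⁻¹ * p.omegaHat m i b = m⁻¹ * ((if i = 0 then 0 else p.ω₂Hat 1 m) +
        ∫ b in (0 : ℝ)..a, p.omegaHat m i b) := fun i a => by
    rw [intervalIntegral.integral_const_mul, mul_add]
  have key := isPrim_cumOmegaDiff.lap_eq (g₀ := p.atom)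
    (fun i => (measurable_past (measurable_evol (p := p) (measurable_upTo 1 p.B) i)).comp
      (f := fun t => (0, t)) (by fun_prop)) measurable_cumOmegaDiff
    measurable_atom cumOmegaDiff_eq hm (h := fun i a => m⁻¹ * p.omegaHat m i a)
    (fun i => (continuous_omegaHat m i).const_mul _)
    (C := fun i => m⁻¹ * if i = 0 then 0 else p.ω₂Hat 1 m)
    (fun i a ha => by
      rw [e]; exact mul_nonneg hm'.le (laplace_toReal_nonneg (laplace_evol hm i ha).2))
    (fun i a ha => by
      rw [e, lap_past (measurable_evol_time (measurable_upTo 1 p.B) i a) hm,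
        (laplace_evol hm i ha).2.lap_eq (fun t ht => evol_of_neg _ _ _ ht)
          (evol_upTo_ne_top 1 p.B i a), ENNReal.ofReal_mul hm'.le])
    (continuousOn_lap_atom hm) i ha
  exact ⟨nonneg_of_mul_nonneg_right key.1 hm', by rw [key.2, ENNReal.ofReal_mul hm'.le]⟩

theorem omegaDiff_measurable_time (i : Fin 2) (a : ℝ) : Measurable (p.omegaDiff i a) :=
  (measurable_omegaDiff i).comp (f := fun t => (a, t)) (by fun_prop)

theorem cumOmegaDiff_zero (a t : ℝ) : p.cumOmegaDiff 0 a t = past (p.omegaDiff 0 a) t := by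
  rw [cumOmegaDiff_eq_past, atom, if_neg zero_ne_one, zero_add]

theorem lap_omegaDiff_zero {m : ℝ} (hm : 0 < m) {a : ℝ} (ha : a ∈ Icc 0 p.B) :
    lap (p.omegaDiff 0 a) m = ENNReal.ofReal (p.omegaHat m 0 a) := by
  have h := (lap_cumOmegaDiff hm 0 ha).2
  have e : p.cumOmegaDiff 0 a = past (p.omegaDiff 0 a) := funext fun t => cumOmegaDiff_zero a t
  rw [e, lap_past (omegaDiff_measurable_time 0 a) hm] at h
  exact (ENNReal.mul_right_inj (by simpa using hm) ENNReal.ofReal_ne_top).1 h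

/-! ### Vanishing at negative times -/

section Causality

theorem kill_of_neg {g : Fin 2 → ℝ → ℝ → ℝ≥0∞} (hg : ∀ i a, ∀ t < 0, g i a t = 0) (i : Fin 2)
    (a : ℝ) {t : ℝ} (ht : t < 0) : p.kill g i a t = 0 := by
  rw [kill, ← lintegral_zero (μ := (volume : Measure ℝ))]
  refine lintegral_congr fun τ => ?_
  rcases lt_or_ge τ 0 with h | h
  · rw [dens_of_neg h, zero_mul]
  · rw [hg _ _ _ (by linarith), mul_zero, mul_zero]

theorem src_of_neg {G : ℝ → ℝ≥0∞} (hG : ∀ t < 0, G t = 0) (i : Fin 2) (a : ℝ) {t : ℝ}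
    (ht : t < 0) : p.src G i a t = 0 := by
  unfold src
  split_ifs
  · rcases lt_or_ge (a / -p.μ 0) 0 with h | h
    · rw [dens_of_neg h, zero_mul, mul_zero]
    · rw [hG _ (by linarith), mul_zero, mul_zero]
  · rfl

theorem diff_of_neg {G : ℕ → ℝ → ℝ≥0∞} {g₀ : Fin 2 → ℝ → ℝ → ℝ≥0∞}
    (hG : ∀ n, ∀ t < 0, G n t = 0) (hg : ∀ i a, ∀ t < 0, g₀ i a t = 0) (i : Fin 2) (a : ℝ) {t : ℝ}
    (ht : t < 0) : p.diff G g₀ i a t = 0 := by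
  have key : ∀ n i a, ∀ t < 0, p.diffN G g₀ n i a t = 0 := fun n => by
    induction n with
    | zero => exact hg
    | succ n ih =>
      intro i a t ht
      change p.src (G n) i a t + p.kill (p.diffN G g₀ n) i a t = 0
      rw [src_of_neg (hG n) i a ht, kill_of_neg ih i a ht, add_zero]
  rw [diff, ENNReal.tsum_eq_zero]
  exact fun n => key n i a t ht

theorem psiDiff_of_neg (i : Fin 2) (a : ℝ) {t : ℝ} (ht : t < 0) : p.psiDiff i a t = 0 :=
  diff_of_neg (fun n _ ht => evolN_of_neg _ n 1 0 ht) (fun _ _ _ _ => rfl) i a ht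

/-- The time `t` is `τ` plus the travel time from the switch to `B`. For `τ ≥ 0` a negative `t`
would place the switch beyond `B`, where `absorb` vanishes. -/
theorem hit_of_neg (i : Fin 2) (a : ℝ) {t : ℝ} (ht : t < 0) : p.hit i a t = 0 := by
  unfold hit
  split_ifs
  swap
  · rfl
  set τ := (t - p.arrival a) / p.slope with hτ
  rcases lt_or_ge τ 0 with h | h
  · rw [dens_of_neg h, zero_mul, mul_zero]
  · have h1 : p.arrival (a + p.μ 0 * τ) + τ = t := by
      have h2 : p.slope * τ = t - p.arrival a := by
        rw [hτ, mul_div_cancel₀ _ slope_pos.ne']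
      have h3 : p.arrival (a + p.μ 0 * τ) + τ = p.arrival a + p.slope * τ := by
        have := p.μ_one_pos
        unfold arrival slope; field_simp; ring
      linarith
    have h4 : ¬ a + p.μ 0 * τ ≤ p.B := fun h5 => by
      have : 0 ≤ p.arrival (a + p.μ 0 * τ) := div_nonneg (by linarith) p.μ_one_pos.le
      linarith
    rw [absorb, if_neg fun h5 => h4 h5.2, zero_mul, mul_zero, mul_zero]

theorem omegaDiff_of_neg (i : Fin 2) (a : ℝ) {t : ℝ} (ht : t < 0) : p.omegaDiff i a t = 0 :=
  diff_of_neg (fun n t ht => evolN_of_neg _ (n + 1) 1 0 ht) (fun i a t ht => by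
    rw [src_of_neg (fun t ht => evolN_of_neg _ 0 1 0 ht) i a ht, hit_of_neg i a ht, add_zero]) i a ht

end Causality

/-! ### The measure `ω¹` -/

/-- The measure `ω¹_a`: an atom at the time of arrival without any switch, and a density. -/
def omegaKernel (p : Params) : Kernel ℝ ℝ :=
  Kernel.withDensity (Kernel.deterministic p.arrival measurable_arrival)
    (fun a _ => p.arrivalMass a) +
  Kernel.withDensity (Kernel.const ℝ volume) (p.omegaDiff 1)

theorem omegaKernel_apply (a : ℝ) : p.omegaKernel a =
    (Measure.dirac (p.arrival a)).withDensity (fun _ => p.arrivalMass a) +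
      volume.withDensity (p.omegaDiff 1 a) := by
  rw [omegaKernel, add_apply, Kernel.withDensity_apply, Kernel.withDensity_apply,
    Kernel.deterministic_apply, Kernel.const_apply]
  · exact measurable_omegaDiff 1
  · exact measurable_arrivalMass.comp measurable_fst

theorem omegaKernel_Iic (a t : ℝ) : p.omegaKernel a (Iic t) = p.cumOmegaDiff 1 a t := by
  rw [omegaKernel_apply, cumOmegaDiff_eq_past, Measure.add_apply, withDensity_Iic,
    withDensity_const, Measure.smul_apply, Measure.dirac_apply' _ measurableSet_Iic, smul_eq_mul,
    atom, if_pos rfl]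
  simp [indicator]

theorem omegaKernel_Iio {a : ℝ} (ha : a ∈ Icc 0 p.B) : p.omegaKernel a (Iio 0) = 0 := by
  have h0 : 0 ≤ p.arrival a := div_nonneg (by linarith [ha.2]) p.μ_one_pos.le
  rw [omegaKernel_apply, Measure.add_apply, withDensity_const, Measure.smul_apply,
    Measure.dirac_apply' _ measurableSet_Iio, withDensity_apply _ measurableSet_Iio,
    setLIntegral_congr_fun (g := fun _ => 0) measurableSet_Iio
      (fun s hs => omegaDiff_of_neg 1 a hs)]
  simp [indicator, not_lt.2 h0]

theorem omegaKernel_Icc {a : ℝ} (ha : a ∈ Icc 0 p.B) (t : ℝ) :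
    p.omegaKernel a (Icc 0 t) = p.cumOmegaDiff 1 a t := by
  rw [← omegaKernel_Iic]
  refine measure_congr ?_
  have : ∀ᵐ s ∂(p.omegaKernel a), s ∉ Iio (0 : ℝ) := measure_eq_zero_iff_ae_notMem.1 (omegaKernel_Iio ha)
  filter_upwards [this] with s hs
  have hs : 0 ≤ s := not_lt.1 hs
  change (s ∈ Icc 0 t) = (s ∈ Iic t)
  simp [hs]

theorem hasLaplaceMeasure_omegaKernel {m : ℝ} (hm : 0 < m) {a : ℝ} (ha : a ∈ Icc 0 p.B) :
    HasLaplaceMeasure (p.omegaKernel a) m (p.ω₁Hat m a) := by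
  obtain ⟨h0, h1⟩ := lap_cumOmegaDiff hm 1 ha
  have hs : SFinite (p.omegaKernel a) := by rw [omegaKernel_apply]; infer_instance
  have e : p.cumOmegaDiff 1 a = fun t => p.omegaKernel a (Iic t) :=
    funext fun t => (omegaKernel_Iic a t).symm
  rw [e, lap_measure_Iic _ hm, ENNReal.mul_right_inj (by simpa using hm) ENNReal.ofReal_ne_top] at h1
  have hω : p.omegaHat m 1 a = p.ω₁Hat m a := rfl
  rw [hω] at h0 h1
  refine ⟨omegaKernel_Iio ha, ⟨by fun_prop, ?_⟩, ?_⟩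
  · rw [hasFiniteIntegral_iff_ofReal (.of_forall fun _ => (Real.exp_pos _).le), h1]
    exact ENNReal.ofReal_lt_top
  · rw [integral_eq_lintegral_of_nonneg_ae (.of_forall fun _ => (Real.exp_pos _).le) (by fun_prop),
      h1, ENNReal.toReal_ofReal h0]

end Params

theorem HasLaplace.const_mul {f : ℝ → ℝ} {m v : ℝ} (h : HasLaplace f m v) (c : ℝ) :
    HasLaplace (fun t => c * f t) m (c * v) := by
  have e : ∀ t, Real.exp (-(m * t)) * (c * f t) = c * (Real.exp (-(m * t)) * f t) :=
    fun t => mul_left_comm _ _ _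
  refine ⟨?_, ?_⟩
  · simp only [e]; exact h.1.const_mul c
  · simp only [laplace, e]
    rw [integral_const_mul, ← h.2, laplace]

namespace Params

/-! ### Superposition -/

section Superposition

variable {p : Params} {ρ : Measure (ℝ × Fin 2)} {G g : Fin 2 → ℝ → ℝ → ℝ≥0∞}

/-- Trading the upper limit `x` for the indicator of `b ≤ x` makes the dependence on the start a
mixture of `upTo` functions, whose averages over the initial law are the values `F_s(0, b)`. -/
theorem IsPrim.eq_add_upTo (h : p.IsPrim G g) (i : Fin 2) {x : ℝ} (hx : x ∈ Icc 0 p.B) (t : ℝ) :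
    G i x t = G 1 0 t * upTo 1 0 i x + ((∫⁻ b in Ioc 0 p.B, g 0 b t * upTo 0 b i x) +
      ∫⁻ b in Ioc 0 p.B, g 1 b t * upTo 1 b i x) := by
  have h1 : ∫⁻ b in Ioc 0 x, g i b t = ∫⁻ b in Ioc 0 p.B, g i b t * if b ≤ x then 1 else 0 := by
    rw [← lintegral_indicator measurableSet_Ioc, ← lintegral_indicator measurableSet_Ioc]
    refine lintegral_congr fun b => ?_
    by_cases h1 : 0 < b
    · by_cases h2 : b ≤ x
      · simp [indicator, h1, h2, h2.trans hx.2]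
      · simp [indicator, h2]
    · simp [indicator, h1]
  rw [h.eq_add i x hx, h1]
  by_cases hi : i = 0
  · subst hi
    simp [upTo, onRegime, h.zero]
  · have hi : i = 1 := by omega
    subst hi
    simp [upTo, onRegime, hx.1]

theorem lintegral_upTo_superposition [IsProbabilityMeasure ρ] (hρ : ∀ᵐ z ∂ρ, z.1 ∈ Icc 0 p.B)
    {v : ℝ → ℝ≥0∞} (hv : Measurable v) (s : Fin 2) :
    ∫⁻ z, (∫⁻ b in Ioc 0 p.B, v b * upTo s b z.2 z.1) ∂ρ =
      ∫⁻ b in Ioc 0 p.B, v b * p.mean ρ (upTo s b) 0 := by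
  have hm : Measurable fun z : ℝ × ℝ × Fin 2 => upTo s z.1 z.2.2 z.2.1 :=
    measurable_of_regime (measurable_upTo_param s)
  rw [lintegral_lintegral_swap (f := fun (z : ℝ × Fin 2) b => v b * upTo s b z.2 z.1)]
  · refine lintegral_congr fun b => ?_
    rw [lintegral_const_mul _ (measurable_test_pair (measurable_upTo s b)), mean_zero hρ]
  · exact ((hv.comp measurable_fst).mul hm).comp measurable_swap |>.aemeasurable

/-- Superposition with respect to the initial law. -/
theorem IsPrim.lintegral_eq [IsProbabilityMeasure ρ] (hρ : ∀ᵐ z ∂ρ, z.1 ∈ Icc 0 p.B)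
    (h : p.IsPrim G g) (hg : ∀ j, Measurable fun z : ℝ × ℝ => g j z.1 z.2) (t : ℝ) :
    ∫⁻ z, G z.2 z.1 t ∂ρ = G 1 0 t * p.mean ρ (upTo 1 0) 0 +
      ((∫⁻ b in Ioc 0 p.B, g 0 b t * p.mean ρ (upTo 0 b) 0) +
        ∫⁻ b in Ioc 0 p.B, g 1 b t * p.mean ρ (upTo 1 b) 0) := by
  have hgt : ∀ j, Measurable fun b => g j b t := fun j =>
    (hg j).comp (f := fun b => (b, t)) (by fun_prop)
  have hm : ∀ s, Measurable fun z : ℝ × Fin 2 => ∫⁻ b in Ioc 0 p.B, g s b t * upTo s b z.2 z.1 := by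
    intro s
    refine Measurable.lintegral_prod_right' (f := fun w : (ℝ × Fin 2) × ℝ =>
      g s w.2 t * upTo s w.2 w.1.2 w.1.1) ?_
    refine ((hgt s).comp measurable_snd).mul ?_
    exact (measurable_of_regime (g := fun z : ℝ × ℝ × Fin 2 => upTo s z.1 z.2.2 z.2.1)
      (measurable_upTo_param s)).comp measurable_swap
  have e : ∫⁻ z, G z.2 z.1 t ∂ρ = ∫⁻ z, (G 1 0 t * upTo 1 0 z.2 z.1 +
      ((∫⁻ b in Ioc 0 p.B, g 0 b t * upTo 0 b z.2 z.1) +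
      ∫⁻ b in Ioc 0 p.B, g 1 b t * upTo 1 b z.2 z.1)) ∂ρ := by
    refine lintegral_congr_ae ?_
    filter_upwards [hρ] with z hz
    exact h.eq_add_upTo z.2 hz t
  rw [e, lintegral_add_left ((measurable_test_pair (measurable_upTo 1 0)).const_mul _),
    lintegral_add_left (hm 0), lintegral_upTo_superposition hρ (hgt 0),
    lintegral_upTo_superposition hρ (hgt 1),
    lintegral_const_mul _ (measurable_test_pair (measurable_upTo 1 0)), mean_zero hρ]

theorem IsPrim.setLIntegral_ne_top (h : p.IsPrim G g) {t : ℝ} (hG : ∀ i, G i p.B t ≠ ∞) (i : Fin 2) :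
    ∫⁻ b in Ioc 0 p.B, g i b t ≠ ∞ := by
  refine ne_top_of_le_ne_top (hG i) ?_
  rw [h.eq_add i p.B ⟨p.B_pos.le, le_rfl⟩]
  exact le_add_self

theorem IsPrim.toReal_lintegral_eq [IsProbabilityMeasure ρ] (hρ : ∀ᵐ z ∂ρ, z.1 ∈ Icc 0 p.B)
    (h : p.IsPrim G g) (hg : ∀ j, Measurable fun z : ℝ × ℝ => g j z.1 z.2) {t : ℝ}
    (hG : ∀ i, ∀ a ∈ Icc 0 p.B, G i a t ≠ ∞) :
    (∫⁻ z, G z.2 z.1 t ∂ρ).toReal = (∫ b in (0 : ℝ)..p.B, (g 0 b t).toReal * p.dist ρ 0 0 b) +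
      (∫ b in (0 : ℝ)..p.B, (g 1 b t).toReal * p.dist ρ 1 0 b) +
      p.dist ρ 1 0 0 * (G 1 0 t).toReal := by
  have hfin := h.setLIntegral_ne_top (t := t) fun i => hG i p.B ⟨p.B_pos.le, le_rfl⟩
  have hle : ∀ s, ∫⁻ b in Ioc 0 p.B, g s b t * p.mean ρ (upTo s b) 0 ≠ ∞ := fun s => by
    refine ne_top_of_le_ne_top (hfin s) (lintegral_mono fun b => ?_)
    exact mul_le_of_le_one_right' (mean_le_one (measurable_upTo s b) (upTo_le_one s b) 0)
  have hm : ∀ s, Measurable fun b => g s b t * p.mean ρ (upTo s b) 0 := fun s =>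
    ((hg s).comp (f := fun b => (b, t)) (by fun_prop)).mul (measurable_mean_upTo s 0)
  have hint : ∀ s, (∫⁻ b in Ioc 0 p.B, g s b t * p.mean ρ (upTo s b) 0).toReal =
      ∫ b in (0 : ℝ)..p.B, (g s b t).toReal * p.dist ρ s 0 b := fun s => by
    rw [intervalIntegral.integral_of_le p.B_pos.le,
      ← integral_toReal (hm s).aemeasurable (ae_lt_top (hm s) (hle s))]
    simp only [ENNReal.toReal_mul, dist]
  have h10 := hG 1 0 ⟨le_rfl, p.B_pos.le⟩
  rw [h.lintegral_eq hρ hg, ENNReal.toReal_add (ENNReal.mul_ne_top h10 (mean_upTo_ne_top 1 0 0))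
    (ENNReal.add_ne_top.2 ⟨hle 0, hle 1⟩), ENNReal.toReal_add (hle 0) (hle 1), hint, hint,
    ENNReal.toReal_mul]
  unfold dist
  ring

end Superposition

variable (p : Params)

theorem integrableOn_toReal_of_isPrim {G g : Fin 2 → ℝ → ℝ → ℝ≥0∞} (h : p.IsPrim G g)
    (hg : ∀ j, Measurable fun z : ℝ × ℝ => g j z.1 z.2) {t : ℝ}
    (hG : ∀ i, G i p.B t ≠ ∞) (i : Fin 2) :
    IntegrableOn (fun a => (g i a t).toReal) (Icc 0 p.B) := by
  rw [integrableOn_Icc_iff_integrableOn_Ioc]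
  exact integrable_toReal_of_lintegral_ne_top
    ((hg i).comp (f := fun b => (b, t)) (by fun_prop)).aemeasurable (h.setLIntegral_ne_top hG i)

theorem past_evol_ne_top (i : Fin 2) (a : ℝ) {t : ℝ} (ht : 0 ≤ t) :
    past (p.evol (upTo 1 p.B) i a) t ≠ ∞ :=
  ne_top_of_le_ne_top (by finiteness)
    (past_le (fun s hs => evol_of_neg _ _ _ hs) (evol_upTo_le_one 1 p.B i a) ht)

theorem integrableOn_omegaDiff {t : ℝ} (ht : 0 ≤ t) :
    IntegrableOn (fun z : ℝ × ℝ => (p.omegaDiff 0 z.1 z.2).toReal) (Icc 0 p.B ×ˢ Icc 0 t) := by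
  have hm := measurable_omegaDiff (p := p) 0
  refine integrable_toReal_of_lintegral_ne_top hm.aemeasurable ?_
  rw [Measure.volume_eq_prod, ← Measure.prod_restrict, lintegral_prod _ hm.aemeasurable]
  refine ne_top_of_le_ne_top (isPrim_cumOmegaDiff.setLIntegral_ne_top (t := t)
    (fun i => p.past_evol_ne_top i p.B ht) 0) ?_
  rw [← setLIntegral_congr Ioc_ae_eq_Icc]
  refine lintegral_mono fun a => ?_
  rw [cumOmegaDiff_zero]
  exact lintegral_mono_set Icc_subset_Iic_self

/-- The fundamental solutions. -/
def fundamentalSolutions : FundamentalSolutions p where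
  ψ₀ a t := (p.psiDiff 0 a t).toReal
  ω₀ a t := (p.omegaDiff 0 a t).toReal
  ψ₁ a t := (p.psiDiff 1 a t).toReal
  ω₁ := p.omegaKernel
  -- The response to `ψ(0)` is the constant of integration in the starting point: the start at `0`
  -- in regime 1. Regime 0 contributes none, since a start at `0` is stopped there.
  ψ₂ c t := c * (p.evol (upTo 1 0) 1 0 t).toReal
  ω₂ c t := c * (p.evol (upTo 1 p.B) 1 0 t).toReal
  integrable_ψ₀ t _ := p.integrableOn_toReal_of_isPrim isPrim_psiDiff measurable_psiDiff
    (fun i => evol_upTo_ne_top 1 0 i p.B t) 0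
  integrable_ψ₁ t _ := p.integrableOn_toReal_of_isPrim isPrim_psiDiff measurable_psiDiff
    (fun i => evol_upTo_ne_top 1 0 i p.B t) 1
  integrable_ω₀ _ ht := p.integrableOn_omegaDiff ht
  integrable_ω₁ t ht := by
    refine (p.integrableOn_toReal_of_isPrim isPrim_cumOmegaDiff measurable_cumOmegaDiff
      (fun i => p.past_evol_ne_top i p.B ht) 1).congr_fun (fun a ha => ?_) measurableSet_Icc
    rw [measureReal_def, omegaKernel_Icc ha]

theorem ψ₂Hat_eq_mul (c m : ℝ) : p.ψ₂Hat c m = c * p.ψ₂Hat 1 m := by unfold ψ₂Hat; ring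

theorem ω₂Hat_eq_mul (c m : ℝ) : p.ω₂Hat c m = c * p.ω₂Hat 1 m := by unfold ω₂Hat; ring

/-- The Laplace transforms of the fundamental solutions. -/
theorem hasLaplace_fundamentalSolutions {m : ℝ} (hm : 0 < m) :
    (∀ a ∈ Icc 0 p.B,
      HasLaplace (p.fundamentalSolutions.ψ₀ a) m (p.ψ₀Hat m a) ∧
      HasLaplace (p.fundamentalSolutions.ω₀ a) m (p.ω₀Hat m a) ∧
      HasLaplace (p.fundamentalSolutions.ψ₁ a) m (p.ψ₁Hat m a) ∧
      HasLaplaceMeasure (p.fundamentalSolutions.ω₁ a) m (p.ω₁Hat m a)) ∧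
    ∀ c : ℝ,
      HasLaplace (p.fundamentalSolutions.ψ₂ c) m (p.ψ₂Hat c m) ∧
      HasLaplace (p.fundamentalSolutions.ω₂ c) m (p.ω₂Hat c m) := by
  have h0 : (0 : ℝ) ∈ Icc 0 p.B := ⟨le_rfl, p.B_pos.le⟩
  refine ⟨fun a ha => ⟨?_, ?_, ?_, hasLaplaceMeasure_omegaKernel hm ha⟩, fun c => ⟨?_, ?_⟩⟩
  · have h := lap_psiDiff hm 0 ha
    exact hasLaplace_of_lap ((measurable_psiDiff 0).comp (f := fun t => (a, t)) (by fun_prop))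
      (fun t ht => psiDiff_of_neg 0 a ht) h.1 h.2
  · exact hasLaplace_of_lap (omegaDiff_measurable_time 0 a)
      (fun t ht => omegaDiff_of_neg 0 a ht) (lap_cumOmegaDiff hm 0 ha).1 (lap_omegaDiff_zero hm ha)
  · have h := lap_psiDiff hm 1 ha
    exact hasLaplace_of_lap ((measurable_psiDiff 1).comp (f := fun t => (a, t)) (by fun_prop))
      (fun t ht => psiDiff_of_neg 1 a ht) h.1 h.2
  · rw [ψ₂Hat_eq_mul]
    have h := (laplace_evol hm 1 h0).1
    rw [intervalIntegral.integral_same, add_zero, if_neg one_ne_zero] at h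
    exact h.const_mul c
  · rw [ω₂Hat_eq_mul]
    have h := (laplace_evol hm 1 h0).2
    rw [intervalIntegral.integral_same, add_zero, if_neg one_ne_zero] at h
    exact h.const_mul c

theorem integral_omegaDiff {a : ℝ} (ha : a ∈ Icc 0 p.B) {t : ℝ} (ht : 0 ≤ t) :
    ∫ τ in (0 : ℝ)..t, (p.omegaDiff 0 a τ).toReal = (p.cumOmegaDiff 0 a t).toReal := by
  have hm := omegaDiff_measurable_time (p := p) 0 a
  -- The density is a sum in `[0, ∞]` without a pointwise bound at hand; its finite transform at `1`
  -- shows that it is finite for almost every time, so passing to real values loses nothing in the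
  -- integral.
  have hfin : ∀ᵐ τ, p.omegaDiff 0 a τ < ∞ := by
    have h := lap_omegaDiff_zero (p := p) one_pos ha
    have h2 := ae_lt_top (f := fun t => ENNReal.ofReal (Real.exp (-(1 * t))) * p.omegaDiff 0 a t)
      (μ := volume) (by fun_prop) (by rw [← lap, h]; exact ENNReal.ofReal_ne_top)
    filter_upwards [h2] with τ hτ
    exact ENNReal.lt_top_of_mul_ne_top_right hτ.ne (by simp [Real.exp_pos])
  rw [cumOmegaDiff_zero, past_eq_setLIntegral_Ioc (fun s hs => omegaDiff_of_neg 0 a hs) ht,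
    intervalIntegral.integral_of_le ht, integral_toReal hm.aemeasurable (ae_restrict_of_ae hfin)]

end Params

/-! ### Superposition for the process -/

namespace Driver

variable {p : Params} {Ω : Type*} [MeasurableSpace Ω] {P : Measure Ω} [IsProbabilityMeasure P]
  (X : Driver p P)

theorem ψ_superposition {t : ℝ} (ht : 0 ≤ t) :
    X.ψ t = (∫ a in (0 : ℝ)..p.B, p.fundamentalSolutions.ψ₀ a t * X.F 0 0 a)
      + (∫ a in (0 : ℝ)..p.B, p.fundamentalSolutions.ψ₁ a t * X.F 1 0 a)
      + p.fundamentalSolutions.ψ₂ (X.ψ 0) t := by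
  simp only [X.F_eq_dist _ le_rfl, X.ψ_eq ht, X.ψ_eq le_rfl]
  exact Params.isPrim_psiDiff.toReal_lintegral_eq X.init_mem Params.measurable_psiDiff
    fun i a _ => Params.evol_upTo_ne_top 1 0 i a t

theorem ω_superposition {t : ℝ} (ht : 0 ≤ t) :
    ∫ τ in (0 : ℝ)..t, X.ω τ =
      (∫ a in (0 : ℝ)..p.B, (∫ τ in (0 : ℝ)..t, p.fundamentalSolutions.ω₀ a τ) * X.F 0 0 a)
      + (∫ a in (0 : ℝ)..p.B, (p.fundamentalSolutions.ω₁ a).real (Icc 0 t) * X.F 1 0 a)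
      + ∫ τ in (0 : ℝ)..t, p.fundamentalSolutions.ω₂ (X.ψ 0) τ := by
  have key := Params.isPrim_cumOmegaDiff.toReal_lintegral_eq X.init_mem
    Params.measurable_cumOmegaDiff fun i a _ => p.past_evol_ne_top i a ht
  have hmean := Params.measurable_mean (p := p) (ρ := X.init) (Params.measurable_upTo 1 p.B)
  rw [Params.past_mean (Params.measurable_upTo 1 p.B),
    toReal_past hmean (fun s hs => Params.mean_of_neg _ hs)
      (fun s => Params.mean_upTo_ne_top 1 s p.B) ht,
    toReal_past (Params.measurable_evol_time (Params.measurable_upTo 1 p.B) 1 0)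
      (fun s hs => Params.evol_of_neg _ _ _ hs) (Params.evol_upTo_ne_top 1 p.B 1 0) ht] at key
  have hω : ∫ τ in (0 : ℝ)..t, X.ω τ = ∫ τ in (0 : ℝ)..t, (p.mean X.init (upTo 1 p.B) τ).toReal := by
    refine intervalIntegral.integral_congr fun s hs => ?_
    rw [uIcc_of_le ht] at hs
    exact X.ω_eq hs.1
  rw [hω, key]
  congr 1
  · congr 1
    · refine intervalIntegral.integral_congr fun a ha => ?_
      rw [uIcc_of_le p.B_pos.le] at ha
      rw [X.F_eq_dist _ le_rfl, ← p.integral_omegaDiff ha ht]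
      rfl
    · refine intervalIntegral.integral_congr fun a ha => ?_
      rw [uIcc_of_le p.B_pos.le] at ha
      rw [X.F_eq_dist _ le_rfl, measureReal_def, ← Params.omegaKernel_Icc ha]
      rfl
  · rw [X.ψ_eq le_rfl, ← intervalIntegral.integral_const_mul]
    rfl

end Driver

end Telegraph

end

theorem mainTheorem1 (p : Telegraph.Params) :
    -- the square roots and the denominators in the formulas are not degenerate
    (∀ ξ : ℝ, 0 < p.q ξ) ∧
    (∀ m : ℝ, 0 < m → 0 < p.r m ∧ p.S₂ m ≠ 0 ∧ p.den m ≠ 0) ∧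
    -- the explicit formulas are the solutions of the linear system for the three kinds of data
    (∀ m : ℝ, 0 < m → ∀ Ψ Θ : ℝ,
      (∀ a ∈ Set.Icc 0 p.B,
        (p.Sys m (Telegraph.Params.deltaHat a) 0 0 Ψ Θ ↔ Ψ = p.ψ₀Hat m a ∧ Θ = p.ω₀Hat m a) ∧
        (p.Sys m 0 (Telegraph.Params.deltaHat a) 0 Ψ Θ ↔ Ψ = p.ψ₁Hat m a ∧ Θ = p.ω₁Hat m a)) ∧
      ∀ c : ℝ, p.Sys m 0 0 c Ψ Θ ↔ Ψ = p.ψ₂Hat c m ∧ Θ = p.ω₂Hat c m) ∧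
    -- fundamental solutions, depending on the parameters only, with these Laplace transforms
    ∃ S : Telegraph.FundamentalSolutions p,
      (∀ m : ℝ, 0 < m →
        (∀ a ∈ Set.Icc 0 p.B,
          Telegraph.HasLaplace (S.ψ₀ a) m (p.ψ₀Hat m a) ∧
          Telegraph.HasLaplace (S.ω₀ a) m (p.ω₀Hat m a) ∧
          Telegraph.HasLaplace (S.ψ₁ a) m (p.ψ₁Hat m a) ∧
          Telegraph.HasLaplaceMeasure (S.ω₁ a) m (p.ω₁Hat m a)) ∧
        ∀ c : ℝ,
          Telegraph.HasLaplace (S.ψ₂ c) m (p.ψ₂Hat c m) ∧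
          Telegraph.HasLaplace (S.ω₂ c) m (p.ω₂Hat c m)) ∧
      -- every telegraph process with these parameters, whatever its initial law
      ∀ {Ω : Type*} [MeasurableSpace Ω] (P : MeasureTheory.Measure Ω)
        [MeasureTheory.IsProbabilityMeasure P] (X : Telegraph.Driver p P),
        (∀ t : ℝ, 0 ≤ t →
          IntervalIntegrable X.φ MeasureTheory.volume 0 t ∧
          IntervalIntegrable X.ψ MeasureTheory.volume 0 t ∧
          IntervalIntegrable X.ω MeasureTheory.volume 0 t) ∧
        -- the transforms of the boundary functions exist and solve the linear system
        (∀ m : ℝ, 0 < m → ∃ Ψ Θ : ℝ,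
          Telegraph.HasLaplace X.ψ m Ψ ∧ Telegraph.HasLaplace X.ω m Θ ∧
          p.Sys m (X.L 0 0) (X.L 1 0) (X.ψ 0) Ψ Θ) ∧
        -- superposition
        (∀ t : ℝ, 0 ≤ t →
          X.ψ t = (∫ a in (0 : ℝ)..p.B, S.ψ₀ a t * X.F 0 0 a)
            + (∫ a in (0 : ℝ)..p.B, S.ψ₁ a t * X.F 1 0 a)
            + S.ψ₂ (X.ψ 0) t) ∧
        (∀ t : ℝ, 0 ≤ t →
          ∫ τ in (0 : ℝ)..t, X.ω τ =
            (∫ a in (0 : ℝ)..p.B, (∫ τ in (0 : ℝ)..t, S.ω₀ a τ) * X.F 0 0 a)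
            + (∫ a in (0 : ℝ)..p.B, (S.ω₁ a).real (Set.Icc 0 t) * X.F 1 0 a)
            + ∫ τ in (0 : ℝ)..t, S.ω₂ (X.ψ 0) τ) ∧
        -- the equation ψ' + Λ₁ ψ - Λ₀ φ = 0: in integrated form, almost everywhere, and at every
        -- point of continuity of φ
        (∀ t : ℝ, 0 ≤ t →
          X.ψ t - X.ψ 0 + ∫ τ in (0 : ℝ)..t, (p.Λ 1 * X.ψ τ - p.Λ 0 * X.φ τ) = 0) ∧
        (∀ᵐ t : ℝ, 0 < t → DifferentiableAt ℝ X.ψ t ∧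
          deriv X.ψ t + p.Λ 1 * X.ψ t - p.Λ 0 * X.φ t = 0) ∧
        (∀ t : ℝ, 0 < t → ContinuousAt X.φ t → DifferentiableAt ℝ X.ψ t ∧
          deriv X.ψ t + p.Λ 1 * X.ψ t - p.Λ 0 * X.φ t = 0) ∧
        -- the Laplace transforms of the distribution functions
        ∀ t : ℝ, 0 ≤ t → ∀ ξ : ℝ,
          X.L 0 t ξ = p.solL₀ X.φ X.ψ X.ω (X.L 0 0 ξ) (X.L 1 0 ξ) t ξ ∧
          X.L 1 t ξ = p.solL₁ X.φ X.ψ X.ω (X.L 0 0 ξ) (X.L 1 0 ξ) t ξ := by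
  refine ⟨p.q_pos, fun m hm => ⟨p.r_pos hm, (p.S₂_pos hm).ne', (p.den_pos hm).ne'⟩,
    fun m hm Ψ Θ => ⟨fun a _ => ⟨p.sys_delta_zero_iff hm a Ψ Θ, p.sys_delta_one_iff hm a Ψ Θ⟩,
      fun c => p.sys_const_iff hm c Ψ Θ⟩,
    p.fundamentalSolutions, fun m hm => p.hasLaplace_fundamentalSolutions hm, ?_⟩
  intro Ω _ P _ X
  exact ⟨fun t ht => ⟨X.intervalIntegrable_F 0 0 ht, X.intervalIntegrable_F 1 0 ht,
      X.intervalIntegrable_F 1 p.B ht⟩, fun m hm => X.sys hm, fun t ht => X.ψ_superposition ht,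
    fun t ht => X.ω_superposition ht, fun t ht => X.integrated_equation ht, X.ae_deriv_ψ,
    fun t ht hφ => X.deriv_ψ ht hφ, fun t ht ξ => X.L_eq_sol ht ξ⟩
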